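/- Let $G$ be a finite simple graph with $n$ vertices. A graph is chordal if it has no induced cycle of length at least $4$. A chordal graph $H$ on the vertex set of $G$ that contains all edges of $G$ and has clique number at most $w+1$ is called a witness that $G$ has treewidth at most $w$; the treewidth $\mathrm{tw}$ of $G$ is the smallest integer $w\ge 0$ for which there is such a witness. A $k$-coloring of $G$ is a map $\alpha\colon V(G)\to[k]$ with $\alpha(u)\ne\alpha(v)$ for every edge $uv$. A Kempe change takes a vertex $u$ and a color $c\ne\alpha(u)$ and exchanges the colors $\alpha(u)$ and $c$ on the connected component containing $u$ of the subgraph of $G$ induced by the vertices colored $\alpha(u)$ or $c$. (1) There is an absolute constant $C$ such that for every such $G$, every $k\ge \mathrm{tw}+1$ and any two $k$-colorings $\alpha,\beta$ of $G$, there is a sequence of at most $C\cdot\max(\mathrm{tw},1)\cdot n^2$ Kempe changes leading from $\alpha$ to $\beta$. (2) Such a sequence can be computed in time $k\cdot\mathrm{Poly}(n)$ from a witness for the treewidth: there are an algorithm (a program of a random access machine in which additions, truncated subtractions, tests and memory accesses have unit cost) and absolute constants $C,d$ such that, for all $n,k,w$ with $k\ge w+1$, given $n$, $k$, the adjacency matrices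 of a graph $G$ on $n$ vertices and of a witness $H$ that $G$ has treewidth at most $w$, and two $k$-colorings $\alpha,\beta$ of $G$, the algorithm outputs, within $C\cdot k\cdot(n+1)^d$ steps, a sequence of at most $C\cdot\max(w,1)\cdot n^2$ Kempe changes leading from $\alpha$ to $\beta$. -/

import Mathlib

namespace Kempe

universe u

/-! ### Chordal graphs and treewidth -/

/-- A graph is chordal if it has no induced cycle of length at least four. -/
def IsChordal {V : Type u} (H : SimpleGraph V) : Prop :=
  ∀ m : ℕ, 4 ≤ m → IsEmpty (SimpleGraph.cycleGraph m ↪g H)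

/-- `H` is a witness that the treewidth of `G` is at most `w`: a chordal graph on the same vertex
set that contains all edges of `G` and has no clique on `w + 2` vertices (clique number at most
`w + 1`). -/
structure IsTreewidthWitness {V : Type u} (G H : SimpleGraph V) (w : ℕ) : Prop where
  chordal : IsChordal H
  le : G ≤ H
  cliqueFree : H.CliqueFree (w + 2)

/-- The treewidth of a finite graph. -/
noncomputable def treewidth {V : Type u} [Fintype V] (G : SimpleGraph V) : ℕ :=
  sInf {w : ℕ | ∃ H : SimpleGraph V, IsTreewidthWitness G H w}

/-! ### Kempe changes -/

section Changes

variable {V : Type u} {G : SimpleGraph V} {k : ℕ}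

/-- The vertices whose colour is `c` or the colour of `u`. -/
def twoColoured (α : G.Coloring (Fin k)) (u : V) (c : Fin k) : Set V :=
  {x | α x = α u ∨ α x = c}

/-- The Kempe chain of `u` and `c`: the vertex set of the connected component containing `u` in
the subgraph of `G` induced by the colours `α u` and `c`. -/
def kempeChain (α : G.Coloring (Fin k)) (u : V) (c : Fin k) : Set V :=
  Subtype.val ''
    ((G.induce (twoColoured α u c)).connectedComponentMk ⟨u, Or.inl rfl⟩).supp

theorem kempeChain_subset (α : G.Coloring (Fin k)) (u : V) (c : Fin k) :
    kempeChain α u c ⊆ twoColoured α u c := by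
  rintro _ ⟨x, -, rfl⟩
  exact x.2

theorem mem_kempeChain_of_adj (α : G.Coloring (Fin k)) (u : V) (c : Fin k) {x y : V}
    (hx : x ∈ kempeChain α u c) (hxy : G.Adj x y) (hy : y ∈ twoColoured α u c) :
    y ∈ kempeChain α u c := by
  obtain ⟨x', hx', rfl⟩ := hx
  refine ⟨⟨y, hy⟩, ?_, rfl⟩
  rw [SimpleGraph.ConnectedComponent.mem_supp_iff] at hx' ⊢
  rw [← hx']
  refine SimpleGraph.ConnectedComponent.sound (SimpleGraph.Adj.reachable ?_)
  exact hxy.symm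

open Classical in
/-- The colour map obtained by exchanging the colours `α u` and `c` on their Kempe chain. -/
noncomputable def kempeSwap (α : G.Coloring (Fin k)) (u : V) (c : Fin k) (x : V) : Fin k :=
  if x ∈ kempeChain α u c then Equiv.swap (α u) c (α x) else α x

theorem kempeSwap_ne_aux (α : G.Coloring (Fin k)) (u : V) (c : Fin k) {x y : V}
    (hxy : G.Adj x y) (hx : x ∈ kempeChain α u c) : kempeSwap α u c x ≠ kempeSwap α u c y := by
  unfold kempeSwap
  rw [if_pos hx]
  by_cases hy : y ∈ kempeChain α u c
  · rw [if_pos hy]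
    exact fun h => α.valid hxy ((Equiv.swap (α u) c).injective h)
  · rw [if_neg hy]
    intro h
    apply hy
    refine mem_kempeChain_of_adj α u c hx hxy ?_
    rcases kempeChain_subset α u c hx with h1 | h1
    · rw [h1, Equiv.swap_apply_left] at h
      exact Or.inr h.symm
    · rw [h1, Equiv.swap_apply_right] at h
      exact Or.inl h.symm

theorem kempeSwap_ne (α : G.Coloring (Fin k)) (u : V) (c : Fin k) {x y : V}
    (hxy : G.Adj x y) : kempeSwap α u c x ≠ kempeSwap α u c y := by
  by_cases hx : x ∈ kempeChain α u c
  · exact kempeSwap_ne_aux α u c hxy hx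
  · by_cases hy : y ∈ kempeChain α u c
    · exact (kempeSwap_ne_aux α u c hxy.symm hy).symm
    · unfold kempeSwap
      rw [if_neg hx, if_neg hy]
      exact α.valid hxy

/-- The coloring obtained from `α` by the Kempe change at the vertex `u` with the colour `c`. -/
noncomputable def kempeChange (α : G.Coloring (Fin k)) (u : V) (c : Fin k) :
    G.Coloring (Fin k) :=
  SimpleGraph.Coloring.mk (kempeSwap α u c) (fun hxy => kempeSwap_ne α u c hxy)

/-- `l` lists Kempe changes (a vertex and a colour different from its current colour, for each
change) which, performed one after the other, lead from the first coloring to the second. -/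
def IsKempeSequence : G.Coloring (Fin k) → List (V × Fin k) → G.Coloring (Fin k) → Prop
  | α, [], β => α = β
  | α, (u, c) :: l, β => c ≠ α u ∧ IsKempeSequence (kempeChange α u c) l β

end Changes

/-! ### Random access machines

Programs with structured control flow over finitely many registers and an unbounded random access
memory, all holding natural numbers. The arithmetic is addition and truncated subtraction; every
operation, constant, register access and memory access costs one step. -/

/-- Expressions. -/
inductive Expr : Type
  | const (a : ℕ) : Expr
  | reg (x : ℕ) : Expr
  | load (e : Expr) : Expr
  | add (e f : Expr) : Expr
  | sub (e f : Expr) : Expr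

/-- Programs. -/
inductive Prog : Type
  | assign (x : ℕ) (e : Expr) : Prog
  | store (e f : Expr) : Prog
  | print (e : Expr) : Prog
  | seq (p q : Prog) : Prog
  | ite (e : Expr) (p q : Prog) : Prog
  | loop (e : Expr) (p : Prog) : Prog

/-- A configuration: registers, memory, and the words printed so far. -/
structure State : Type where
  reg : ℕ → ℕ
  mem : ℕ → ℕ
  out : List ℕ

/-- The value of an expression. -/
def Expr.eval (s : State) : Expr → ℕ
  | .const a => a
  | .reg x => s.reg x
  | .load e => s.mem (e.eval s)
  | .add e f => e.eval s + f.eval s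
  | .sub e f => e.eval s - f.eval s

/-- The number of steps for evaluating an expression. -/
def Expr.cost : Expr → ℕ
  | .const _ => 1
  | .reg _ => 1
  | .load e => e.cost + 1
  | .add e f => e.cost + f.cost + 1
  | .sub e f => e.cost + f.cost + 1

/-- `Run p s t s'`: the program `p`, started in `s`, halts in `s'` after exactly `t` steps.
A test is passed when the value of its expression is nonzero; `loop e p` repeats `p` as long as
the test `e` is passed. -/
inductive Run : Prog → State → ℕ → State → Prop
  | assign (x : ℕ) (e : Expr) (s : State) :
      Run (.assign x e) s (e.cost + 1) { s with reg := Function.update s.reg x (e.eval s) }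
  | store (e f : Expr) (s : State) :
      Run (.store e f) s (e.cost + f.cost + 1)
        { s with mem := Function.update s.mem (e.eval s) (f.eval s) }
  | print (e : Expr) (s : State) :
      Run (.print e) s (e.cost + 1) { s with out := s.out ++ [e.eval s] }
  | seq {p q : Prog} {s s' s'' : State} {t t' : ℕ} :
      Run p s t s' → Run q s' t' s'' → Run (.seq p q) s (t + t') s''
  | ite_true {e : Expr} {p : Prog} (q : Prog) {s s' : State} {t : ℕ} :
      e.eval s ≠ 0 → Run p s t s' → Run (.ite e p q) s (e.cost + 1 + t) s'
  | ite_false {e : Expr} (p : Prog) {q : Prog} {s s' : State} {t : ℕ} :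
      e.eval s = 0 → Run q s t s' → Run (.ite e p q) s (e.cost + 1 + t) s'
  | loop_true {e : Expr} {p : Prog} {s s' s'' : State} {t t' : ℕ} :
      e.eval s ≠ 0 → Run p s t s' → Run (.loop e p) s' t' s'' →
        Run (.loop e p) s (e.cost + 1 + t + t') s''
  | loop_false {e : Expr} (p : Prog) {s : State} :
      e.eval s = 0 → Run (.loop e p) s (e.cost + 1) s

/-- The initial configuration on a given input: the input stands at the beginning of the memory,
everything else is zero, and nothing has been printed. -/
def initial (input : List ℕ) : State where
  reg := fun _ => 0
  mem := fun i => input.getD i 0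
  out := []

/-- On the given input the program halts within `T` steps, having printed exactly `output`. -/
def OutputsWithin (p : Prog) (input output : List ℕ) (T : ℕ) : Prop :=
  ∃ (t : ℕ) (s : State), t ≤ T ∧ Run p (initial input) t s ∧ s.out = output

/-! ### Encoding of graphs, colorings and sequences of Kempe changes -/

open Classical in
/-- The adjacency matrix, row by row. -/
noncomputable def encodeGraph {n : ℕ} (G : SimpleGraph (Fin n)) : List ℕ :=
  (List.ofFn fun u : Fin n => List.ofFn fun v : Fin n => if G.Adj u v then 1 else 0).flatten

/-- The list of the colours. -/
def encodeColoring {n k : ℕ} {G : SimpleGraph (Fin n)} (α : G.Coloring (Fin k)) : List ℕ :=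
  List.ofFn fun u : Fin n => (α u : ℕ)

/-- The input: the number of vertices, the number of colours, the graph, a chordal supergraph of
it, and two colorings. -/
noncomputable def encodeInput {n k : ℕ} (G H : SimpleGraph (Fin n)) (α β : G.Coloring (Fin k)) :
    List ℕ :=
  [n, k] ++ encodeGraph G ++ encodeGraph H ++ encodeColoring α ++ encodeColoring β

/-- The output: the vertex and the colour of each Kempe change, in order. -/
def encodeMoves {n k : ℕ} (l : List (Fin n × Fin k)) : List ℕ :=
  l.flatMap fun m => [(m.1 : ℕ), (m.2 : ℕ)]

end Kempe

/-! Fix a perfect elimination order of the chordal supergraph `H`: the earlier `H`-neighbours N(l)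
of each vertex l form a clique, so there are at most w of them. It is enough to lead every
k-coloring of `G` to one canonical coloring, the greedy coloring of `H` along this order. Kempe
changes are reversible, so the sequence for α followed by the reversed sequence for β solves the
problem. The greedy colours are at most w, hence available.

A coloring f of `G` may have monochromatic `H`-edges; the recolouring never creates new ones. Its
basic move is an exchange: two colours a, c are swapped on a set D that is closed under `H`-edges
whose ends carry a and c. Since `G ≤ H`, D is a union of Kempe chains of `G`, so an exchange costs
at most n Kempe changes.

D is found by one scan of the order. It starts as {t}, where t is the first vertex without its
greedy colour and c is that greedy colour. A later vertex l is forced into D by an earlier neighbour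
in D carrying the other one of the two colours (`Touches`). This fails only if another earlier
neighbour of that other colour lies outside D (`Splits`). But then two vertices of N(l) share a
colour, so besides the colour of l some colour among 0, ..., |N(l)| is missing on N(l); the plan is
dropped and restarted at {l} with this colour.

The number of exchanges is bounded by a potential. Before the scan becomes active, a vertex counts 1
if its colour is not greedy and 0 otherwise. Afterwards l counts |N(l)| + 1 - |f(N(l))|, minus 1 if
D contains exactly one of two equally coloured vertices of N(l) while l does not force a restart. An
exchange started at t changes nothing before t and lowers the term of t by at least one: either t
becomes greedy, or t ceases to force a restart. At a later l the clique N(l) loses no colours, and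
gains one whenever the bonus was present, so the term does not grow. Hence `potential_exchange_lt`.
Each term is at most max(w, 1), which gives n · max(w, 1) exchanges and n² · max(w, 1) Kempe changes
for each of the two colorings.

The algorithm carries out this proof literally. It is written in a small language all of whose loops
run over i < n, so polynomial time follows by induction on the syntax (`Cmd.exists_prog`). The order
comes from repeatedly removing a simplicial vertex (Dirac's theorem, `IsChordal.exists_simplicial`).
Free colours are sought only below n, so the running time does not depend on k. Statement (1)
follows from the correctness of the algorithm after transport to `Fin n`. -/

namespace Kempe

/-! ### A small language compiled to random access machines -/

/-- Terms: natural numbers computed from the input, sixteen arrays and the local variables. Here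
`mulN t` is the product of `t` and the first input word `n`, and `find t` is the least `i < n` for
which `t` is nonzero (with `i` as the new local variable `0`), or `n` if there is none. -/
inductive Tm : Type
  | const (a : ℕ) : Tm
  | var (j : ℕ) : Tm
  | inp (t : Tm) : Tm
  | arr (A : Fin 16) (t : Tm) : Tm
  | add (t u : Tm) : Tm
  | sub (t u : Tm) : Tm
  | mulN (t : Tm) : Tm
  | find (t : Tm) : Tm

/-- Commands. `iter p` repeats `p` for `i = 0, …, n - 1`, and `bind t p` runs `p` with the value of
`t` as a new local variable. -/
inductive Cmd : Type
  | skip : Cmd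
  | set (A : Fin 16) (i v : Tm) : Cmd
  | print (t : Tm) : Cmd
  | seq (p q : Cmd) : Cmd
  | ite (t : Tm) (p q : Cmd) : Cmd
  | iter (p : Cmd) : Cmd
  | bind (t : Tm) (p : Cmd) : Cmd

/-- The global data on which commands act. -/
structure Store : Type where
  inp : ℕ → ℕ
  arr : Fin 16 → ℕ → ℕ
  out : List ℕ

/-! ### Bounded search and the semantics of the language -/

/-- The least `i < n` with `φ i`, or `n` if there is none. -/
noncomputable def leastBelow (n : ℕ) (φ : ℕ → Prop) : ℕ := sInf {i | n ≤ i ∨ φ i}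

theorem leastBelow_spec (n : ℕ) (φ : ℕ → Prop) : n ≤ leastBelow n φ ∨ φ (leastBelow n φ) :=
  Nat.sInf_mem (s := {i | n ≤ i ∨ φ i}) ⟨n, Or.inl le_rfl⟩

theorem leastBelow_le (n : ℕ) (φ : ℕ → Prop) : leastBelow n φ ≤ n :=
  Nat.sInf_le (s := {i | n ≤ i ∨ φ i}) (Or.inl le_rfl)

theorem leastBelow_le_of {n i : ℕ} {φ : ℕ → Prop} (h : φ i) : leastBelow n φ ≤ i :=
  Nat.sInf_le (s := {i | n ≤ i ∨ φ i}) (Or.inr h)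

theorem not_of_lt_leastBelow {n i : ℕ} {φ : ℕ → Prop} (h : i < leastBelow n φ) : ¬ φ i :=
  fun h' => absurd (leastBelow_le_of h') (not_le.mpr h)

theorem of_leastBelow_lt {n : ℕ} {φ : ℕ → Prop} (h : leastBelow n φ < n) : φ (leastBelow n φ) :=
  (leastBelow_spec n φ).resolve_left (not_le.mpr h)

theorem leastBelow_eq {n i : ℕ} {φ : ℕ → Prop} (hi : i ≤ n) (h : n ≤ i ∨ φ i)
    (hlt : ∀ j < i, ¬ φ j) : leastBelow n φ = i := by
  apply le_antisymm
  · rcases h with h | h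
    · exact (leastBelow_le n φ).trans h
    · exact leastBelow_le_of h
  · by_contra hc
    push Not at hc
    exact hlt _ hc (of_leastBelow_lt (hc.trans_le hi))

theorem leastBelow_lt_iff {n : ℕ} {φ : ℕ → Prop} : leastBelow n φ < n ↔ ∃ i < n, φ i :=
  ⟨fun h => ⟨_, h, of_leastBelow_lt h⟩, fun ⟨_, hi, h⟩ => (leastBelow_le_of h).trans_lt hi⟩

theorem leastBelow_congr {n : ℕ} {φ ψ : ℕ → Prop} (h : ∀ i < n, (φ i ↔ ψ i)) :
    leastBelow n φ = leastBelow n ψ := by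
  refine leastBelow_eq (leastBelow_le _ _) ?_ fun j hj hφ => not_of_lt_leastBelow hj
    ((h j (hj.trans_le (leastBelow_le _ _))).mp hφ)
  rcases (leastBelow_le n ψ).lt_or_eq with h' | h'
  · exact Or.inr ((h _ h').mpr (of_leastBelow_lt h'))
  · exact Or.inl h'.ge

/-- The value of a term, with the list `e` of values of the local variables. -/
noncomputable def Tm.eval (σ : Store) : Tm → List ℕ → ℕ
  | .const a, _ => a
  | .var j, e => e.getD j 0
  | .inp t, e => σ.inp (t.eval σ e)
  | .arr A t, e => σ.arr A (t.eval σ e)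
  | .add t u, e => t.eval σ e + u.eval σ e
  | .sub t u, e => t.eval σ e - u.eval σ e
  | .mulN t, e => σ.inp 0 * t.eval σ e
  | .find t, e => leastBelow (σ.inp 0) fun i => t.eval σ (i :: e) ≠ 0

/-- Writing an array entry. -/
def Store.set (σ : Store) (A : Fin 16) (i v : ℕ) : Store :=
  { σ with arr := fun B j => if B = A ∧ j = i then v else σ.arr B j }

/-- The effect of a command. -/
noncomputable def Cmd.run : Cmd → Store → List ℕ → Store
  | .skip, σ, _ => σ
  | .set A i v, σ, e => σ.set A (i.eval σ e) (v.eval σ e)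
  | .print t, σ, e => { σ with out := σ.out ++ [t.eval σ e] }
  | .seq p q, σ, e => q.run (p.run σ e) e
  | .ite t p q, σ, e => if t.eval σ e ≠ 0 then p.run σ e else q.run σ e
  | .iter p, σ, e => Nat.rec σ (fun i σ' => p.run σ' (i :: e)) (σ.inp 0)
  | .bind t p, σ, e => p.run σ (t.eval σ e :: e)

@[simp] theorem Store.set_inp (σ : Store) (A : Fin 16) (i v : ℕ) : (σ.set A i v).inp = σ.inp := rfl

@[simp] theorem Store.set_out (σ : Store) (A : Fin 16) (i v : ℕ) : (σ.set A i v).out = σ.out := rfl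

@[simp] theorem Store.set_arr (σ : Store) (A B : Fin 16) (i j v : ℕ) :
    (σ.set A i v).arr B j = if B = A ∧ j = i then v else σ.arr B j := rfl

@[simp] theorem Cmd.run_inp (p : Cmd) : ∀ (σ : Store) (e : List ℕ), (p.run σ e).inp = σ.inp := by
  induction p with
  | skip => intros; rfl
  | set => intros; rfl
  | print => intros; rfl
  | seq p q hp hq => intro σ e; simp [Cmd.run, hp, hq]
  | ite t p q hp hq => intro σ e; simp only [Cmd.run]; split_ifs <;> simp [hp, hq]
  | iter p hp =>
    intro σ e
    simp only [Cmd.run]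
    generalize σ.inp 0 = n
    induction n with
    | zero => rfl
    | succ n ih => simp [hp, ih]
  | bind t p hp => intro σ e; simp [Cmd.run, hp]

/-- The arrays that a command may write. -/
def Cmd.writes : Cmd → List (Fin 16)
  | .skip => []
  | .set A _ _ => [A]
  | .print _ => []
  | .seq p q => p.writes ++ q.writes
  | .ite _ p q => p.writes ++ q.writes
  | .iter p => p.writes
  | .bind _ p => p.writes

/-- Whether a command may print. -/
def Cmd.prints : Cmd → Bool
  | .skip => false
  | .set _ _ _ => false
  | .print _ => true
  | .seq p q => p.prints || q.prints
  | .ite _ p q => p.prints || q.prints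
  | .iter p => p.prints
  | .bind _ p => p.prints

/-- Frame rule: `writes` is a computable syntactic overapproximation, so for concrete commands the
hypothesis is settled by `decide`. -/
theorem Cmd.run_arr_of_notMem (p : Cmd) {A : Fin 16} (hA : A ∉ p.writes) :
    ∀ (σ : Store) (e : List ℕ), (p.run σ e).arr A = σ.arr A := by
  induction p with
  | skip => intros; rfl
  | set B i v =>
    intro σ e
    funext j
    have : A ≠ B := by simpa [Cmd.writes] using hA
    simp [Cmd.run, this]
  | print => intros; rfl
  | seq p q hp hq =>
    simp only [Cmd.writes, List.mem_append, not_or] at hA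
    intro σ e; simp [Cmd.run, hp hA.1, hq hA.2]
  | ite t p q hp hq =>
    simp only [Cmd.writes, List.mem_append, not_or] at hA
    intro σ e; simp only [Cmd.run]; split_ifs <;> simp [hp hA.1, hq hA.2]
  | iter p hp =>
    intro σ e
    simp only [Cmd.run]
    generalize σ.inp 0 = n
    induction n with
    | zero => rfl
    | succ n ih => simp [hp hA, ih]
  | bind t p hp => intro σ e; simp [Cmd.run, hp hA]

theorem Cmd.run_out_of_prints (p : Cmd) (hp : p.prints = false) :
    ∀ (σ : Store) (e : List ℕ), (p.run σ e).out = σ.out := by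
  induction p with
  | skip => intros; rfl
  | set => intros; rfl
  | print => simp [Cmd.prints] at hp
  | seq p q ihp ihq =>
    simp only [Cmd.prints, Bool.or_eq_false_iff] at hp
    intro σ e; simp [Cmd.run, ihp hp.1, ihq hp.2]
  | ite t p q ihp ihq =>
    simp only [Cmd.prints, Bool.or_eq_false_iff] at hp
    intro σ e; simp only [Cmd.run]; split_ifs <;> simp [ihp hp.1, ihq hp.2]
  | iter p ih =>
    intro σ e
    simp only [Cmd.run]
    generalize σ.inp 0 = n
    induction n with
    | zero => rfl
    | succ n ih' => simp [ih hp, ih']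
  | bind t p ih => intro σ e; simp [Cmd.run, ih hp]

/-! ### Compilation -/

/-- The expression for the address of the entry of the array `A` whose index is in register `r`;
register `0` holds the first address behind the input. -/
def addrExpr (A : Fin 16) (r : ℕ) : Expr :=
  let e₂ := Expr.add (.reg r) (.reg r)
  let e₄ := Expr.add e₂ e₂
  let e₈ := Expr.add e₄ e₄
  .add (.add (.reg 0) (.add e₈ e₈)) (.const A)

theorem addrExpr_eval (A : Fin 16) (r : ℕ) (s : State) :
    (addrExpr A r).eval s = s.reg 0 + 16 * s.reg r + A := by
  simp only [addrExpr, Expr.eval]; omega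

theorem addrExpr_cost (A : Fin 16) (r : ℕ) : (addrExpr A r).cost = 35 := rfl

/-- The expression for the first input word. -/
def sizeExpr : Expr := .load (.const 0)

/-- The program evaluating a term into register `r`; the local variables are in the registers
listed in `ρ`, and only registers from `r` on are changed. -/
def Tm.compile : Tm → List ℕ → ℕ → Prog
  | .const a, _, r => .assign r (.const a)
  | .var j, ρ, r => .assign r ((ρ.map Expr.reg).getD j (.const 0))
  | .inp t, ρ, r => .seq (t.compile ρ r)
      (.ite (.sub (.reg 0) (.reg r)) (.assign r (.load (.reg r))) (.assign r (.const 0)))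
  | .arr A t, ρ, r => .seq (t.compile ρ r) (.assign r (.load (addrExpr A r)))
  | .add t u, ρ, r => .seq (t.compile ρ r)
      (.seq (u.compile ρ (r + 1)) (.assign r (.add (.reg r) (.reg (r + 1)))))
  | .sub t u, ρ, r => .seq (t.compile ρ r)
      (.seq (u.compile ρ (r + 1)) (.assign r (.sub (.reg r) (.reg (r + 1)))))
  | .mulN t, ρ, r => .seq (t.compile ρ r) (.seq (.assign (r + 1) (.const 0))
      (.seq (.assign (r + 2) (.const 0))
        (.seq (.loop (.sub sizeExpr (.reg (r + 2)))
          (.seq (.assign (r + 1) (.add (.reg (r + 1)) (.reg r)))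
            (.assign (r + 2) (.add (.reg (r + 2)) (.const 1)))))
          (.assign r (.reg (r + 1))))))
  | .find t, ρ, r => .seq (.assign r (.const 0)) (.seq (.assign (r + 1) (.const 0))
      (.loop (.sub (.sub sizeExpr (.reg r)) (.reg (r + 1)))
        (.seq (t.compile (r :: ρ) (r + 2))
          (.ite (.reg (r + 2)) (.assign (r + 1) sizeExpr)
            (.assign r (.add (.reg r) (.const 1)))))))

/-- The program executing a command, with the same conventions. -/
def Cmd.compile : Cmd → List ℕ → ℕ → Prog
  | .skip, _, r => .assign r (.const 0)
  | .set A i v, ρ, r => .seq (i.compile ρ r)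
      (.seq (v.compile ρ (r + 1)) (.store (addrExpr A r) (.reg (r + 1))))
  | .print t, ρ, r => .seq (t.compile ρ r) (.print (.reg r))
  | .seq p q, ρ, r => .seq (p.compile ρ r) (q.compile ρ r)
  | .ite t p q, ρ, r => .seq (t.compile ρ r) (.ite (.reg r) (p.compile ρ r) (q.compile ρ r))
  | .iter p, ρ, r => .seq (.assign r (.const 0)) (.loop (.sub sizeExpr (.reg r))
      (.seq (p.compile (r :: ρ) (r + 1)) (.assign r (.add (.reg r) (.const 1)))))
  | .bind t p, ρ, r => .seq (t.compile ρ r) (p.compile (r :: ρ) (r + 1))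

/-- A bound for the running time of a compiled term. -/
def Tm.time : Tm → ℕ → ℕ
  | .const _, _ => 2
  | .var _, _ => 2
  | .inp t, n => t.time n + 10
  | .arr _ t, n => t.time n + 40
  | .add t u, n => t.time n + u.time n + 5
  | .sub t u, n => t.time n + u.time n + 5
  | .mulN t, n => t.time n + n * 20 + 20
  | .find t, n => n * (t.time n + 20) + 20

/-- A bound for the running time of a compiled command. -/
def Cmd.time : Cmd → ℕ → ℕ
  | .skip, _ => 2
  | .set _ i v, n => i.time n + v.time n + 40
  | .print t, n => t.time n + 2
  | .seq p q, n => p.time n + q.time n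
  | .ite t p q, n => t.time n + p.time n + q.time n + 5
  | .iter p, n => n * (p.time n + 20) + 20
  | .bind t p, n => t.time n + p.time n

/-! ### Polynomial running time -/

/-- Polynomially bounded functions. -/
def PolyBounded (f : ℕ → ℕ) : Prop := ∃ C d : ℕ, ∀ n, f n ≤ C * (n + 1) ^ d

theorem PolyBounded.const (a : ℕ) : PolyBounded fun _ => a := ⟨a, 0, fun n => by simp⟩

theorem PolyBounded.id : PolyBounded fun n => n := ⟨1, 1, fun n => by simp⟩

theorem PolyBounded.add {f g : ℕ → ℕ} (hf : PolyBounded f) (hg : PolyBounded g) :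
    PolyBounded fun n => f n + g n := by
  obtain ⟨C, d, hf⟩ := hf
  obtain ⟨C', d', hg⟩ := hg
  refine ⟨C + C', d + d', fun n => ?_⟩
  have h1 : (n + 1) ^ d ≤ (n + 1) ^ (d + d') := Nat.pow_le_pow_right (by omega) (by omega)
  have h2 : (n + 1) ^ d' ≤ (n + 1) ^ (d + d') := Nat.pow_le_pow_right (by omega) (by omega)
  calc f n + g n ≤ C * (n + 1) ^ d + C' * (n + 1) ^ d' := add_le_add (hf n) (hg n)
    _ ≤ C * (n + 1) ^ (d + d') + C' * (n + 1) ^ (d + d') := by gcongr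
    _ = _ := by ring

theorem PolyBounded.mul {f g : ℕ → ℕ} (hf : PolyBounded f) (hg : PolyBounded g) :
    PolyBounded fun n => f n * g n := by
  obtain ⟨C, d, hf⟩ := hf
  obtain ⟨C', d', hg⟩ := hg
  refine ⟨C * C', d + d', fun n => ?_⟩
  calc f n * g n ≤ (C * (n + 1) ^ d) * (C' * (n + 1) ^ d') := Nat.mul_le_mul (hf n) (hg n)
    _ = _ := by ring

theorem Tm.polyBounded_time (t : Tm) : PolyBounded t.time := by
  induction t with
  | const a => exact .const 2
  | var j => exact .const 2
  | inp t ih => exact ih.add (.const 10)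
  | arr A t ih => exact ih.add (.const 40)
  | add t u iht ihu => exact (iht.add ihu).add (.const 5)
  | sub t u iht ihu => exact (iht.add ihu).add (.const 5)
  | mulN t ih => exact (ih.add (PolyBounded.id.mul (.const 20))).add (.const 20)
  | find t ih => exact (PolyBounded.id.mul (ih.add (.const 20))).add (.const 20)

/-- Every loop has n rounds, so a loop multiplies the bound by about n, and the depth of nesting is
fixed by the syntax. -/
theorem Cmd.polyBounded_time (p : Cmd) : PolyBounded p.time := by
  induction p with
  | skip => exact .const 2
  | set A i v => exact (i.polyBounded_time.add v.polyBounded_time).add (.const 40)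
  | print t => exact t.polyBounded_time.add (.const 2)
  | seq p q hp hq => exact hp.add hq
  | ite t p q hp hq => exact ((t.polyBounded_time.add hp).add hq).add (.const 5)
  | iter p hp => exact (PolyBounded.id.mul (hp.add (.const 20))).add (.const 20)
  | bind t p hp => exact t.polyBounded_time.add hp

/-! ### Rules for timed total correctness of machine programs -/

/-- `p`, started in `s`, halts within `T` steps in a configuration with the property `Q`. -/
def Reaches (p : Prog) (s : State) (T : ℕ) (Q : State → Prop) : Prop :=
  ∃ t s', t ≤ T ∧ Run p s t s' ∧ Q s'

theorem Reaches.mono {p : Prog} {s : State} {T T' : ℕ} {Q Q' : State → Prop}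
    (h : Reaches p s T Q) (hT : T ≤ T') (hQ : ∀ s', Q s' → Q' s') : Reaches p s T' Q' := by
  obtain ⟨t, s', ht, hr, hq⟩ := h
  exact ⟨t, s', ht.trans hT, hr, hQ _ hq⟩

theorem Reaches.assign {x : ℕ} {e : Expr} {s : State} {Q : State → Prop}
    (h : Q { s with reg := Function.update s.reg x (e.eval s) }) :
    Reaches (.assign x e) s (e.cost + 1) Q :=
  ⟨_, _, le_rfl, Run.assign x e s, h⟩

theorem Reaches.seq {p q : Prog} {s : State} {T T' : ℕ} {Q R : State → Prop}
    (hp : Reaches p s T R) (hq : ∀ s', R s' → Reaches q s' T' Q) :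
    Reaches (.seq p q) s (T + T') Q := by
  obtain ⟨t, s', ht, hr, h⟩ := hp
  obtain ⟨t', s'', ht', hr', h'⟩ := hq s' h
  exact ⟨_, _, add_le_add ht ht', hr.seq hr', h'⟩

theorem Reaches.ite {e : Expr} {p q : Prog} {s : State} {T : ℕ} {Q : State → Prop}
    (hp : e.eval s ≠ 0 → Reaches p s T Q) (hq : e.eval s = 0 → Reaches q s T Q) :
    Reaches (.ite e p q) s (e.cost + 1 + T) Q := by
  by_cases h : e.eval s = 0
  · obtain ⟨t, s', ht, hr, hQ⟩ := hq h
    exact ⟨_, _, by omega, Run.ite_false p h hr, hQ⟩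
  · obtain ⟨t, s', ht, hr, hQ⟩ := hp h
    exact ⟨_, _, by omega, Run.ite_true q h hr, hQ⟩

theorem Reaches.store {e f : Expr} {s : State} {Q : State → Prop}
    (h : Q { s with mem := Function.update s.mem (e.eval s) (f.eval s) }) :
    Reaches (.store e f) s (e.cost + f.cost + 1) Q :=
  ⟨_, _, le_rfl, Run.store e f s, h⟩

theorem Reaches.print {e : Expr} {s : State} {Q : State → Prop}
    (h : Q { s with out := s.out ++ [e.eval s] }) :
    Reaches (.print e) s (e.cost + 1) Q :=
  ⟨_, _, le_rfl, Run.print e s, h⟩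

/-- A loop with at most `m` rounds, each within `T` steps, and a counted invariant `I`. -/
theorem Reaches.loop {e : Expr} {p : Prog} {T : ℕ} (I : ℕ → State → Prop) (m : ℕ)
    (hstep : ∀ i s, I i s → e.eval s ≠ 0 → i < m ∧ Reaches p s T (I (i + 1)))
    {s : State} (hs : I 0 s) :
    Reaches (.loop e p) s (m * (T + (e.cost + 1)) + (e.cost + 1))
      (fun s' => e.eval s' = 0 ∧ ∃ i, I i s') := by
  have key : ∀ j i s, m ≤ i + j → I i s →
      Reaches (.loop e p) s (j * (T + (e.cost + 1)) + (e.cost + 1))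
        (fun s' => e.eval s' = 0 ∧ ∃ i, I i s') := by
    intro j
    induction j with
    | zero =>
      intro i s hm hi
      by_cases h : e.eval s = 0
      · exact ⟨_, _, by omega, Run.loop_false p h, h, i, hi⟩
      · have := (hstep i s hi h).1
        omega
    | succ j ih =>
      intro i s hm hi
      by_cases h : e.eval s = 0
      · exact ⟨_, _, by omega, Run.loop_false p h, h, i, hi⟩
      · obtain ⟨-, t, s', ht, hr, hi'⟩ := hstep i s hi h
        obtain ⟨t', s'', ht', hr', hQ⟩ := ih (i + 1) s' (by omega) hi'
        refine ⟨_, _, ?_, Run.loop_true h hr hr', hQ⟩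
        rw [Nat.succ_mul]
        omega
  exact key m 0 s (by omega) hs

/-! ### Correctness of the compilation -/

/-- The configuration `s` represents the store `σ`, with arrays placed behind address `L`. -/
structure Represents (L : ℕ) (s : State) (σ : Store) : Prop where
  pos : 0 < L
  base : s.reg 0 = L
  inp : ∀ i < L, s.mem i = σ.inp i
  inp_zero : ∀ i, L ≤ i → σ.inp i = 0
  arr : ∀ (A : Fin 16) (i : ℕ), s.mem (L + 16 * i + A) = σ.arr A i
  out : s.out = σ.out

theorem Represents.congr {L : ℕ} {s s' : State} {σ : Store} (h : Represents L s σ)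
    (hr : s'.reg 0 = s.reg 0) (hm : s'.mem = s.mem) (ho : s'.out = s.out) : Represents L s' σ :=
  ⟨h.pos, hr.trans h.base, fun i hi => hm ▸ h.inp i hi, h.inp_zero, fun A i => hm ▸ h.arr A i,
    ho.trans h.out⟩

theorem Represents.size {L : ℕ} {s : State} {σ : Store} (h : Represents L s σ) :
    sizeExpr.eval s = σ.inp 0 := h.inp 0 h.pos

/-- `s'` differs from `s` only in the registers from `r` on. -/
structure Agree (r : ℕ) (s s' : State) : Prop where
  reg : ∀ x < r, s'.reg x = s.reg x
  mem : s'.mem = s.mem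
  out : s'.out = s.out

theorem Agree.trans {r r' : ℕ} {s s' s'' : State} (h : Agree r s s') (h' : Agree r' s' s'')
    (hr : r ≤ r') : Agree r s s'' :=
  ⟨fun x hx => (h'.reg x (by omega)).trans (h.reg x hx), h'.mem.trans h.mem, h'.out.trans h.out⟩

theorem Agree.update {r x : ℕ} (s : State) (v : ℕ) (h : r ≤ x) :
    Agree r s { s with reg := Function.update s.reg x v } :=
  ⟨fun y hy => Function.update_of_ne (by omega) _ _, rfl, rfl⟩

theorem Agree.represents {L r : ℕ} {s s' : State} {σ : Store} (h : Agree r s s') (hr : 0 < r)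
    (hs : Represents L s σ) : Represents L s' σ :=
  hs.congr (h.reg 0 hr) h.mem h.out

theorem Agree.map {r : ℕ} {s s' : State} (h : Agree r s s') {ρ : List ℕ} (hρ : ∀ x ∈ ρ, x < r) :
    ρ.map s'.reg = ρ.map s.reg :=
  List.map_congr_left fun x hx => h.reg x (hρ x hx)

/-- The registers are used as a stack: everything below r, in particular the base address in
register 0 and the local variables listed in `ρ`, survives the evaluation, so subterms can use r, r
+ 1, ... as scratch space. -/
theorem Tm.compile_correct {L : ℕ} {σ : Store} (t : Tm) : ∀ (ρ : List ℕ) (r : ℕ) (s : State),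
    Represents L s σ → 0 < r → (∀ x ∈ ρ, x < r) →
    Reaches (t.compile ρ r) s (t.time (σ.inp 0))
      (fun s' => s'.reg r = t.eval σ (ρ.map s.reg) ∧ Agree r s s') := by
  induction t with
  | const a =>
    intro ρ r s hs hr hρ
    exact Reaches.assign ⟨by simp [Expr.eval, Tm.eval], .update s _ le_rfl⟩
  | var j =>
    intro ρ r s hs hr hρ
    have hc : ((ρ.map Expr.reg).getD j (.const 0)).cost = 1 := by
      by_cases h : j < ρ.length
      · simp [List.getD, h, Expr.cost]
      · simp [List.getD, h, Expr.cost]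
    refine (Reaches.assign ⟨?_, .update s _ le_rfl⟩).mono (by rw [hc]; simp [Tm.time]) fun _ h => h
    by_cases h : j < ρ.length
    · simp [List.getD, h, Expr.eval, Tm.eval]
    · simp [List.getD, h, Expr.eval, Tm.eval]
  | inp t ih =>
    intro ρ r s hs hr hρ
    refine Reaches.mono ((ih ρ r s hs hr hρ).seq (T' := 10)
      fun s₁ ⟨h₁, ha⟩ => (Reaches.ite (T := 3) ?_ ?_).mono (by simp [Expr.cost]) fun _ h => h)
      le_rfl fun _ h => h
    · intro hlt
      refine (Reaches.assign ⟨?_, ha.trans (.update s₁ _ le_rfl) le_rfl⟩)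
      simp only [Expr.eval, ha.reg 0 hr, hs.base, h₁] at hlt
      simp only [Expr.eval, Function.update_self, h₁, Tm.eval, ha.mem]
      exact hs.inp _ (by omega)
    · intro hlt
      refine (Reaches.assign ⟨?_, ha.trans (.update s₁ _ le_rfl) le_rfl⟩).mono (by simp [Expr.cost])
        fun _ h => h
      simp only [Expr.eval, ha.reg 0 hr, hs.base, h₁] at hlt
      simp only [Expr.eval, Function.update_self, Tm.eval]
      exact (hs.inp_zero _ (by omega)).symm
  | arr A t ih =>
    intro ρ r s hs hr hρ
    refine Reaches.mono ((ih ρ r s hs hr hρ).seq (T' := 37)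
      fun s₁ ⟨h₁, ha⟩ => Reaches.assign ⟨?_, ha.trans (.update s₁ _ le_rfl) le_rfl⟩)
      (by simp [Tm.time]) fun _ h => h
    simp only [Expr.eval, Function.update_self, addrExpr_eval, ha.reg 0 hr, hs.base, h₁, Tm.eval,
      ha.mem]
    exact hs.arr A _
  | add t u iht ihu =>
    intro ρ r s hs hr hρ
    refine Reaches.mono ((iht ρ r s hs hr hρ).seq (T' := u.time (σ.inp 0) + 4)
      fun s₁ ⟨h₁, ha⟩ => (ihu ρ (r + 1) s₁ (ha.represents hr hs) (by omega)
        fun x hx => (hρ x hx).trans (by omega)).seq fun s₂ ⟨h₂, hb⟩ =>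
          Reaches.assign ⟨?_, (ha.trans hb (by omega)).trans (.update s₂ _ le_rfl) le_rfl⟩)
      (by simp [Tm.time]; omega) fun _ h => h
    simp only [Expr.eval, Function.update_self, Tm.eval, h₂, hb.reg r (by omega), h₁, ha.map hρ]
  | sub t u iht ihu =>
    intro ρ r s hs hr hρ
    refine Reaches.mono ((iht ρ r s hs hr hρ).seq (T' := u.time (σ.inp 0) + 4)
      fun s₁ ⟨h₁, ha⟩ => (ihu ρ (r + 1) s₁ (ha.represents hr hs) (by omega)
        fun x hx => (hρ x hx).trans (by omega)).seq fun s₂ ⟨h₂, hb⟩ =>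
          Reaches.assign ⟨?_, (ha.trans hb (by omega)).trans (.update s₂ _ le_rfl) le_rfl⟩)
      (by simp [Tm.time]; omega) fun _ h => h
    simp only [Expr.eval, Function.update_self, Tm.eval, h₂, hb.reg r (by omega), h₁, ha.map hρ]
  | mulN t ih =>
    intro ρ r s hs hr hρ
    let I : ℕ → State → Prop := fun i s' => s'.reg (r + 2) = i ∧ i ≤ σ.inp 0 ∧
      s'.reg (r + 1) = i * t.eval σ (ρ.map s.reg) ∧ s'.reg r = t.eval σ (ρ.map s.reg) ∧
      Agree r s s'
    refine Reaches.mono ((ih ρ r s hs hr hρ).seq fun s₁ ⟨h₁, ha⟩ => (Reaches.assign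
      (Q := fun s' => s'.reg (r + 1) = 0 ∧ s'.reg r = t.eval σ (ρ.map s.reg) ∧ Agree r s s')
      ?_).seq fun s₂ ⟨h₂, h₂', hb⟩ => (Reaches.assign (Q := I 0) ?_).seq fun s₃ h₃ =>
      (Reaches.loop (T := 8) I (σ.inp 0) ?_ h₃).seq fun s₄ ⟨h₄, i, hi⟩ => Reaches.assign ?_)
      ?_ fun _ h => h
    · refine ⟨by simp [Expr.eval], ?_, ha.trans (.update s₁ _ (by omega)) le_rfl⟩
      simpa using h₁
    · refine ⟨by simp [Expr.eval], by omega, ?_, ?_, hb.trans (.update s₂ _ (by omega)) le_rfl⟩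
      · simpa using h₂
      · simpa using h₂'
    · rintro i s' ⟨h1, h2, h3, h4, h5⟩ hne
      have hlt : i < σ.inp 0 := by
        have := (h5.represents hr hs).size
        simp only [Expr.eval, h1, this] at hne
        omega
      refine ⟨hlt, (Reaches.seq (Reaches.assign (Q := fun s'' => s''.reg (r + 2) = i ∧
        s''.reg (r + 1) = (i + 1) * t.eval σ (ρ.map s.reg) ∧ s''.reg r = t.eval σ (ρ.map s.reg) ∧
        Agree r s s'') ?_) fun s'' ⟨g1, g2, g3, g4⟩ => Reaches.assign ?_)⟩
      · refine ⟨by simpa using h1, ?_, by simpa using h4, h5.trans (.update s' _ (by omega)) le_rfl⟩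
        simp [Expr.eval, h3, h4]; ring
      · refine ⟨by simp [Expr.eval, g1], hlt, by simpa using g2, by simpa using g3,
          g4.trans (.update s'' _ (by omega)) le_rfl⟩
    · obtain ⟨h1, h2, h3, h4, h5⟩ := hi
      have hn := (h5.represents hr hs).size
      simp only [Expr.eval, h1, hn] at h₄
      refine ⟨?_, h5.trans (.update s₄ _ le_rfl) le_rfl⟩
      have : i = σ.inp 0 := by omega
      simp [Expr.eval, h3, this, Tm.eval]
    · simp [Expr.cost, sizeExpr, Tm.time]; omega
  | find t ih =>
    intro ρ r s hs hr hρ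
    set φ : ℕ → Prop := fun i => t.eval σ (i :: ρ.map s.reg) ≠ 0 with hφ
    -- Register r + 1 is a flag: once a witness is found it is set to n, which makes the truncated
    -- difference n - r - flag in the loop test vanish and ends the search.
    let I : ℕ → State → Prop := fun i s' => i ≤ σ.inp 0 ∧ Agree r s s' ∧
      (∀ j < s'.reg r, ¬ φ j) ∧
      ((s'.reg r = i ∧ s'.reg (r + 1) = 0) ∨
        (s'.reg r < σ.inp 0 ∧ φ (s'.reg r) ∧ s'.reg (r + 1) = σ.inp 0))
    refine Reaches.mono ((Reaches.assign
      (Q := fun s' => s'.reg r = 0 ∧ Agree r s s') ?_).seq fun s₁ ⟨h₁, ha⟩ =>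
      (Reaches.assign (Q := I 0) ?_).seq (T' := σ.inp 0 * (t.time (σ.inp 0) + 13) + 7)
      fun s₂ h₂ => ((Reaches.loop (T := t.time (σ.inp 0) + 6) I (σ.inp 0) ?_ h₂).mono
        (by simp [Expr.cost, sizeExpr]) ?_))
      ?_ fun _ h => h
    · exact ⟨by simp [Expr.eval], .update s _ le_rfl⟩
    · refine ⟨by omega, ha.trans (.update s₁ _ (by omega)) le_rfl, ?_, ?_⟩
      · simp [h₁]
      · simp [h₁, Expr.eval]
    · rintro i s' ⟨h1, h2, h3, h4⟩ hne
      have hn := (h2.represents hr hs).size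
      simp only [Expr.eval, hn] at hne
      obtain ⟨h4, h4'⟩ : s'.reg r = i ∧ s'.reg (r + 1) = 0 := by
        rcases h4 with h4 | h4
        · exact h4
        · omega
      have hlt : i < σ.inp 0 := by omega
      refine ⟨hlt, ((ih (r :: ρ) (r + 2) s' (h2.represents hr hs) (by omega) ?_).seq
        (T' := 6) fun s'' ⟨g1, g2⟩ => (Reaches.ite (T := 4) ?_ ?_).mono (by simp [Expr.cost])
        fun _ h => h).mono le_rfl fun _ h => h⟩
      · intro x hx
        rcases List.mem_cons.mp hx with rfl | hx
        · omega
        · have := hρ x hx; omega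
      · intro hg
        simp only [Expr.eval, g1, List.map_cons, h4, h2.map hρ] at hg
        have hn' := (((h2.trans g2 (by omega)).represents hr hs)).size
        refine (Reaches.assign ⟨hlt, (h2.trans g2 (by omega)).trans (.update s'' _ (by omega))
          le_rfl, ?_, Or.inr ?_⟩).mono (by simp [sizeExpr, Expr.cost]) fun _ h => h
        · have : s''.reg r = s'.reg r := g2.reg r (by omega)
          simpa [this] using h3
        · have : s''.reg r = s'.reg r := g2.reg r (by omega)
          simp only [ne_eq, Nat.left_eq_add, one_ne_zero, not_false_eq_true,
            Function.update_of_ne, Function.update_self, this, h4, hn']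
          exact ⟨hlt, hg, trivial⟩
      · intro hg
        simp only [Expr.eval, g1, List.map_cons, h4, h2.map hρ] at hg
        have e1 : s''.reg r = i := (g2.reg r (by omega)).trans h4
        have e2 : s''.reg (r + 1) = 0 := (g2.reg (r + 1) (by omega)).trans h4'
        refine (Reaches.assign ⟨hlt, (h2.trans g2 (by omega)).trans (.update s'' _ (by omega))
          le_rfl, ?_, Or.inl ?_⟩).mono (by simp [Expr.cost]) fun _ h => h
        · simp only [Function.update_self, Expr.eval, e1]
          intro j hj
          rcases Nat.lt_succ_iff_lt_or_eq.mp hj with hj | rfl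
          · exact h3 j (by omega)
          · simpa [hφ] using hg
        · simp [Expr.eval, e1, e2]
    · rintro s₃ ⟨h₃, i, h1, h2, h3, h4⟩
      have hn := (h2.represents hr hs).size
      simp only [Expr.eval, hn] at h₃
      refine ⟨?_, h2⟩
      simp only [Tm.eval]
      symm
      refine leastBelow_eq ?_ ?_ h3
      · omega
      · rcases h4 with h4 | h4
        · left; omega
        · exact Or.inr h4.2.1
    · simp [Expr.cost, Tm.time]
      ring_nf
      omega

theorem Cmd.compile_correct {L : ℕ} (p : Cmd) : ∀ (ρ : List ℕ) (r : ℕ) (s : State) (σ : Store),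
    Represents L s σ → 0 < r → (∀ x ∈ ρ, x < r) →
    Reaches (p.compile ρ r) s (p.time (σ.inp 0))
      (fun s' => Represents L s' (p.run σ (ρ.map s.reg)) ∧ ∀ x < r, s'.reg x = s.reg x) := by
  induction p with
  | skip =>
    intro ρ r s σ hs hr hρ
    have h : Agree r s _ := .update s ((Expr.const 0).eval s) le_rfl
    exact Reaches.assign ⟨h.represents hr hs, h.reg⟩
  | set A i v =>
    intro ρ r s σ hs hr hρ
    refine Reaches.mono ((i.compile_correct ρ r s hs hr hρ).seq fun s₁ ⟨h₁, ha⟩ =>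
      (v.compile_correct ρ (r + 1) s₁ (ha.represents hr hs) (by omega)
        fun x hx => (hρ x hx).trans (by omega)).seq fun s₂ ⟨h₂, hb⟩ =>
      Reaches.store ?_) ?_ fun _ h => h
    · have hc := ha.trans hb (by omega)
      have hs₂ := hc.represents hr hs
      have e1 : s₂.reg r = i.eval σ (ρ.map s.reg) := (hb.reg r (by omega)).trans h₁
      rw [ha.map hρ] at h₂
      refine ⟨⟨hs₂.pos, hs₂.base, ?_, hs₂.inp_zero, ?_, hs₂.out⟩, hc.reg⟩
      · intro j hj
        simp only [addrExpr_eval, Expr.eval, hs₂.base]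
        rw [Function.update_of_ne (by omega)]
        exact hs₂.inp j hj
      · intro B j
        simp only [addrExpr_eval, Expr.eval, hs₂.base, e1, h₂, Cmd.run, Store.set_arr]
        split_ifs with hB
        · obtain ⟨rfl, rfl⟩ := hB
          simp
        · rw [Function.update_of_ne]
          · exact hs₂.arr B j
          · intro heq
            apply hB
            -- The arrays are interleaved with period 16, so an address determines both the array
            -- and the index.
            have := A.isLt
            have := B.isLt
            exact ⟨Fin.ext (by omega), by omega⟩
    · simp [Cmd.time, addrExpr_cost, Expr.cost]; omega
  | print t =>
    intro ρ r s σ hs hr hρ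
    refine Reaches.mono ((t.compile_correct ρ r s hs hr hρ).seq fun s₁ ⟨h₁, ha⟩ =>
      Reaches.print ?_) ?_ fun _ h => h
    · have hs₁ := ha.represents hr hs
      refine ⟨⟨hs₁.pos, hs₁.base, hs₁.inp, hs₁.inp_zero, hs₁.arr, ?_⟩, ha.reg⟩
      simp [Cmd.run, hs₁.out, Expr.eval, h₁]
    · simp [Cmd.time, Expr.cost]
  | seq p q hp hq =>
    intro ρ r s σ hs hr hρ
    refine (hp ρ r s σ hs hr hρ).seq fun s₁ ⟨h₁, ha⟩ =>
      (hq ρ r s₁ _ h₁ hr hρ).mono (by simp) fun s₂ ⟨h₂, hb⟩ => ⟨?_, fun x hx =>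
        (hb x hx).trans (ha x hx)⟩
    rwa [List.map_congr_left fun x hx => ha x (hρ x hx)] at h₂
  | ite t p q hp hq =>
    intro ρ r s σ hs hr hρ
    refine Reaches.mono ((t.compile_correct ρ r s hs hr hρ).seq fun s₁ ⟨h₁, ha⟩ =>
      Reaches.ite (T := p.time (σ.inp 0) + q.time (σ.inp 0)) ?_ ?_) ?_ fun _ h => h
    · intro hne
      simp only [Expr.eval, h₁] at hne
      refine (hp ρ r s₁ σ (ha.represents hr hs) hr hρ).mono (by omega) fun s₂ ⟨h₂, hb⟩ =>
        ⟨?_, fun x hx => (hb x hx).trans (ha.reg x hx)⟩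
      rw [ha.map hρ] at h₂
      simpa [Cmd.run, hne] using h₂
    · intro hne
      simp only [Expr.eval, h₁] at hne
      refine (hq ρ r s₁ σ (ha.represents hr hs) hr hρ).mono (by omega) fun s₂ ⟨h₂, hb⟩ =>
        ⟨?_, fun x hx => (hb x hx).trans (ha.reg x hx)⟩
      rw [ha.map hρ] at h₂
      simpa [Cmd.run, hne] using h₂
    · simp [Cmd.time, Expr.cost]; omega
  | iter p hp =>
    intro ρ r s σ hs hr hρ
    let F : ℕ → Store := fun m => Nat.rec σ (fun i σ' => p.run σ' (i :: ρ.map s.reg)) m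
    have hF : ∀ m, (F m).inp = σ.inp := by
      intro m
      induction m with
      | zero => rfl
      | succ m ih => simpa [F] using ih
    let I : ℕ → State → Prop := fun i s' => i ≤ σ.inp 0 ∧ s'.reg r = i ∧
      (∀ x < r, s'.reg x = s.reg x) ∧ Represents L s' (F i)
    refine Reaches.mono ((Reaches.assign (Q := I 0) ?_).seq (T' := σ.inp 0 * (p.time (σ.inp 0) + 9) + 5)
      fun s₁ h₁ => ((Reaches.loop (T := p.time (σ.inp 0) + 4) I (σ.inp 0) ?_ h₁).mono
        (by simp [Expr.cost, sizeExpr]) ?_)) ?_ fun _ h => h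
    · have h : Agree r s _ := .update s ((Expr.const 0).eval s) le_rfl
      exact ⟨by omega, by simp [Expr.eval], h.reg, h.represents hr hs⟩
    · rintro i s' ⟨h1, h2, h3, h4⟩ hne
      have hn := h4.size
      simp only [Expr.eval, hn, h2, hF] at hne
      have hlt : i < σ.inp 0 := by omega
      refine ⟨hlt, ((hp (r :: ρ) (r + 1) s' _ h4 (by omega) ?_).mono (by rw [hF])
        fun _ h => h).seq fun s'' ⟨g1, g2⟩ => Reaches.assign ?_⟩
      · intro x hx
        rcases List.mem_cons.mp hx with rfl | hx
        · omega
        · have := hρ x hx; omega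
      · refine ⟨hlt, ?_, ?_, ?_⟩
        · simp [Expr.eval, g2 r (by omega), h2]
        · intro x hx
          rw [← h3 x hx, ← g2 x (by omega)]
          exact Function.update_of_ne (by omega) _ _
        · have h : Agree r s'' _ := .update s''
            ((Expr.add (.reg r) (.const 1)).eval s'') le_rfl
          refine h.represents hr ?_
          have e : (r :: ρ).map s'.reg = i :: ρ.map s.reg := by
            rw [List.map_cons, h2, List.map_congr_left fun x hx => h3 x (hρ x hx)]
          rw [e] at g1
          exact g1
    · rintro s₂ ⟨h₂, i, h1, h2, h3, h4⟩
      have hn := h4.size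
      simp only [Expr.eval, hn, h2, hF] at h₂
      have : i = σ.inp 0 := by omega
      subst this
      exact ⟨h4, h3⟩
    · simp [Expr.cost, Cmd.time]
      ring_nf
      omega
  | bind t p hp =>
    intro ρ r s σ hs hr hρ
    refine (t.compile_correct ρ r s hs hr hρ).seq fun s₁ ⟨h₁, ha⟩ =>
      (hp (r :: ρ) (r + 1) s₁ σ (ha.represents hr hs) (by omega) ?_).mono le_rfl
        fun s₂ ⟨h₂, hb⟩ => ⟨?_, fun x hx => (hb x (by omega)).trans (ha.reg x hx)⟩
    · intro x hx
      rcases List.mem_cons.mp hx with rfl | hx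
      · omega
      · have := hρ x hx; omega
    · rwa [List.map_cons, h₁, ha.map hρ] at h₂

/-! ### Placing the arrays behind the input -/

/-- The program that puts `2 + 2 n + 2 n ^ 2` into register `0`. -/
def baseProg : Prog :=
  .seq (.assign 0 (.add (.const 2) (.add sizeExpr sizeExpr)))
    (.seq (.assign 1 sizeExpr)
      (.loop (.reg 1) (.seq (.assign 0 (.add (.reg 0) (.add sizeExpr sizeExpr)))
        (.assign 1 (.sub (.reg 1) (.const 1))))))

theorem baseProg_correct (s : State) :
    Reaches baseProg s (s.mem 0 * 20 + 20) (fun s' =>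
      s'.reg 0 = 2 + 2 * s.mem 0 + 2 * (s.mem 0 * s.mem 0) ∧ s'.mem = s.mem ∧ s'.out = s.out) := by
  set n := s.mem 0 with hn
  let I : ℕ → State → Prop := fun i s' => i ≤ n ∧ s'.reg 1 = n - i ∧
    s'.reg 0 = 2 + 2 * n + i * (2 * n) ∧ s'.mem = s.mem ∧ s'.out = s.out
  refine Reaches.mono ((Reaches.assign (Q := fun s' => s'.reg 0 = 2 + 2 * n ∧ s'.mem = s.mem ∧
    s'.out = s.out) ?_).seq fun s₁ ⟨h₁, h₁', h₁''⟩ => (Reaches.assign (Q := I 0) ?_).seq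
    (T' := n * 14 + 2) fun s₂ h₂ => (Reaches.loop (T := 12) I n ?_ h₂).mono
      (by simp [Expr.cost]) ?_) ?_ fun _ h => h
  · refine ⟨?_, rfl, rfl⟩
    simp [Expr.eval, sizeExpr, ← hn]; omega
  · refine ⟨by omega, ?_, ?_, h₁', h₁''⟩
    · simp [Expr.eval, sizeExpr, h₁', ← hn]
    · simpa using h₁
  · rintro i s' ⟨h1, h2, h3, h4, h5⟩ hne
    simp only [Expr.eval, h2] at hne
    refine ⟨by omega, Reaches.seq (T := 8) (T' := 4) (Reaches.mono (Reaches.assign (Q := fun s'' =>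
      s''.reg 1 = n - i ∧ s''.reg 0 = 2 + 2 * n + (i + 1) * (2 * n) ∧ s''.mem = s.mem ∧
      s''.out = s.out) ?_) (by simp [Expr.cost, sizeExpr]) fun _ h => h)
      fun s'' ⟨g1, g2, g3, g4⟩ => Reaches.assign ?_⟩
    · refine ⟨by simpa using h2, ?_, h4, h5⟩
      simp [Expr.eval, sizeExpr, h3, h4, ← hn]; ring
    · refine ⟨by omega, ?_, by simpa using g2, g3, g4⟩
      simp [Expr.eval, g1]; omega
  · rintro s₃ ⟨h₃, i, h1, h2, h3, h4, h5⟩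
    simp only [Expr.eval, h2] at h₃
    have : i = n := by omega
    subst this
    exact ⟨by rw [h3]; ring, h4, h5⟩
  · simp [Expr.cost, sizeExpr]; omega

/-- The initial store on a given input. -/
def initialStore (input : List ℕ) : Store where
  inp := fun i => input.getD i 0
  arr := fun _ _ => 0
  out := []

/-- Every command is executed by a machine program in polynomial time, on inputs of the length of
`encodeInput`. -/
theorem Cmd.exists_prog (p : Cmd) : ∃ (P : Prog) (C d : ℕ), ∀ (n : ℕ) (input : List ℕ),
    input.getD 0 0 = n → input.length = 2 + 2 * n + 2 * (n * n) →
    OutputsWithin P input (p.run (initialStore input) []).out (C * (n + 1) ^ d) := by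
  obtain ⟨C, d, hCd⟩ := ((PolyBounded.id.mul (.const 20)).add (.const 20)).add p.polyBounded_time
  refine ⟨.seq baseProg (p.compile [] 1), C, d, fun n input hn hlen => ?_⟩
  have h0 : (initial input).mem 0 = n := hn
  obtain ⟨t, s, ht, hr, hs, -⟩ := (baseProg_correct (initial input)).seq
    (T' := p.time n) (q := p.compile [] 1)
    (Q := fun s' => Represents (2 + 2 * n + 2 * (n * n)) s'
      (p.run (initialStore input) []) ∧ True) fun s ⟨h1, h2, h3⟩ => by
    rw [h0] at h1
    have hrep : Represents (2 + 2 * n + 2 * (n * n)) s (initialStore input) := by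
      refine ⟨by omega, h1, fun i _ => by rw [h2]; rfl, fun i hi => ?_, fun A i => ?_, h3⟩
      · exact List.getD_eq_default _ _ (by omega)
      · rw [h2]
        exact List.getD_eq_default _ _ (by omega)
    refine (p.compile_correct [] 1 s _ hrep (by omega) (by simp)).mono
      (le_of_eq (congrArg p.time hn)) fun s' h => ⟨h.1, trivial⟩
  refine ⟨t, s, ?_, hr, hs.out⟩
  rw [h0] at ht
  exact ht.trans (hCd n)

/-! ### Simplicial vertices of chordal graphs -/

theorem cycleGraph_adj_iff {m : ℕ} {i j : Fin m} (hij : i < j) :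
    (SimpleGraph.cycleGraph m).Adj i j ↔ ((j : ℕ) = i + 1 ∨ ((i : ℕ) = 0 ∧ (j : ℕ) + 1 = m)) := by
  have hj := j.isLt
  have hij' : (i : ℕ) < j := hij
  obtain ⟨n, rfl⟩ : ∃ n, m = n + 1 := ⟨m - 1, by omega⟩
  rw [SimpleGraph.cycleGraph_adj', Fin.sub_val_of_le hij.le, Fin.val_sub]
  by_cases h0 : n + 1 - (j : ℕ) + i < n + 1
  · rw [Nat.mod_eq_of_lt h0]; omega
  · omega

/-- A sequence of distinct vertices with exactly the adjacencies of a cycle yields an induced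
cycle. -/
theorem IsChordal.false_of_cycle {V : Type*} {H : SimpleGraph V} (hH : IsChordal H) {m : ℕ}
    (hm : 4 ≤ m) (g : ℕ → V) (hinj : ∀ i j, i < j → j < m → g i ≠ g j)
    (hadj : ∀ i j, i < j → j < m → (H.Adj (g i) (g j) ↔ (j = i + 1 ∨ (i = 0 ∧ j + 1 = m)))) :
    False := by
  refine (hH m hm).false ⟨⟨fun i : Fin m => g i, ?_⟩, ?_⟩
  · intro i j hij
    rcases lt_trichotomy i j with h | h | h
    · exact absurd hij (hinj i j h j.isLt)
    · exact h
    · exact absurd hij.symm (hinj j i h i.isLt)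
  · intro i j
    change H.Adj (g i) (g j) ↔ _
    rcases lt_trichotomy i j with h | h | h
    · rw [cycleGraph_adj_iff h, hadj i j h j.isLt]
    · subst h; simp
    · rw [SimpleGraph.adj_comm, SimpleGraph.adj_comm _ i, cycleGraph_adj_iff h, hadj j i h i.isLt]

/-- The two parts of the walk bound the distances from the i-th vertex to both ends by i and |p| -
i; by the triangle inequality both bounds are attained. -/
theorem dist_getVert {V : Type*} {K : SimpleGraph V} {x y : V} (p : K.Walk x y)
    (hp : p.length = K.dist x y) {i : ℕ} (hi : i ≤ p.length) : K.dist x (p.getVert i) = i := by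
  have h1 : K.dist x (p.getVert i) ≤ i := by
    have := SimpleGraph.dist_le (p.take i)
    rw [SimpleGraph.Walk.take_length] at this
    omega
  have h2 : K.dist (p.getVert i) y ≤ p.length - i := by
    have := SimpleGraph.dist_le (p.drop i)
    rwa [SimpleGraph.Walk.drop_length] at this
  have h3 : K.dist x y ≤ K.dist x (p.getVert i) + K.dist (p.getVert i) y :=
    SimpleGraph.Reachable.dist_triangle_left ⟨p.take i⟩ y
  omega

/-- In a chordal graph, two neighbours of `v` that are joined by a path avoiding the closed
neighbourhood of `v` are adjacent. -/
theorem IsChordal.adj_of_reachable {V : Type*} {H : SimpleGraph V} (hH : IsChordal H)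
    {v s s' : V} {C : Set V} (hv : ∀ c ∈ C, c ≠ v ∧ ¬ H.Adj v c) (hs : H.Adj v s)
    (hs' : H.Adj v s') (hne : s ≠ s') (K : SimpleGraph V)
    (hK : ∀ x y, K.Adj x y ↔ H.Adj x y ∧ x ∈ C ∪ {s, s'} ∧ y ∈ C ∪ {s, s'})
    (hr : K.Reachable s s') : H.Adj s s' := by
  by_contra hn
  -- A shortest path from s to s' with all inner vertices in C is induced; closed up by v, which
  -- sees only its two ends, it becomes an induced cycle on |p| + 2 ≥ 4 vertices.
  obtain ⟨p, hp⟩ := hr.exists_walk_length_eq_dist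
  have hKn : ¬ K.Adj s s' := fun h => hn ((hK _ _).mp h).1
  have hl : 2 ≤ p.length := by
    rw [hp]
    exact hr.one_lt_dist_of_ne_of_not_adj hne hKn
  have hmem : ∀ i ≤ p.length, p.getVert i ∈ C ∪ {s, s'} := by
    intro i hi
    rcases hi.lt_or_eq with h | h
    · exact ((hK _ _).mp (p.adj_getVert_succ h)).2.1
    · rw [h, p.getVert_length]; simp
  have hd : ∀ i ≤ p.length, K.dist s (p.getVert i) = i := fun i hi => dist_getVert p hp hi
  have hint : ∀ i, 0 < i → i < p.length → p.getVert i ∈ C := by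
    intro i h0 hi
    rcases hmem i hi.le with h | h | h
    · exact h
    · have := hd i hi.le
      rw [h, SimpleGraph.dist_self] at this
      omega
    · have := hd i hi.le
      rw [Set.mem_singleton_iff.mp h, ← hp] at this
      omega
  refine hH.false_of_cycle (m := p.length + 2) (by omega)
    (fun i => if i ≤ p.length then p.getVert i else v) ?_ ?_
  · intro i j hij hj
    rw [if_pos (by omega)]
    split_ifs with h
    · intro heq
      have h1 := hd i (by omega)
      rw [heq, hd j h] at h1
      omega
    · intro heq
      rcases hmem i (by omega) with h' | h' | h'
      · exact (hv _ h').1 heq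
      · exact hs.ne' (h'.symm.trans heq)
      · exact hs'.ne' (h'.symm.trans heq)
  · intro i j hij hj
    rw [if_pos (by omega)]
    split_ifs with h
    · constructor
      · intro hadj
        have hadj' : K.Adj (p.getVert i) (p.getVert j) :=
          (hK _ _).mpr ⟨hadj, hmem _ (by omega), hmem _ h⟩
        have h1 : K.dist s (p.getVert j) ≤ K.dist s (p.getVert i) + K.dist (p.getVert i)
          (p.getVert j) := SimpleGraph.Reachable.dist_triangle_left ⟨p.take i⟩ _
        rw [hd i (by omega), hd j h, SimpleGraph.dist_eq_one_iff_adj.mpr hadj'] at h1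
        left; omega
      · rintro (rfl | h')
        · exact ((hK _ _).mp (p.adj_getVert_succ (by omega))).1
        · omega
    · constructor
      · intro hadj
        by_contra h0
        exact (hv _ (hint i (by omega) (by omega))).2 hadj.symm
      · rintro (h' | h')
        · have : i = p.length := by omega
          rw [this, p.getVert_length]
          exact hs'.symm
        · rw [h'.1, p.getVert_zero]
          exact hs.symm

/-- The neighbours of `z` in `A` form a clique. -/
def IsSimplicialIn {V : Type*} (H : SimpleGraph V) (A : Set V) (z : V) : Prop :=
  ∀ x ∈ A, ∀ y ∈ A, H.Adj z x → H.Adj z y → x ≠ y → H.Adj x y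

/-- Dirac's theorem, strengthened for the induction by asking for a simplicial vertex away from v.
Let C be the component of b among the non-neighbours of v in A, and S the set of vertices of A
outside C with a neighbour in C. Since C ∪ S contains all neighbours in A of the vertices of C, a
vertex of C simplicial in C ∪ S is simplicial in A; and C ∪ S is smaller because it misses v. -/
theorem IsChordal.exists_simplicial_not_adj {V : Type*} {H : SimpleGraph V} (hH : IsChordal H) :
    ∀ (m : ℕ) (A : Set V), A.Finite → A.ncard ≤ m → ∀ v ∈ A, (∃ b ∈ A, b ≠ v ∧ ¬ H.Adj v b) →
      ∃ z ∈ A, z ≠ v ∧ ¬ H.Adj v z ∧ IsSimplicialIn H A z := by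
  intro m
  induction m with
  | zero =>
    intro A hA hm v hv
    rw [Nat.le_zero, Set.ncard_eq_zero hA] at hm
    simp [hm] at hv
  | succ m ih =>
    rintro A hA hm v hvA ⟨b, hbA, hbv, hvb⟩
    set R : Set V := {x | x ∈ A ∧ x ≠ v ∧ ¬ H.Adj v x} with hR
    set C : Set V := {x | Relation.ReflTransGen (fun p q => H.Adj p q ∧ q ∈ R) b x} with hC
    have hbR : b ∈ R := ⟨hbA, hbv, hvb⟩
    have hbC : b ∈ C := Relation.ReflTransGen.refl
    have hCR : C ⊆ R := by
      intro x hx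
      rcases Relation.ReflTransGen.cases_tail hx with h | ⟨y, -, h⟩
      · rw [h]; exact hbR
      · exact h.2
    set S : Set V := {s | s ∈ A ∧ s ∉ C ∧ ∃ c ∈ C, H.Adj c s} with hS
    have hvS : ∀ s ∈ S, H.Adj v s := by
      rintro s ⟨hsA, hsC, c, hc, hcs⟩
      by_contra hn
      refine hsC (Relation.ReflTransGen.tail hc ⟨hcs, hsA, ?_, hn⟩)
      rintro rfl
      exact (hCR hc).2.2 hcs.symm
    -- S separates C from v: its vertices are neighbours of v, and any two of them are joined by a
    -- path through C, which avoids the closed neighbourhood of v.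
    have hclique : ∀ s ∈ S, ∀ s' ∈ S, s ≠ s' → H.Adj s s' := by
      intro s hs s' hs' hne
      let K : SimpleGraph V :=
        { Adj := fun x y => H.Adj x y ∧ x ∈ C ∪ {s, s'} ∧ y ∈ C ∪ {s, s'}
          symm := ⟨fun x y h => ⟨h.1.symm, h.2.2, h.2.1⟩⟩
          loopless := ⟨fun x h => H.irrefl h.1⟩ }
      have hbr : ∀ x ∈ C, K.Reachable b x := by
        intro x hx
        change Relation.ReflTransGen _ b x at hx
        induction hx with
        | refl => exact SimpleGraph.Reachable.refl _
        | tail hxy h ih' =>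
          refine ih'.trans (SimpleGraph.Adj.reachable ⟨h.1, Or.inl hxy, Or.inl ?_⟩)
          exact Relation.ReflTransGen.tail hxy h
      have hreach : ∀ x ∈ S, x ∈ ({s, s'} : Set V) → K.Reachable b x := by
        rintro x ⟨-, -, c, hc, hcx⟩ hx
        exact (hbr c hc).trans (SimpleGraph.Adj.reachable ⟨hcx, Or.inl hc, Or.inr hx⟩)
      exact hH.adj_of_reachable (fun c hc => (hCR hc).2) (hvS s hs) (hvS s' hs') hne K
        (fun x y => Iff.rfl) ((hreach s hs (by simp)).symm.trans (hreach s' hs' (by simp)))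
    have hCA : C ∪ S ⊆ A := by
      rintro x (hx | hx)
      · exact (hCR hx).1
      · exact hx.1
    have hvCS : v ∉ C ∪ S := by
      rintro (hx | hx)
      · exact (hCR hx).2.1 rfl
      · exact H.irrefl (hvS v hx)
    have hfin : (C ∪ S).Finite := hA.subset hCA
    have hcard : (C ∪ S).ncard ≤ m := by
      have : (C ∪ S).ncard < A.ncard :=
        Set.ncard_lt_ncard ⟨hCA, fun h => hvCS (h hvA)⟩ hA
      omega
    -- it suffices to find a simplicial vertex of the smaller set inside `C`
    suffices h : ∃ z ∈ C, IsSimplicialIn H (C ∪ S) z by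
      obtain ⟨z, hz, hsim⟩ := h
      refine ⟨z, (hCR hz).1, (hCR hz).2.1, (hCR hz).2.2, ?_⟩
      have hN : ∀ x ∈ A, H.Adj z x → x ∈ C ∪ S := by
        intro x hx hzx
        by_cases hxC : x ∈ C
        · exact Or.inl hxC
        · exact Or.inr ⟨hx, hxC, z, hz, hzx⟩
      exact fun x hx y hy hzx hzy hne => hsim x (hN x hx hzx) y (hN y hy hzy) hzx hzy hne
    -- The induction hypothesis must return a vertex of C. Applied to some s in S it returns a
    -- non-neighbour of s, which is not in the clique S. If every s in S is adjacent to all other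
    -- vertices of C ∪ S, it is applied to a vertex of C instead, unless C is a clique, when b
    -- itself serves.
    by_cases hdom : ∀ s ∈ S, ∀ x ∈ C ∪ S, x ≠ s → H.Adj s x
    · by_cases hcomp : ∀ p ∈ C, ∀ q ∈ C, p ≠ q → H.Adj p q
      · refine ⟨b, hbC, fun x hx y hy _ _ hne => ?_⟩
        rcases hx with hx | hx
        · rcases hy with hy | hy
          · exact hcomp x hx y hy hne
          · exact (hdom y hy x (Or.inl hx) hne).symm
        · exact hdom x hx y hy hne.symm
      · push Not at hcomp
        obtain ⟨p, hp, q, hq, hpq, hn⟩ := hcomp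
        obtain ⟨z, hz, hzp, hpz, hsim⟩ := ih _ hfin hcard p (Or.inl hp)
          ⟨q, Or.inl hq, hpq.symm, hn⟩
        refine ⟨z, hz.resolve_right fun hzS => hpz ?_, hsim⟩
        exact (hdom z hzS p (Or.inl hp) hzp.symm).symm
    · push Not at hdom
      obtain ⟨s, hs, x, hx, hxs, hn⟩ := hdom
      obtain ⟨z, hz, hzs, hsz, hsim⟩ := ih _ hfin hcard s (Or.inr hs) ⟨x, hx, hxs, hn⟩
      exact ⟨z, hz.resolve_right fun hzS => hsz (hclique s hs z hzS hzs.symm), hsim⟩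

/-- Every nonempty finite set of vertices of a chordal graph has a simplicial vertex. -/
theorem IsChordal.exists_simplicial {V : Type*} {H : SimpleGraph V} (hH : IsChordal H)
    {A : Set V} (hA : A.Finite) (hne : A.Nonempty) : ∃ z ∈ A, IsSimplicialIn H A z := by
  by_cases h : ∃ v ∈ A, ∃ b ∈ A, b ≠ v ∧ ¬ H.Adj v b
  · obtain ⟨v, hv, hb⟩ := h
    obtain ⟨z, hz, -, -, hsim⟩ := hH.exists_simplicial_not_adj _ A hA le_rfl v hv hb
    exact ⟨z, hz, hsim⟩
  · push Not at h
    obtain ⟨z, hz⟩ := hne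
    exact ⟨z, hz, fun x hx y hy _ _ hxy => h x hx y hy hxy.symm⟩

/-! ### Kempe chains and sequences of Kempe changes -/

section Sequences

variable {V : Type*} {G : SimpleGraph V} {k : ℕ}

theorem self_mem_kempeChain (α : G.Coloring (Fin k)) (u : V) (c : Fin k) :
    u ∈ kempeChain α u c := ⟨⟨u, Or.inl rfl⟩, rfl, rfl⟩

/-- The Kempe chain of `u` is contained in every set containing `u` and closed under adjacency
among vertices of the two colours. -/
theorem kempeChain_subset_of_closed (α : G.Coloring (Fin k)) (u : V) (c : Fin k) {D : Set V}
    (hu : u ∈ D) (hD : ∀ x ∈ D, ∀ y, G.Adj x y → y ∈ twoColoured α u c → y ∈ D) :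
    kempeChain α u c ⊆ D := by
  rintro _ ⟨x, hx, rfl⟩
  rw [SimpleGraph.ConnectedComponent.mem_supp_iff, SimpleGraph.ConnectedComponent.eq] at hx
  obtain ⟨p⟩ := hx.symm
  suffices h : ∀ (a b : twoColoured α u c), (G.induce (twoColoured α u c)).Walk a b →
      (a : V) ∈ D → (b : V) ∈ D from h _ _ p hu
  intro a b q
  induction q with
  | nil => exact id
  | cons h q ih => exact fun ha => ih (hD _ ha _ h (Subtype.property _))

theorem kempeChange_apply (α : G.Coloring (Fin k)) (u : V) (c : Fin k) (x : V) :
    kempeChange α u c x = kempeSwap α u c x := rfl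

theorem kempeSwap_of_mem {α : G.Coloring (Fin k)} {u : V} {c : Fin k} {x : V}
    (h : x ∈ kempeChain α u c) : kempeSwap α u c x = Equiv.swap (α u) c (α x) := if_pos h

theorem kempeSwap_of_notMem {α : G.Coloring (Fin k)} {u : V} {c : Fin k} {x : V}
    (h : x ∉ kempeChain α u c) : kempeSwap α u c x = α x := if_neg h

theorem kempeChange_self (α : G.Coloring (Fin k)) (u : V) (c : Fin k) :
    kempeChange α u c u = c := by
  rw [kempeChange_apply, kempeSwap_of_mem (self_mem_kempeChain α u c), Equiv.swap_apply_left]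

theorem twoColoured_kempeChange (α : G.Coloring (Fin k)) (u : V) (c : Fin k) :
    twoColoured (kempeChange α u c) u (α u) = twoColoured α u c := by
  ext x
  simp only [twoColoured, Set.mem_ofPred_eq, kempeChange_self]
  rw [kempeChange_apply]
  by_cases hx : x ∈ kempeChain α u c
  · rw [kempeSwap_of_mem hx]
    rcases kempeChain_subset α u c hx with h | h <;> simp [h]
  · rw [kempeSwap_of_notMem hx, or_comm]

/-- A swap permutes the two colours, so it preserves the set of vertices bearing either of them, and
with it the components. -/
theorem kempeChain_kempeChange (α : G.Coloring (Fin k)) (u : V) (c : Fin k) :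
    kempeChain (kempeChange α u c) u (α u) = kempeChain α u c := by
  apply Set.Subset.antisymm
  · apply kempeChain_subset_of_closed _ _ _ (self_mem_kempeChain _ _ _)
    rw [twoColoured_kempeChange]
    exact fun x hx y hxy hy => mem_kempeChain_of_adj α u c hx hxy hy
  · apply kempeChain_subset_of_closed _ _ _ (self_mem_kempeChain _ _ _)
    rw [← twoColoured_kempeChange]
    exact fun x hx y hxy hy => mem_kempeChain_of_adj _ u _ hx hxy hy

/-- A Kempe change is undone by the Kempe change at the same vertex with its old colour. -/
theorem kempeChange_kempeChange (α : G.Coloring (Fin k)) (u : V) (c : Fin k) :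
    kempeChange (kempeChange α u c) u (α u) = α := by
  ext x : 1
  rw [kempeChange_apply]
  by_cases hx : x ∈ kempeChain α u c
  · rw [kempeSwap_of_mem (by rwa [kempeChain_kempeChange]), kempeChange_self, kempeChange_apply,
      kempeSwap_of_mem hx, Equiv.swap_comm, Equiv.swap_apply_self]
  · rw [kempeSwap_of_notMem (by rwa [kempeChain_kempeChange]), kempeChange_apply,
      kempeSwap_of_notMem hx]

theorem IsKempeSequence.append {β γ : G.Coloring (Fin k)} {l' : List (V × Fin k)}
    (h' : IsKempeSequence β l' γ) : ∀ {l : List (V × Fin k)} {α : G.Coloring (Fin k)},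
    IsKempeSequence α l β → IsKempeSequence α (l ++ l') γ
  | [], α, h => by
    have h : α = β := h
    rwa [h]
  | (u, c) :: l, α, h => ⟨h.1, h'.append h.2⟩

/-- `KempeLog α l γ`: the Kempe changes listed in `l`, as triples of a vertex, its new colour and
its old colour, lead from `α` to `γ`. -/
inductive KempeLog (α : G.Coloring (Fin k)) :
    List (V × Fin k × Fin k) → G.Coloring (Fin k) → Prop
  | nil : KempeLog α [] α
  | snoc {l : List (V × Fin k × Fin k)} {γ : G.Coloring (Fin k)} (u : V) (c : Fin k) :
      KempeLog α l γ → c ≠ γ u → KempeLog α (l ++ [(u, c, γ u)]) (kempeChange γ u c)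

theorem KempeLog.isKempeSequence {α γ : G.Coloring (Fin k)} {l : List (V × Fin k × Fin k)}
    (h : KempeLog α l γ) : IsKempeSequence α (l.map fun m => (m.1, m.2.1)) γ := by
  induction h with
  | nil => exact rfl
  | snoc u c _ hc ih =>
    rw [List.map_append]
    refine IsKempeSequence.append ?_ ih
    exact ⟨hc, rfl⟩

/-- The old colours are logged for this purpose: they undo the changes in reverse order. -/
theorem KempeLog.isKempeSequence_reverse {α γ : G.Coloring (Fin k)}
    {l : List (V × Fin k × Fin k)} (h : KempeLog α l γ) :
    IsKempeSequence γ (l.reverse.map fun m => (m.1, m.2.2)) α := by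
  induction h with
  | nil => exact rfl
  | snoc u c _ hc ih =>
    rw [List.reverse_append]
    refine ⟨?_, ?_⟩
    · rw [kempeChange_self]; exact hc.symm
    · rw [kempeChange_kempeChange]; exact ih

/-- Transport of a coloring along an isomorphism. -/
def mapColoring {V' : Type*} {G' : SimpleGraph V'} (e : G ≃g G') (α : G.Coloring (Fin k)) :
    G'.Coloring (Fin k) :=
  α.comp e.symm.toHom

theorem mapColoring_apply {V' : Type*} {G' : SimpleGraph V'} (e : G ≃g G')
    (α : G.Coloring (Fin k)) (x : V) : mapColoring e α (e x) = α x :=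
  congrArg α (e.symm_apply_apply x)

theorem mem_kempeChain_mapColoring {V' : Type*} {G' : SimpleGraph V'} (e : G ≃g G')
    (α : G.Coloring (Fin k)) (u : V) (c : Fin k) (x : V) :
    e x ∈ kempeChain (mapColoring e α) (e u) c ↔ x ∈ kempeChain α u c := by
  constructor
  · have h : kempeChain (mapColoring e α) (e u) c ⊆ e.symm ⁻¹' kempeChain α u c := by
      apply kempeChain_subset_of_closed
      · simpa using self_mem_kempeChain α u c
      · intro y hy z hyz hz
        refine mem_kempeChain_of_adj α u c hy (e.symm.map_rel_iff.mpr hyz) ?_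
        have hz' := mapColoring_apply e α (e.symm z)
        rw [e.apply_symm_apply] at hz'
        simpa [twoColoured, mapColoring_apply, hz'] using hz
    intro hx
    simpa using h hx
  · have h : kempeChain α u c ⊆ e ⁻¹' kempeChain (mapColoring e α) (e u) c := by
      apply kempeChain_subset_of_closed
      · exact self_mem_kempeChain _ _ _
      · intro y hy z hyz hz
        refine mem_kempeChain_of_adj _ _ c hy (e.map_rel_iff.mpr hyz) ?_
        simpa [twoColoured, mapColoring_apply] using hz
    exact fun hx => h hx

theorem mapColoring_kempeChange {V' : Type*} {G' : SimpleGraph V'} (e : G ≃g G')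
    (α : G.Coloring (Fin k)) (u : V) (c : Fin k) :
    mapColoring e (kempeChange α u c) = kempeChange (mapColoring e α) (e u) c := by
  ext y : 1
  obtain ⟨x, rfl⟩ := e.surjective y
  rw [mapColoring_apply, kempeChange_apply, kempeChange_apply]
  by_cases hx : x ∈ kempeChain α u c
  · rw [kempeSwap_of_mem hx, kempeSwap_of_mem ((mem_kempeChain_mapColoring e α u c x).mpr hx),
      mapColoring_apply, mapColoring_apply]
  · rw [kempeSwap_of_notMem hx,
      kempeSwap_of_notMem (mt (mem_kempeChain_mapColoring e α u c x).mp hx), mapColoring_apply]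

theorem IsKempeSequence.of_mapColoring {V' : Type*} {G' : SimpleGraph V'} (e : G ≃g G')
    {β : G.Coloring (Fin k)} : ∀ {l : List (V' × Fin k)} {α : G.Coloring (Fin k)},
    IsKempeSequence (mapColoring e α) l (mapColoring e β) →
    IsKempeSequence α (l.map fun m => (e.symm m.1, m.2)) β
  | [], α, h => by
    have h : mapColoring e α = mapColoring e β := h
    change α = β
    ext x : 1
    rw [← mapColoring_apply e α, h, mapColoring_apply]
  | (u, c) :: l, α, h => by
    obtain ⟨u, rfl⟩ := e.surjective u
    have h : c ≠ mapColoring e α (e u) ∧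
      IsKempeSequence (kempeChange (mapColoring e α) (e u) c) l (mapColoring e β) := h
    rw [mapColoring_apply, ← mapColoring_kempeChange] at h
    have ih := IsKempeSequence.of_mapColoring e h.2
    simp only [List.map_cons, RelIso.symm_apply_apply]
    exact ⟨h.1, ih⟩

end Sequences

/-! ### Transport of treewidth witnesses -/

theorem IsTreewidthWitness.map {V V' : Type*} {G H : SimpleGraph V} {w : ℕ}
    (h : IsTreewidthWitness G H w) (e : V ≃ V') :
    IsTreewidthWitness (G.map e.toEmbedding) (H.map e.toEmbedding) w where
  chordal m hm := ⟨fun f =>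
    (h.chordal m hm).false ((SimpleGraph.Iso.map e H).symm.toEmbedding.comp f)⟩
  le := SimpleGraph.map_monotone _ h.le
  cliqueFree := h.cliqueFree.comap ⟨(SimpleGraph.Iso.map e H).symm.toCopy⟩

/-- The complete graph is a witness for w = |V|, so the infimum defining the treewidth is attained.
-/
theorem exists_isTreewidthWitness {V : Type*} [Fintype V] (G : SimpleGraph V) :
    ∃ H, IsTreewidthWitness G H (treewidth G) := by
  refine Nat.sInf_mem (s := {w : ℕ | ∃ H : SimpleGraph V, IsTreewidthWitness G H w})
    ⟨Fintype.card V, ⊤, ⟨fun m hm => ⟨fun f => ?_⟩, le_top, ?_⟩⟩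
  · obtain ⟨n, rfl⟩ : ∃ n, m = n + 4 := ⟨m - 4, by omega⟩
    have h : (SimpleGraph.cycleGraph (n + 4)).Adj ⟨0, by omega⟩ ⟨2, by omega⟩ := by
      rw [← f.map_rel_iff]
      exact fun h => absurd (f.injective h) (by simp)
    rw [cycleGraph_adj_iff (Fin.mk_lt_mk.mpr (by omega))] at h
    simp at h
  · exact SimpleGraph.cliqueFree_of_card_lt (by omega)

/-! ### Earlier neighbours and free colours -/

open Classical in
/-- The earlier neighbours of `l`. -/
noncomputable def backNbrs (R : ℕ → ℕ → Prop) (l : ℕ) : Finset ℕ := (Finset.range l).filter (R · l)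

open Classical in
theorem mem_backNbrs {R : ℕ → ℕ → Prop} {l m : ℕ} : m ∈ backNbrs R l ↔ m < l ∧ R m l := by
  rw [backNbrs, Finset.mem_filter, Finset.mem_range]

theorem card_backNbrs_le (R : ℕ → ℕ → Prop) (l : ℕ) : (backNbrs R l).card ≤ l :=
  (Finset.card_le_card fun _ hm => Finset.mem_range.mpr (mem_backNbrs.mp hm).1).trans
    (Finset.card_range l).le

/-- The least colour below `n` that is different from `x` and not used on the earlier neighbours
of `l`. -/
noncomputable def freeColour (R : ℕ → ℕ → Prop) (n : ℕ) (f : ℕ → ℕ) (l x : ℕ) : ℕ :=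
  leastBelow n fun c => c ≠ x ∧ ¬ ∃ m < l, R m l ∧ f m = c

theorem freeColour_congr {R : ℕ → ℕ → Prop} {n l x : ℕ} {f g : ℕ → ℕ} (h : ∀ m < l, f m = g m) :
    freeColour R n f l x = freeColour R n g l x := by
  refine leastBelow_congr fun c _ => and_congr_right fun _ => not_congr ?_
  exact exists_congr fun m => and_congr_right fun hm => by rw [h m hm]

theorem exists_le_notMem_of_card_le {X : Finset ℕ} {q : ℕ} (h : X.card ≤ q) : ∃ c ≤ q, c ∉ X := by
  by_contra hc
  push Not at hc
  have hsub : Finset.range (q + 1) ⊆ X := fun c hcq =>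
    hc c (Nat.lt_succ_iff.mp (Finset.mem_range.mp hcq))
  have := Finset.card_le_card hsub
  rw [Finset.card_range] at this
  omega

/-- Pigeonhole: q + 1 colours cannot all lie in a set X of at most q forbidden ones. The condition q
< n ensures that the search below n succeeds. Taking x ≥ n means that no colour besides those of the
neighbours is excluded. -/
theorem freeColour_spec_of_card_le {R : ℕ → ℕ → Prop} {n l x q : ℕ} {f : ℕ → ℕ} {X : Finset ℕ}
    (hX : X.card ≤ q) (hq : q < n) (hN : (backNbrs R l).image f ⊆ X)
    (hx : x ∈ X ∨ n ≤ x) :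
    freeColour R n f l x ≤ q ∧ freeColour R n f l x ≠ x ∧
      ∀ m < l, R m l → f m ≠ freeColour R n f l x := by
  obtain ⟨c, hcq, hcX⟩ := exists_le_notMem_of_card_le hX
  have hc : c ≠ x ∧ ¬ ∃ m < l, R m l ∧ f m = c := by
    refine ⟨?_, ?_⟩
    · rintro rfl
      rcases hx with hx | hx
      · exact hcX hx
      · omega
    · rintro ⟨m, hm, hR, rfl⟩
      exact hcX (hN (Finset.mem_image_of_mem f (mem_backNbrs.mpr ⟨hm, hR⟩)))
  have hle : freeColour R n f l x ≤ q := (leastBelow_le_of hc).trans hcq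
  have hs := of_leastBelow_lt (hle.trans_lt hq)
  exact ⟨hle, hs.1, fun m hm hR heq => hs.2 ⟨m, hm, hR, heq⟩⟩

theorem freeColour_spec {R : ℕ → ℕ → Prop} {n l : ℕ} {f : ℕ → ℕ} (hl : l < n) :
    freeColour R n f l n ≤ (backNbrs R l).card ∧
      ∀ m < l, R m l → f m ≠ freeColour R n f l n := by
  have h := freeColour_spec_of_card_le (R := R) (x := n) (f := f)
    (Finset.card_image_le (s := backNbrs R l) (f := f))
    ((card_backNbrs_le R l).trans_lt hl) subset_rfl (Or.inr le_rfl)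
  exact ⟨h.1, h.2.2⟩

/-- A repeated colour on the earlier neighbours leaves room to avoid the present colour of l as
well, without exceeding |N(l)|. This is what makes restarting a plan possible. -/
theorem freeColour_spec_of_eq {R : ℕ → ℕ → Prop} {n l m m' : ℕ} {f : ℕ → ℕ} (hl : l < n)
    (hm : m ∈ backNbrs R l) (hm' : m' ∈ backNbrs R l) (hne : m ≠ m') (heq : f m = f m') :
    freeColour R n f l (f l) ≤ (backNbrs R l).card ∧ freeColour R n f l (f l) ≠ f l ∧
      ∀ m < l, R m l → f m ≠ freeColour R n f l (f l) := by
  have hlt : ((backNbrs R l).image f).card < (backNbrs R l).card := by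
    refine lt_of_le_of_ne Finset.card_image_le fun h => hne ?_
    exact Finset.card_image_iff.mp h hm hm' heq
  exact freeColour_spec_of_card_le (X := insert (f l) ((backNbrs R l).image f))
    ((Finset.card_insert_le _ _).trans hlt) ((card_backNbrs_le R l).trans_lt hl)
    (Finset.subset_insert _ _) (Or.inl (Finset.mem_insert_self _ _))

/-! ### Looking for the next exchange of two colours -/

/-- The data of a planned exchange of the colours `a` and `c` on the set `D`, with least element
`t`; there is none as long as `act` fails. -/
structure Plan : Type where
  act : Prop
  t : ℕ
  a : ℕ
  c : ℕ
  D : Set ℕ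

/-- The vertex `l` has one of the two colours, and an earlier neighbour in `D` with the other. -/
def Plan.Touches (S : Plan) (R : ℕ → ℕ → Prop) (f : ℕ → ℕ) (l : ℕ) : Prop :=
  (f l = S.a ∨ f l = S.c) ∧ ∃ m < l, R m l ∧ m ∈ S.D ∧ f m ≠ f l

/-- Some earlier neighbour of `l` outside `D` has one of the two colours, but not that of `l`. -/
def Plan.Splits (S : Plan) (R : ℕ → ℕ → Prop) (f : ℕ → ℕ) (l : ℕ) : Prop :=
  ∃ m < l, R m l ∧ m ∉ S.D ∧ f m ≠ f l ∧ (f m = S.a ∨ f m = S.c)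

open Classical in
/-- The plan after inspection of the vertex `l`. -/
noncomputable def Plan.step (R : ℕ → ℕ → Prop) (n : ℕ) (f : ℕ → ℕ) (S : Plan) (l : ℕ) : Plan :=
  if S.act then
    if S.Touches R f l then
      if S.Splits R f l then ⟨True, l, f l, freeColour R n f l (f l), {l}⟩
      else { S with D := insert l S.D }
    else S
  else if f l ≠ freeColour R n f l n then ⟨True, l, f l, freeColour R n f l n, {l}⟩
  else S

/-- The plan after inspection of the vertices below `l`. -/
noncomputable def plan (R : ℕ → ℕ → Prop) (n : ℕ) (f : ℕ → ℕ) : ℕ → Plan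
  | 0 => ⟨False, 0, 0, 0, ∅⟩
  | l + 1 => (plan R n f l).step R n f l

theorem Plan.Touches.congr {S : Plan} {R : ℕ → ℕ → Prop} {f g : ℕ → ℕ} {l : ℕ}
    (h : ∀ m ≤ l, f m = g m) (hS : S.Touches R f l) : S.Touches R g l := by
  obtain ⟨h1, m, hm, hR, hD, hne⟩ := hS
  rw [h l le_rfl] at h1 hne
  rw [h m hm.le] at hne
  exact ⟨h1, m, hm, hR, hD, hne⟩

theorem Plan.Splits.congr {S : Plan} {R : ℕ → ℕ → Prop} {f g : ℕ → ℕ} {l : ℕ}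
    (h : ∀ m ≤ l, f m = g m) (hS : S.Splits R f l) : S.Splits R g l := by
  obtain ⟨m, hm, hR, hD, hne, hac⟩ := hS
  rw [h l le_rfl, h m hm.le] at hne
  rw [h m hm.le] at hac
  exact ⟨m, hm, hR, hD, hne, hac⟩

/-- The scan up to l sees only the colours below l; hence an exchange starting at t leaves the plans
up to t as they were. -/
theorem plan_congr {R : ℕ → ℕ → Prop} {n : ℕ} {f g : ℕ → ℕ} : ∀ {l : ℕ},
    (∀ m < l, f m = g m) → plan R n f l = plan R n g l
  | 0, _ => rfl
  | l + 1, h => by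
    have h' : ∀ m ≤ l, f m = g m := fun m hm => h m (Nat.lt_succ_iff.mpr hm)
    have ht : (plan R n g l).Touches R f l ↔ (plan R n g l).Touches R g l :=
      ⟨.congr h', .congr fun m hm => (h' m hm).symm⟩
    have hs : (plan R n g l).Splits R f l ↔ (plan R n g l).Splits R g l :=
      ⟨.congr h', .congr fun m hm => (h' m hm).symm⟩
    have hc : ∀ x, freeColour R n f l x = freeColour R n g l x := fun x =>
      freeColour_congr fun m hm => h' m hm.le
    simp only [plan]
    rw [plan_congr fun m hm => h' m hm.le]
    unfold Plan.step
    rw [propext ht, propext hs, hc, hc, h' l le_rfl]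

/-- What an active plan guarantees. -/
structure Plan.Valid (R : ℕ → ℕ → Prop) (w l : ℕ) (f : ℕ → ℕ) (S : Plan) : Prop where
  t_lt : S.t < l
  mem_t : S.t ∈ S.D
  colour_t : f S.t = S.a
  ne : S.a ≠ S.c
  c_le : S.c ≤ w
  range : ∀ x ∈ S.D, S.t ≤ x ∧ x < l
  colour : ∀ x ∈ S.D, f x = S.a ∨ f x = S.c
  closed : ∀ x ∈ S.D, ∀ y < l, R x y → (f y = S.a ∨ f y = S.c) → f y ≠ f x → y ∈ S.D

/-- No earlier neighbour of l has colour c, so {l} alone is closed among the vertices up to l. -/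
theorem Plan.Valid.singleton {R : ℕ → ℕ → Prop} {w l c : ℕ} {f : ℕ → ℕ}
    (hR : ∀ x y, R x y → R y x) (hc : c ≤ w) (hne : c ≠ f l)
    (hfree : ∀ m < l, R m l → f m ≠ c) :
    Plan.Valid R w (l + 1) f ⟨True, l, f l, c, {l}⟩ where
  t_lt := Nat.lt_succ_self l
  mem_t := rfl
  colour_t := rfl
  ne := hne.symm
  c_le := hc
  range := by rintro x rfl; exact ⟨le_rfl, Nat.lt_succ_self _⟩
  colour := by rintro x rfl; exact Or.inl rfl
  closed := by
    rintro x rfl y hy hxy hac hne'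
    rcases Nat.lt_succ_iff_lt_or_eq.mp hy with h | h
    · rcases hac with hac | hac
      · exact absurd hac hne'
      · exact absurd hac (hfree y h (hR _ _ hxy))
    · exact h

theorem Plan.Valid.mono {R : ℕ → ℕ → Prop} {w l : ℕ} {f : ℕ → ℕ} {S : Plan}
    (h : S.Valid R w l f) (ht : ¬ S.Touches R f l) :
    S.Valid R w (l + 1) f where
  t_lt := h.t_lt.trans (Nat.lt_succ_self l)
  mem_t := h.mem_t
  colour_t := h.colour_t
  ne := h.ne
  c_le := h.c_le
  range x hx := ⟨(h.range x hx).1, (h.range x hx).2.trans (Nat.lt_succ_self l)⟩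
  colour := h.colour
  closed := by
    intro x hx y hy hxy hac hne
    rcases Nat.lt_succ_iff_lt_or_eq.mp hy with hl | rfl
    · exact h.closed x hx y hl hxy hac hne
    · exact absurd ⟨hac, x, (h.range x hx).2, hxy, hx, hne.symm⟩ ht

theorem Plan.Valid.insert {R : ℕ → ℕ → Prop} {w l : ℕ} {f : ℕ → ℕ} {S : Plan}
    (h : S.Valid R w l f) (hR : ∀ x y, R x y → R y x) (ht : S.Touches R f l)
    (hs : ¬ S.Splits R f l) : Plan.Valid R w (l + 1) f { S with D := insert l S.D } where
  t_lt := h.t_lt.trans (Nat.lt_succ_self l)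
  mem_t := Or.inr h.mem_t
  colour_t := h.colour_t
  ne := h.ne
  c_le := h.c_le
  range := by
    rintro x (rfl | hx)
    · exact ⟨h.t_lt.le, Nat.lt_succ_self _⟩
    · exact ⟨(h.range x hx).1, (h.range x hx).2.trans (Nat.lt_succ_self l)⟩
  colour := by
    rintro x (rfl | hx)
    · exact ht.1
    · exact h.colour x hx
  closed := by
    intro x hx y hy hxy hac hne
    rcases Nat.lt_succ_iff_lt_or_eq.mp hy with hl | rfl
    · refine Or.inr ?_
      rcases hx with rfl | hx
      · by_contra hyD
        exact hs ⟨y, hl, hR _ _ hxy, hyD, hne, hac⟩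
      · exact h.closed x hx y hl hxy hac hne
    · exact Or.inl rfl

/-- If `l` is touched and split, two of its earlier neighbours have the same colour, exactly one
of them in `D`. -/
theorem Plan.Valid.exists_eq {R : ℕ → ℕ → Prop} {w l : ℕ} {f : ℕ → ℕ} {S : Plan}
    (h : S.Valid R w l f) (ht : S.Touches R f l) (hs : S.Splits R f l) :
    ∃ m ∈ backNbrs R l, ∃ m' ∈ backNbrs R l, m ∈ S.D ∧ m' ∉ S.D ∧ f m = f m' ∧ f m ≠ f l ∧
      (f m = S.a ∨ f m = S.c) := by
  obtain ⟨hl, m, hm, hR, hD, hne⟩ := ht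
  obtain ⟨m', hm', hR', hD', hne', hac'⟩ := hs
  have hac := h.colour m hD
  refine ⟨m, mem_backNbrs.mpr ⟨hm, hR⟩, m', mem_backNbrs.mpr ⟨hm', hR'⟩, hD, hD', ?_, hne, hac⟩
  grind

theorem Plan.Valid.freeColour_spec {R : ℕ → ℕ → Prop} {w n l : ℕ} {f : ℕ → ℕ} {S : Plan}
    (h : S.Valid R w l f) (ht : S.Touches R f l) (hs : S.Splits R f l) (hl : l < n) :
    freeColour R n f l (f l) ≤ (backNbrs R l).card ∧ freeColour R n f l (f l) ≠ f l ∧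
      ∀ m < l, R m l → f m ≠ freeColour R n f l (f l) := by
  obtain ⟨m, hm, m', hm', hD, hD', heq, -⟩ := h.exists_eq ht hs
  exact freeColour_spec_of_eq hl hm hm' (fun h => hD' (h ▸ hD)) heq

/-- Closedness need only be checked at each new vertex, since it concerns pairs of scanned vertices.
The second conclusion identifies an inactive scan with a greedy prefix. -/
theorem plan_valid {R : ℕ → ℕ → Prop} (hR : ∀ x y, R x y → R y x) {n w : ℕ} {f : ℕ → ℕ}
    (hw : ∀ l < n, (backNbrs R l).card ≤ w) : ∀ l ≤ n,
    ((plan R n f l).act → (plan R n f l).Valid R w l f) ∧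
      (¬ (plan R n f l).act → ∀ m < l, f m = freeColour R n f m n) := by
  intro l
  induction l with
  | zero => exact fun _ => ⟨False.elim, fun _ m hm => by omega⟩
  | succ l ih =>
    intro hl
    obtain ⟨ih1, ih2⟩ := ih (by omega)
    have hl' : l < n := hl
    simp only [plan]
    unfold Plan.step
    split_ifs with h1 h2 h3 h4
    -- Restart: the two equally coloured earlier neighbours of l, one inside and one outside D,
    -- provide the new colour.
    · have hv := ih1 h1
      obtain ⟨e1, e2, e3⟩ := hv.freeColour_spec h2 h3 hl'
      exact ⟨fun _ => Plan.Valid.singleton hR (e1.trans (hw l hl')) e2 e3, fun h => (h trivial).elim⟩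
    · exact ⟨fun _ => (ih1 h1).insert hR h2 h3, fun h => (h h1).elim⟩
    · exact ⟨fun _ => (ih1 h1).mono h2, fun h => (h h1).elim⟩
    · obtain ⟨e1, e2⟩ := freeColour_spec (R := R) (f := f) hl'
      exact ⟨fun _ => Plan.Valid.singleton hR (e1.trans (hw l hl')) (Ne.symm h4) e2,
        fun h => (h trivial).elim⟩
    · refine ⟨fun h => (h1 h).elim, fun _ m hm => ?_⟩
      rcases Nat.lt_succ_iff_lt_or_eq.mp hm with hm | rfl
      · exact ih2 h1 m hm
      · exact not_not.mp h4

open Classical in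
/-- The colours after the planned exchange. -/
noncomputable def Plan.exchange (S : Plan) (f : ℕ → ℕ) (x : ℕ) : ℕ :=
  if S.act ∧ x ∈ S.D then S.a + S.c - f x else f x

theorem Plan.exchange_of_mem {S : Plan} {f : ℕ → ℕ} {x : ℕ} (h : S.act) (hx : x ∈ S.D) :
    S.exchange f x = S.a + S.c - f x := if_pos ⟨h, hx⟩

theorem Plan.exchange_of_notMem {S : Plan} {f : ℕ → ℕ} {x : ℕ} (hx : x ∉ S.D) :
    S.exchange f x = f x := if_neg fun h => hx h.2

theorem Plan.exchange_of_not_act {S : Plan} {f : ℕ → ℕ} (h : ¬ S.act) : S.exchange f = f :=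
  funext fun _ => if_neg fun h' => h h'.1

/-- The exchange creates no new monochromatic edges. -/
theorem Plan.Valid.exchange_ne {R : ℕ → ℕ → Prop} {w n : ℕ} {f : ℕ → ℕ} {S : Plan}
    (h : S.Valid R w n f) (hR : ∀ x y, R x y → R y x) (hact : S.act) {x y : ℕ} (hx : x < n)
    (hy : y < n) (hxy : R x y) (hne : f x ≠ f y) : S.exchange f x ≠ S.exchange f y := by
  by_cases hxD : x ∈ S.D <;> by_cases hyD : y ∈ S.D
  · rw [exchange_of_mem hact hxD, exchange_of_mem hact hyD]
    have := h.colour x hxD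
    have := h.colour y hyD
    omega
  · rw [exchange_of_mem hact hxD, exchange_of_notMem hyD]
    have h1 := h.colour x hxD
    have h2 := mt (fun hac => h.closed x hxD y hy hxy hac hne.symm) hyD
    omega
  · rw [exchange_of_notMem hxD, exchange_of_mem hact hyD]
    have h1 := h.colour y hyD
    have h2 := mt (fun hac => h.closed y hyD x hx (hR _ _ hxy) hac hne) hxD
    omega
  · rwa [exchange_of_notMem hxD, exchange_of_notMem hyD]

/-- The history of an active plan: how it started at the vertex `t`, and how it grew. -/
theorem plan_history {R : ℕ → ℕ → Prop} {n : ℕ} {f : ℕ → ℕ} : ∀ {l : ℕ}, (plan R n f l).act →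
    (plan R n f l).t < l ∧ (∀ x ∈ (plan R n f l).D, x < l) ∧
    ((¬ (plan R n f (plan R n f l).t).act ∧
        f (plan R n f l).t ≠ freeColour R n f (plan R n f l).t n ∧
        (plan R n f l).c = freeColour R n f (plan R n f l).t n) ∨
      ((plan R n f (plan R n f l).t).act ∧
        (plan R n f (plan R n f l).t).Touches R f (plan R n f l).t ∧
        (plan R n f (plan R n f l).t).Splits R f (plan R n f l).t ∧
        (plan R n f l).c = freeColour R n f (plan R n f l).t (f (plan R n f l).t))) ∧
    ∀ j, (plan R n f l).t < j → j ≤ l → (plan R n f j).act ∧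
      (plan R n f j).a = (plan R n f l).a ∧ (plan R n f j).c = (plan R n f l).c ∧
      (∀ x, x ∈ (plan R n f j).D ↔ x ∈ (plan R n f l).D ∧ x < j) ∧
      (j < l → ¬ ((plan R n f j).Touches R f j ∧ (plan R n f j).Splits R f j)) := by
  intro l
  induction l with
  | zero => exact False.elim
  | succ l ih =>
    intro hact
    have hstep : plan R n f (l + 1) = (plan R n f l).step R n f l := rfl
    unfold Plan.step at hstep
    split_ifs at hstep with h1 h2 h3 h4
    · rw [hstep]
      refine ⟨by simp, by rintro x rfl; simp, Or.inr ⟨h1, h2, h3, rfl⟩, fun j hj hj' => ?_⟩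
      have hj'' : j = l + 1 := by simp only at hj; omega
      subst hj''
      rw [hstep]
      refine ⟨trivial, rfl, rfl, fun x => ⟨?_, fun h => h.1⟩, fun h => by omega⟩
      rintro rfl
      exact ⟨rfl, Nat.lt_succ_self _⟩
    · obtain ⟨e1, e2, e3, e4⟩ := ih h1
      have hD : ∀ x, x ∈ (plan R n f (l + 1)).D ↔ x = l ∨ x ∈ (plan R n f l).D := by
        rw [hstep]; exact fun x => Iff.rfl
      have ht : (plan R n f (l + 1)).t = (plan R n f l).t := by rw [hstep]
      have ha : (plan R n f (l + 1)).a = (plan R n f l).a := by rw [hstep]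
      have hc : (plan R n f (l + 1)).c = (plan R n f l).c := by rw [hstep]
      rw [ht, hc, ha]
      refine ⟨by omega, ?_, e3, fun j hj hj' => ?_⟩
      · intro x hx
        rcases (hD x).mp hx with rfl | hx
        · exact Nat.lt_succ_self _
        · exact (e2 x hx).trans (Nat.lt_succ_self l)
      · rcases Nat.lt_succ_iff_lt_or_eq.mp (Nat.lt_succ_iff.mpr hj') with hlt | rfl
        · obtain ⟨g1, g2, g3, g4, g5⟩ := e4 j hj (by omega)
          refine ⟨g1, g2, g3, fun x => ?_, fun _ => ?_⟩
          · rw [g4, hD]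
            constructor
            · exact fun h => ⟨Or.inr h.1, h.2⟩
            · rintro ⟨rfl | h, h'⟩
              · omega
              · exact ⟨h, h'⟩
          · rcases (show j ≤ l by omega).lt_or_eq with h | rfl
            · exact g5 h
            · exact fun h => h3 h.2
        · refine ⟨hact, ha, hc, fun x => ⟨fun h => ⟨h, ?_⟩, fun h => h.1⟩, fun h => by omega⟩
          rcases (hD x).mp h with rfl | hx
          · exact Nat.lt_succ_self _
          · exact (e2 x hx).trans (Nat.lt_succ_self l)
    · obtain ⟨e1, e2, e3, e4⟩ := ih h1
      rw [hstep]
      refine ⟨by omega, fun x hx => (e2 x hx).trans (Nat.lt_succ_self l), e3, fun j hj hj' => ?_⟩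
      rcases Nat.lt_succ_iff_lt_or_eq.mp (Nat.lt_succ_iff.mpr hj') with hlt | rfl
      · obtain ⟨g1, g2, g3, g4, g5⟩ := e4 j hj (by omega)
        refine ⟨g1, g2, g3, g4, fun _ => ?_⟩
        rcases (show j ≤ l by omega).lt_or_eq with h | rfl
        · exact g5 h
        · exact fun h => h2 h.1
      · rw [hstep]
        exact ⟨h1, rfl, rfl, fun x => ⟨fun h => ⟨h, (e2 x h).trans (Nat.lt_succ_self l)⟩,
          fun h => h.1⟩, fun h => by omega⟩
    · rw [hstep]
      refine ⟨by simp, by rintro x rfl; simp, Or.inl ⟨h1, h4, rfl⟩, fun j hj hj' => ?_⟩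
      have hj'' : j = l + 1 := by simp only at hj; omega
      subst hj''
      rw [hstep]
      refine ⟨trivial, rfl, rfl, fun x => ⟨?_, fun h => h.1⟩, fun h => by omega⟩
      rintro rfl
      exact ⟨rfl, Nat.lt_succ_self _⟩
    · rw [hstep] at hact
      exact (h1 hact).elim

/-! ### The potential -/

/-- Two earlier neighbours of `l` have the same colour, exactly one of them in `D`. -/
def Plan.Separates (S : Plan) (R : ℕ → ℕ → Prop) (f : ℕ → ℕ) (l : ℕ) : Prop :=
  ∃ m ∈ backNbrs R l, ∃ m' ∈ backNbrs R l, m ∈ S.D ∧ m' ∉ S.D ∧ f m = f m'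

open Classical in
/-- The contribution of the vertex `l` to the potential. -/
noncomputable def vertexPotential (R : ℕ → ℕ → Prop) (n : ℕ) (f : ℕ → ℕ) (l : ℕ) : ℕ :=
  if (plan R n f l).act then
    (backNbrs R l).card + 1 - ((backNbrs R l).image f).card -
      if (plan R n f l).Separates R f l ∧
        ¬ ((plan R n f l).Touches R f l ∧ (plan R n f l).Splits R f l) then 1 else 0
  else if f l ≠ freeColour R n f l n then 1 else 0

/-- The potential, which bounds the number of exchanges. -/
noncomputable def potential (R : ℕ → ℕ → Prop) (n : ℕ) (f : ℕ → ℕ) : ℕ :=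
  ∑ l ∈ Finset.range n, vertexPotential R n f l

theorem vertexPotential_congr {R : ℕ → ℕ → Prop} {n : ℕ} {f g : ℕ → ℕ} {l : ℕ}
    (h : ∀ m ≤ l, f m = g m) : vertexPotential R n f l = vertexPotential R n g l := by
  have h' : ∀ m ≤ l, g m = f m := fun m hm => (h m hm).symm
  have hp : plan R n f l = plan R n g l := plan_congr fun m hm => h m hm.le
  have hi : (backNbrs R l).image f = (backNbrs R l).image g :=
    Finset.image_congr fun m hm => h m (mem_backNbrs.mp hm).1.le
  have hc : freeColour R n f l n = freeColour R n g l n :=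
    freeColour_congr fun m hm => h m hm.le
  have ht : (plan R n g l).Touches R f l ↔ (plan R n g l).Touches R g l := ⟨.congr h, .congr h'⟩
  have hs : (plan R n g l).Splits R f l ↔ (plan R n g l).Splits R g l := ⟨.congr h, .congr h'⟩
  have hsep : (plan R n g l).Separates R f l ↔ (plan R n g l).Separates R g l := by
    refine exists_congr fun m => and_congr_right fun hm => exists_congr fun m' =>
      and_congr_right fun hm' => ?_
    rw [h m (mem_backNbrs.mp hm).1.le, h m' (mem_backNbrs.mp hm').1.le]
  unfold vertexPotential
  rw [hp, hi, hc, propext ht, propext hs, propext hsep, h l le_rfl]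

/-- A nonempty set of neighbours carries at least one colour, which cancels the summand 1; without
neighbours the value is at most 1. -/
theorem vertexPotential_le (R : ℕ → ℕ → Prop) (n : ℕ) (f : ℕ → ℕ) (l : ℕ) :
    vertexPotential R n f l ≤ max (backNbrs R l).card 1 := by
  unfold vertexPotential
  split_ifs
  all_goals try omega
  all_goals
    rcases (backNbrs R l).eq_empty_or_nonempty with h | h
    · simp [h]
    · have := (h.image f).card_pos
      omega

theorem potential_le (R : ℕ → ℕ → Prop) (n w : ℕ) (f : ℕ → ℕ)
    (hw : ∀ l < n, (backNbrs R l).card ≤ w) : potential R n f ≤ n * max w 1 := by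
  refine (Finset.sum_le_card_nsmul _ _ (max w 1) fun l hl => ?_).trans (by simp)
  exact (vertexPotential_le R n f l).trans (max_le_max (hw l (Finset.mem_range.mp hl)) le_rfl)

/-! ### Counting colours on a clique, and the decrease of the potential -/

/-- The colour classes of g refine those of f on N, so f factors through g on N. -/
theorem card_image_le_of_refines {N : Finset ℕ} {f g : ℕ → ℕ}
    (h : ∀ x ∈ N, ∀ y ∈ N, g x = g y → f x = f y) : (N.image f).card ≤ (N.image g).card := by
  classical
  refine Finset.card_le_card_of_surjOn (fun c => if hc : ∃ x ∈ N, g x = c then f hc.choose else 0) ?_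
  intro c hc
  obtain ⟨x, hx, rfl⟩ := Finset.mem_image.mp hc
  refine ⟨g x, Finset.mem_coe.mpr (Finset.mem_image_of_mem g hx), ?_⟩
  have hex : ∃ y ∈ N, g y = g x := ⟨x, hx, rfl⟩
  simp only [dif_pos hex]
  exact h _ hex.choose_spec.1 _ hx hex.choose_spec.2

/-- The map from g-colours to f-colours identifies the colours of x and y, so it remains surjective
after `g x` is erased. -/
theorem card_image_lt_of_refines {N : Finset ℕ} {f g : ℕ → ℕ}
    (h : ∀ x ∈ N, ∀ y ∈ N, g x = g y → f x = f y) {x y : ℕ} (hx : x ∈ N) (hy : y ∈ N)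
    (hf : f x = f y) (hg : g x ≠ g y) : (N.image f).card < (N.image g).card := by
  classical
  have hle : (N.image f).card ≤ ((N.image g).erase (g x)).card := by
    refine Finset.card_le_card_of_surjOn
      (fun c => if hc : ∃ z ∈ N, g z = c then f hc.choose else 0) ?_
    have key : ∀ z ∈ N, (if hc : ∃ z' ∈ N, g z' = g z then f hc.choose else 0) = f z := by
      intro z hz
      have hex : ∃ y ∈ N, g y = g z := ⟨z, hz, rfl⟩
      rw [dif_pos hex]
      exact h _ hex.choose_spec.1 _ hz hex.choose_spec.2
    intro c hc
    obtain ⟨z, hz, rfl⟩ := Finset.mem_image.mp hc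
    by_cases hzx : g z = g x
    · refine ⟨g y, ?_, ?_⟩
      · exact Finset.mem_coe.mpr (Finset.mem_erase.mpr ⟨hg.symm, Finset.mem_image_of_mem g hy⟩)
      · rw [h z hz x hx hzx, hf]
        exact key y hy
    · refine ⟨g z, ?_, key z hz⟩
      exact Finset.mem_coe.mpr (Finset.mem_erase.mpr ⟨hzx, Finset.mem_image_of_mem g hz⟩)
  exact hle.trans_lt (Finset.card_erase_lt_of_mem (Finset.mem_image_of_mem g hx))

/-- Earlier neighbours of a vertex are adjacent. -/
def IsElimination (R : ℕ → ℕ → Prop) (n : ℕ) : Prop :=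
  ∀ l < n, ∀ x ∈ backNbrs R l, ∀ y ∈ backNbrs R l, x ≠ y → R x y

/-- Every exchange decreases the potential. -/
theorem potential_exchange_lt {R : ℕ → ℕ → Prop} (hR : ∀ x y, R x y → R y x) {n w : ℕ}
    {f : ℕ → ℕ} (hw : ∀ l < n, (backNbrs R l).card ≤ w) (helim : IsElimination R n)
    (hact : (plan R n f n).act) :
    potential R n ((plan R n f n).exchange f) < potential R n f := by
  have hv := (plan_valid hR hw n le_rfl).1 hact
  obtain ⟨-, -, hstart, hgrow⟩ := plan_history hact
  set S := plan R n f n with hS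
  set g := S.exchange f with hg
  have hlow : ∀ m < S.t, f m = g m := fun m hm =>
    (Plan.exchange_of_notMem fun hmD => by have := (hv.range m hmD).1; omega).symm
  have hgt : g S.t = S.c := by
    rw [hg, Plan.exchange_of_mem hact hv.mem_t, hv.colour_t]
    omega
  -- The only use of the elimination property: the vertices of N(l) are pairwise adjacent, and no
  -- edge becomes monochromatic.
  have href : ∀ l < n, ∀ x ∈ backNbrs R l, ∀ y ∈ backNbrs R l, g x = g y → f x = f y := by
    intro l hl x hx y hy hxy
    by_contra hne
    have hx' := mem_backNbrs.mp hx
    have hy' := mem_backNbrs.mp hy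
    exact hv.exchange_ne hR hact (hx'.1.trans hl) (hy'.1.trans hl)
      (helim l hl x hx y hy fun h => hne (congrArg f h)) hne hxy
  have hcard : ∀ l, ((backNbrs R l).image g).card ≤ (backNbrs R l).card :=
    fun l => Finset.card_image_le
  -- The colours below t are unchanged, so only the colour of t itself matters here. In the first
  -- case t attains its greedy colour; in the second it gains the bonus.
  have hfix : vertexPotential R n g S.t < vertexPotential R n f S.t := by
    have hpg : plan R n g S.t = plan R n f S.t := plan_congr fun m hm => (hlow m hm).symm
    have hcg : ∀ x, freeColour R n g S.t x = freeColour R n f S.t x := fun x =>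
      freeColour_congr fun m hm => (hlow m hm).symm
    have hig : (backNbrs R S.t).image g = (backNbrs R S.t).image f :=
      Finset.image_congr fun m hm => (hlow m (mem_backNbrs.mp hm).1).symm
    unfold vertexPotential
    rw [hpg, hcg, hig, hgt]
    rcases hstart with ⟨h1, h2, h3⟩ | ⟨h1, h2, h3, h4⟩
    · rw [if_neg h1, if_neg h1, if_neg (not_not.mpr h3), if_pos h2]
      exact Nat.zero_lt_one
    · have hvt := (plan_valid hR hw S.t hv.t_lt.le).1 h1
      obtain ⟨x, hx, y, hy, hxD, hyD, hxy, hxt, hxac⟩ := hvt.exists_eq h2 h3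
      obtain ⟨-, e2, e3⟩ := hvt.freeColour_spec h2 h3 hv.t_lt
      rw [← h4] at e2 e3
      have hx' := mem_backNbrs.mp hx
      have hy' := mem_backNbrs.mp hy
      have hlt : ((backNbrs R S.t).image f).card < (backNbrs R S.t).card := by
        refine lt_of_le_of_ne Finset.card_image_le fun h => ?_
        exact hyD (Finset.card_image_iff.mp h hx hy hxy ▸ hxD)
      have hsep : (plan R n f S.t).Separates R g S.t :=
        ⟨x, hx, y, hy, hxD, hyD, by rw [← hlow x hx'.1, ← hlow y hy'.1, hxy]⟩
      -- The dropped plan exchanged the old colour of t and a colour present on N(t). The new colour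
      -- of t is neither of them.
      have htouch : ¬ (plan R n f S.t).Touches R g S.t := by
        rintro ⟨hac, -⟩
        rw [hgt] at hac
        have := e3 x hx'.1 hx'.2
        have := h2.1
        omega
      rw [if_pos h1, if_pos h1, if_pos ⟨hsep, fun h => htouch h.1⟩, if_neg fun h => h.2 ⟨h2, h3⟩]
      omega
  refine Finset.sum_lt_sum (fun l hl => ?_) ⟨S.t, Finset.mem_range.mpr hv.t_lt, hfix⟩
  · have hl := Finset.mem_range.mp hl
    rcases lt_trichotomy l S.t with hlt | rfl | hlt
    · exact (vertexPotential_congr fun m hm => hlow m (by omega)).ge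
    · exact hfix.le
    · obtain ⟨g1, g2, g3, g4, g5⟩ := hgrow l hlt hl.le
      -- This bound is independent of the scan for g, which beyond t may be quite different from
      -- that for f. It covers the inactive case too, its right-hand side being at least 1.
      have hle : vertexPotential R n g l ≤
          (backNbrs R l).card + 1 - ((backNbrs R l).image g).card := by
        have := hcard l
        unfold vertexPotential
        split_ifs <;> omega
      refine hle.trans ?_
      unfold vertexPotential
      rw [if_pos g1]
      by_cases hsep : (plan R n f l).Separates R f l
      -- The bonus present for f is paid for by a new colour: swapping inside D separates x from y.
      · rw [if_pos ⟨hsep, g5 hl⟩]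
        obtain ⟨x, hx, y, hy, hxD, hyD, hxy⟩ := hsep
        have hxS := ((g4 x).mp hxD).1
        have hyS : y ∉ S.D := fun h => hyD ((g4 y).mpr ⟨h, (mem_backNbrs.mp hy).1⟩)
        have := card_image_lt_of_refines (href l hl) hx hy hxy (by
          rw [hg, Plan.exchange_of_mem hact hxS, Plan.exchange_of_notMem hyS, ← hxy]
          have := hv.colour x hxS
          have := hv.ne
          omega)
        omega
      · rw [if_neg fun h => hsep h.1]
        have := card_image_le_of_refines (href l hl)
        omega

/-- The colorings without a planned exchange agree. -/
theorem eq_of_not_act {R : ℕ → ℕ → Prop} (hR : ∀ x y, R x y → R y x) {n w : ℕ} {f g : ℕ → ℕ}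
    (hw : ∀ l < n, (backNbrs R l).card ≤ w) (hf : ¬ (plan R n f n).act)
    (hg : ¬ (plan R n g n).act) : ∀ l < n, f l = g l := by
  intro l
  induction l using Nat.strong_induction_on with
  | _ l ih =>
    intro hl
    rw [(plan_valid hR hw n le_rfl).2 hf l hl, (plan_valid hR hw n le_rfl).2 hg l hl]
    exact freeColour_congr fun m hm => ih m hm (hm.trans hl)

/-! ### Derived terms -/

namespace Tm

/-- A term is true if its value is nonzero. -/
def Holds (t : Tm) (σ : Store) (e : List ℕ) : Prop := t.eval σ e ≠ 0

/-- The number `n`. -/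
def size : Tm := .inp (.const 0)

/-- Truth is nonvanishing, so truncated subtraction expresses the order, addition the disjunction,
and a search returning less than n the existential quantifier. -/
def lt' (t u : Tm) : Tm := .sub u t

def not' (t : Tm) : Tm := .sub (.const 1) t

def or' (t u : Tm) : Tm := .add t u

def and' (t u : Tm) : Tm := not' (or' (not' t) (not' u))

def eq' (t u : Tm) : Tm := not' (.add (.sub t u) (.sub u t))

def ex (t : Tm) : Tm := .sub size (.find t)

def imp' (t u : Tm) : Tm := or' (not' t) u

def all (t : Tm) : Tm := not' (ex (not' t))

variable (σ : Store) (e : List ℕ) (t u : Tm)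

@[simp] theorem eval_const (a : ℕ) : (const a).eval σ e = a := rfl

@[simp] theorem eval_var (j : ℕ) : (var j).eval σ e = e.getD j 0 := rfl

@[simp] theorem eval_inp : (inp t).eval σ e = σ.inp (t.eval σ e) := rfl

@[simp] theorem eval_arr (A : Fin 16) : (arr A t).eval σ e = σ.arr A (t.eval σ e) := rfl

@[simp] theorem eval_add : (add t u).eval σ e = t.eval σ e + u.eval σ e := rfl

@[simp] theorem eval_sub : (sub t u).eval σ e = t.eval σ e - u.eval σ e := rfl

@[simp] theorem eval_mulN : (mulN t).eval σ e = σ.inp 0 * t.eval σ e := rfl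

@[simp] theorem eval_find :
    (find t).eval σ e = leastBelow (σ.inp 0) fun i => t.Holds σ (i :: e) := rfl

@[simp] theorem eval_size : size.eval σ e = σ.inp 0 := rfl

theorem holds_iff : t.Holds σ e ↔ t.eval σ e ≠ 0 := Iff.rfl

@[simp] theorem holds_inp : (inp t).Holds σ e ↔ σ.inp (t.eval σ e) ≠ 0 := Iff.rfl

@[simp] theorem holds_arr (A : Fin 16) : (arr A t).Holds σ e ↔ σ.arr A (t.eval σ e) ≠ 0 := Iff.rfl

@[simp] theorem holds_lt' : (lt' t u).Holds σ e ↔ t.eval σ e < u.eval σ e := by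
  simp [holds_iff, lt', Nat.sub_eq_zero_iff_le]

@[simp] theorem holds_not' : (not' t).Holds σ e ↔ ¬ t.Holds σ e := by
  simp only [holds_iff, not', eval_sub, eval_const]; omega

@[simp] theorem holds_or' : (or' t u).Holds σ e ↔ t.Holds σ e ∨ u.Holds σ e := by
  simp only [holds_iff, or', eval_add]; omega

@[simp] theorem holds_and' : (and' t u).Holds σ e ↔ t.Holds σ e ∧ u.Holds σ e := by
  simp only [and', holds_not', holds_or']; tauto

@[simp] theorem holds_eq' : (eq' t u).Holds σ e ↔ t.eval σ e = u.eval σ e := by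
  simp only [holds_iff, eq', not', eval_sub, eval_const, eval_add]; omega

@[simp] theorem holds_ex : (ex t).Holds σ e ↔ ∃ i < σ.inp 0, t.Holds σ (i :: e) := by
  rw [← leastBelow_lt_iff]
  simp [holds_iff, ex, Nat.sub_eq_zero_iff_le]

@[simp] theorem holds_imp' : (imp' t u).Holds σ e ↔ (t.Holds σ e → u.Holds σ e) := by
  simp only [imp', holds_or', holds_not']; tauto

@[simp] theorem holds_all : (all t).Holds σ e ↔ ∀ i < σ.inp 0, t.Holds σ (i :: e) := by
  simp [all]

end Tm

namespace Cmd

variable (σ : Store) (e : List ℕ) (p q : Cmd) (t : Tm)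

@[simp] theorem run_skip : skip.run σ e = σ := rfl

@[simp] theorem run_set (A : Fin 16) (i v : Tm) :
    (set A i v).run σ e = σ.set A (i.eval σ e) (v.eval σ e) := rfl

@[simp] theorem run_print : (print t).run σ e = { σ with out := σ.out ++ [t.eval σ e] } := rfl

@[simp] theorem run_seq : (seq p q).run σ e = q.run (p.run σ e) e := rfl

open Classical in
theorem run_ite : (ite t p q).run σ e = if t.Holds σ e then p.run σ e else q.run σ e := by
  by_cases h : t.eval σ e ≠ 0
  · rw [if_pos (show t.Holds σ e from h)]
    exact if_pos h
  · rw [if_neg (show ¬ t.Holds σ e from h)]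
    exact if_neg h

theorem run_ite_of_holds {σ : Store} {e : List ℕ} {t : Tm} (h : t.Holds σ e) :
    (ite t p q).run σ e = p.run σ e := by rw [run_ite, if_pos h]

theorem run_ite_of_not_holds {σ : Store} {e : List ℕ} {t : Tm} (h : ¬ t.Holds σ e) :
    (ite t p q).run σ e = q.run σ e := by rw [run_ite, if_neg h]

@[simp] theorem run_bind : (bind t p).run σ e = p.run σ (t.eval σ e :: e) := rfl

variable {σ e p}

/-- Induction over the rounds of an iteration. -/
theorem iter_induction {n : ℕ} (hn : σ.inp 0 = n) (I : ℕ → Store → Prop) (h0 : I 0 σ)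
    (hstep : ∀ i < n, ∀ τ : Store, τ.inp = σ.inp → I i τ → I (i + 1) (p.run τ (i :: e))) :
    I n ((iter p).run σ e) := by
  simp only [Cmd.run, hn]
  suffices h : ∀ m ≤ n, (Nat.rec σ (fun i σ' => p.run σ' (i :: e)) m : Store).inp = σ.inp ∧
      I m (Nat.rec σ (fun i σ' => p.run σ' (i :: e)) m) from (h n le_rfl).2
  intro m
  induction m with
  | zero => exact fun _ => ⟨rfl, h0⟩
  | succ m ih =>
    intro hm
    obtain ⟨h1, h2⟩ := ih (by omega)
    exact ⟨by simpa using h1, hstep m hm _ h1 h2⟩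

/-- Counting the rounds of nested iterations. -/
theorem iter_count {n s : ℕ} {I : ℕ → Store → Prop}
    (h : ∀ (τ : Store) (e : List ℕ) (m : ℕ), τ.inp 0 = n → I m τ → I (m + s) (p.run τ e))
    (τ : Store) (e : List ℕ) (m : ℕ) (hτ : τ.inp 0 = n) (hm : I m τ) :
    I (m + n * s) ((iter p).run τ e) := by
  refine iter_induction (I := fun i τ' => I (m + i * s) τ') hτ (by simpa using hm) ?_
  intro i _ τ' hτ' hi
  have := h τ' (i :: e) _ ((congrFun hτ' 0).trans hτ) hi
  rwa [add_assoc, ← Nat.succ_mul] at this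

end Cmd

/-! ### The elimination order -/

open Tm Cmd

/-- The entry of the adjacency matrix of `G`. -/
def edgeG (u v : Tm) : Tm := .inp (.add (.const 2) (.add (.mulN u) v))

/-- The entry of the adjacency matrix of the chordal supergraph. -/
def edgeH (u v : Tm) : Tm := .inp (.add (.const 2) (.add (.mulN (.add size u)) v))

/-- The local variable `0` is a simplicial vertex of the graph of the unused vertices. -/
def simplicialTm : Tm :=
  and' (not' (.arr 1 (.var 0))) (all (imp' (not' (.arr 1 (.var 0)))
    (imp' (edgeH (.var 1) (.var 0)) (all (imp' (not' (.arr 1 (.var 0)))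
      (imp' (edgeH (.var 2) (.var 0)) (imp' (not' (eq' (.var 1) (.var 0)))
        (edgeH (.var 1) (.var 0)))))))))

/-- Repeatedly removes a simplicial vertex; the vertices are listed backwards in the array `0`. -/
def orderCmd : Cmd :=
  .iter (.bind (.find simplicialTm)
    (.seq (.set 0 (.sub (.sub size (.const 1)) (.var 1)) (.var 0)) (.set 1 (.var 0) (.const 1))))

/-- The input words of `σ` describe `G` and `H`. -/
structure DescribesInput {n : ℕ} (σ : Store) (G H : SimpleGraph (Fin n)) : Prop where
  size : σ.inp 0 = n
  graph : ∀ u v : Fin n, σ.inp (2 + (n * u + v)) ≠ 0 ↔ G.Adj u v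
  supergraph : ∀ u v : Fin n, σ.inp (2 + (n * (n + u) + v)) ≠ 0 ↔ H.Adj u v

theorem DescribesInput.of_inp_eq {n : ℕ} {σ τ : Store} {G H : SimpleGraph (Fin n)}
    (h : DescribesInput σ G H) (hτ : τ.inp = σ.inp) : DescribesInput τ G H :=
  ⟨hτ ▸ h.size, hτ ▸ h.graph, hτ ▸ h.supergraph⟩

/-- The vertex removed in round j is placed at position n - 1 - j. When it is removed, its
neighbours among the remaining vertices, that is at earlier positions, form a clique. -/
theorem orderCmd_correct {n : ℕ} {σ : Store} {G H : SimpleGraph (Fin n)}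
    (hσ : DescribesInput σ G H) (hH : IsChordal H) (hused : ∀ v, σ.arr 1 v = 0) (e : List ℕ) :
    ∃ o : Fin n ≃ Fin n, (∀ l : Fin n, (orderCmd.run σ e).arr 0 l = o l) ∧
      ∀ l x y : Fin n, x < l → y < l → H.Adj (o x) (o l) → H.Adj (o y) (o l) → x ≠ y →
        H.Adj (o x) (o y) := by
  rcases Nat.eq_zero_or_pos n with rfl | hn0
  · exact ⟨Equiv.refl _, fun l => l.elim0, fun l => l.elim0⟩
  let I : ℕ → Store → Prop := fun j τ => ∃ g : ℕ → Fin n,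
    (∀ i < j, τ.arr 0 (n - 1 - i) = g i) ∧
    (∀ v : Fin n, τ.arr 1 v ≠ 0 ↔ ∃ i < j, g i = v) ∧
    (∀ i < j, ∀ i' < i, g i' ≠ g i) ∧
    ∀ i < j, IsSimplicialIn H {v | ∀ i' < i, g i' ≠ v} (g i)
  have key : I n (orderCmd.run σ e) := by
    refine iter_induction hσ.size I ⟨fun _ => ⟨0, hn0⟩, by simp, by simp [hused], by simp,
      by simp⟩ ?_
    rintro j hj τ hτ ⟨g, h1, h2, h3, h4⟩
    have hτ' := hσ.of_inp_eq hτ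
    set A : Set (Fin n) := {v | ∀ i < j, g i ≠ v} with hA
    -- Fewer than n vertices have been removed, so the search finds a simplicial one.
    have hAne : A.Nonempty := by
      by_contra hemp
      have hsurj : ∀ v : Fin n, ∃ i : Fin j, g i = v := by
        intro v
        by_contra hc
        push Not at hc
        exact hemp ⟨v, fun i hi => hc ⟨i, hi⟩⟩
      have := Fintype.card_le_of_surjective (fun i : Fin j => g i) hsurj
      simp at this
      omega
    have hAused : ∀ v : Fin n, τ.arr 1 v = 0 ↔ v ∈ A := by
      intro v
      rw [← not_iff_not]
      refine (h2 v).trans ?_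
      simp [hA]
    set φ : ℕ → Prop := fun v => τ.arr 1 v = 0 ∧ ∀ x < n, τ.arr 1 x = 0 →
      τ.inp (2 + (n * (n + v) + x)) ≠ 0 → ∀ y < n, τ.arr 1 y = 0 →
      τ.inp (2 + (n * (n + v) + y)) ≠ 0 → x ≠ y → τ.inp (2 + (n * (n + x) + y)) ≠ 0 with hφ
    have hφs : ∀ v : Fin n, φ v ↔ v ∈ A ∧ IsSimplicialIn H A v := by
      intro v
      rw [hφ]
      simp only [hAused]
      refine and_congr_right fun hv => ⟨fun h x hx y hy hvx hvy hxy => ?_,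
        fun h x hx hxA hvx y hy hyA hvy hxy => ?_⟩
      · exact (hτ'.supergraph x y).mp (h x x.isLt ((hAused x).mpr hx)
          ((hτ'.supergraph v x).mpr hvx) y y.isLt ((hAused y).mpr hy)
          ((hτ'.supergraph v y).mpr hvy) fun h => hxy (Fin.ext h))
      · exact (hτ'.supergraph ⟨x, hx⟩ ⟨y, hy⟩).mpr (h ⟨x, hx⟩ ((hAused ⟨x, hx⟩).mp hxA) ⟨y, hy⟩
          ((hAused ⟨y, hy⟩).mp hyA) ((hτ'.supergraph v ⟨x, hx⟩).mp hvx)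
          ((hτ'.supergraph v ⟨y, hy⟩).mp hvy) fun h => hxy (congrArg Fin.val h))
    obtain ⟨z, hz⟩ := hH.exists_simplicial A.toFinite hAne
    have hlt : leastBelow n φ < n := leastBelow_lt_iff.mpr ⟨z, z.isLt, (hφs z).mpr hz⟩
    have hu := (hφs ⟨_, hlt⟩).mp (of_leastBelow_lt hlt)
    set u : Fin n := ⟨leastBelow n φ, hlt⟩ with hu_def
    have hfind : (Tm.find simplicialTm).eval τ (j :: e) = u := by
      have hφ' : ∀ v, simplicialTm.Holds τ (v :: j :: e) ↔ φ v := by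
        intro v
        simp [simplicialTm, edgeH, hφ, hτ'.size]
      rw [eval_find, hτ'.size]
      simp only [hφ']
      rfl
    rw [run_bind, hfind]
    simp only [run_seq, run_set, eval_sub, eval_size, eval_const, eval_var, List.getD_cons_zero,
      List.getD_cons_succ, hτ'.size]
    refine ⟨fun i => if i = j then u else g i, ?_, ?_, ?_, ?_⟩
    · intro i hi
      by_cases hij : i = j
      · simp [hij]
      · simp [hij, show n - 1 - i ≠ n - 1 - j by omega, h1 i (by omega)]
    · intro v
      simp only [Store.set_arr, true_and]
      by_cases hv : v = u
      · subst hv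
        simp only [if_true]
        simp only [ne_eq, one_ne_zero, not_false_eq_true, true_iff]
        exact ⟨j, by omega, by simp⟩
      · have hv' : (v : ℕ) ≠ u := fun h => hv (Fin.ext h)
        simp only [hv', if_false, Fin.reduceEq, false_and]
        refine (h2 v).trans ⟨?_, ?_⟩
        · rintro ⟨i, hi, rfl⟩
          exact ⟨i, by omega, by rw [if_neg (by omega)]⟩
        · rintro ⟨i, hi, hiv⟩
          by_cases hij : i = j
          · rw [if_pos hij] at hiv
            exact absurd hiv.symm hv
          · rw [if_neg hij] at hiv
            exact ⟨i, by omega, hiv⟩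
    · intro i hi i' hi'
      beta_reduce
      rw [if_neg (show i' ≠ j by omega)]
      by_cases hij : i = j
      · rw [if_pos hij]
        exact hu.1 i' (by omega)
      · rw [if_neg hij]
        exact h3 i (by omega) i' hi'
    · intro i hi
      have hset : {v : Fin n | ∀ i' < i, (if i' = j then u else g i') ≠ v} =
          {v | ∀ i' < i, g i' ≠ v} := by
        ext v
        refine forall_congr' fun i' => imp_congr_right fun hi' => ?_
        rw [if_neg (by omega)]
      rw [hset]
      beta_reduce
      by_cases hij : i = j
      · subst hij
        rw [if_pos rfl]
        exact hu.2
      · rw [if_neg hij]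
        exact h4 i (by omega)
  obtain ⟨g, h1, -, h3, h4⟩ := key
  have hne : ∀ i j, i < n → j < n → g i = g j → i = j := by
    intro i j hi hj h
    by_contra hij
    rcases Nat.lt_or_gt_of_ne hij with h' | h'
    · exact h3 j hj i h' h
    · exact h3 i hi j h' h.symm
  have hinj : Function.Injective fun l : Fin n => g (n - 1 - l) := by
    intro l l' h
    have := hne _ _ (by omega) (by omega) h
    exact Fin.ext (by omega)
  refine ⟨Equiv.ofBijective _ (Finite.injective_iff_bijective.mp hinj), fun l => ?_, ?_⟩
  · have := h1 (n - 1 - l) (by omega)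
    rwa [show n - 1 - (n - 1 - (l : ℕ)) = l by omega] at this
  · intro l x y hx hy hlx hly hxy
    simp only [Equiv.ofBijective_apply] at hlx hly ⊢
    refine h4 (n - 1 - l) (by omega) _ ?_ _ ?_ hlx.symm hly.symm fun h => hxy (hinj h)
    · intro i hi h
      have := hne _ _ (by omega) (by omega) h
      omega
    · intro i hi h
      have := hne _ _ (by omega) (by omega) h
      omega

/-! ### Looking for the next exchange: the program -/

/-- The vertices at the positions `x` and `y` are adjacent in the chordal supergraph. -/
def adjH (x y : Tm) : Tm := edgeH (.arr 0 x) (.arr 0 y)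

/-- The vertices at the positions `x` and `y` are adjacent. -/
def adjG (x y : Tm) : Tm := edgeG (.arr 0 x) (.arr 0 y)

/-- The position `x` belongs to the set of the planned exchange. -/
def inPlan (x : Tm) : Tm := and' (not' (lt' x (.arr 9 (.const 0)))) (.arr 3 x)

/-- The position `x` has one of the two colours of the planned exchange. -/
def hasColour (x : Tm) : Tm :=
  or' (eq' (.arr 2 x) (.arr 10 (.const 0))) (eq' (.arr 2 x) (.arr 11 (.const 0)))

/-- The least colour different from `x` that is not used on the earlier neighbours of the position
given by the local variable `1`. -/
def freeColourTm (x : Tm) : Tm :=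
  .find (and' (not' (eq' (.var 0) x)) (not' (ex (and' (lt' (.var 0) (.var 2))
    (and' (adjH (.var 0) (.var 2)) (eq' (.arr 2 (.var 0)) (.var 1)))))))

/-- The position inspected is the local variable 0; under the quantifier it becomes variable 1. The
same holds for `splitsTm`. -/
def touchesTm : Tm :=
  and' (hasColour (.var 0)) (ex (and' (lt' (.var 0) (.var 1)) (and' (adjH (.var 0) (.var 1))
    (and' (inPlan (.var 0)) (not' (eq' (.arr 2 (.var 0)) (.arr 2 (.var 1))))))))

def splitsTm : Tm :=
  ex (and' (lt' (.var 0) (.var 1)) (and' (adjH (.var 0) (.var 1)) (and' (not' (inPlan (.var 0)))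
    (and' (not' (eq' (.arr 2 (.var 0)) (.arr 2 (.var 1)))) (hasColour (.var 0))))))

/-- Start a new plan at the position given by the local variable `0`. -/
def launchCmd (x : Tm) : Cmd :=
  .seq (.set 11 (.const 0) (freeColourTm x)) (.seq (.set 10 (.const 0) (.arr 2 (.var 0)))
    (.seq (.set 9 (.const 0) (.var 0)) (.seq (.set 8 (.const 0) (.const 1))
      (.set 3 (.var 0) (.const 1)))))

/-- During an active plan the entry of array 3 is written also when the position is not joined,
since earlier scans may have left marks there. -/
def stepCmd : Cmd :=
  .ite (.arr 8 (.const 0))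
    (.ite touchesTm (.ite splitsTm (launchCmd (.arr 2 (.var 1))) (.set 3 (.var 0) (.const 1)))
      (.set 3 (.var 0) (.const 0)))
    (.ite (not' (eq' (.arr 2 (.var 0)) (freeColourTm size))) (launchCmd size) .skip)

def planCmd : Cmd := .seq (.set 8 (.const 0) (.const 0)) (.iter stepCmd)

/-- The store holds the plan `S` for the positions below `l`. -/
structure Tracks (τ : Store) (S : Plan) (l : ℕ) : Prop where
  act : τ.arr 8 0 ≠ 0 ↔ S.act
  t : S.act → τ.arr 9 0 = S.t
  a : S.act → τ.arr 10 0 = S.a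
  c : S.act → τ.arr 11 0 = S.c
  D : S.act → ∀ m < l, (¬ m < S.t ∧ τ.arr 3 m ≠ 0) ↔ m ∈ S.D

/-- The relation `R` is the adjacency in the chordal supergraph, as a relation on positions. -/
def DescribesRel (n : ℕ) (σ : Store) (R : ℕ → ℕ → Prop) : Prop :=
  ∀ m < n, ∀ l < n, σ.inp (2 + (n * (n + σ.arr 0 m) + σ.arr 0 l)) ≠ 0 ↔ R m l

section

variable {n : ℕ} {σ : Store} {R : ℕ → ℕ → Prop}

theorem freeColourTm_eval (hn : σ.inp 0 = n) (hR : DescribesRel n σ R) {l : ℕ} (hl : l < n)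
    (e : List ℕ) {x : Tm} {v : ℕ} (hx : ∀ i, x.eval σ (i :: l :: e) = v) :
    (freeColourTm x).eval σ (l :: e) = freeColour R n (σ.arr 2) l v := by
  rw [freeColourTm, eval_find, hn, freeColour]
  refine leastBelow_congr fun c hc => ?_
  simp only [holds_and', holds_not', holds_eq', hx, eval_var, List.getD_cons_zero, holds_ex, hn,
    holds_lt', List.getD_cons_succ, adjH, edgeH, holds_inp, eval_add, eval_const, eval_mulN,
    eval_size, eval_arr]
  refine and_congr_right fun _ => not_congr ⟨?_, ?_⟩
  · rintro ⟨m, hm, hml, hadj, heq⟩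
    exact ⟨m, hml, (hR m hm l hl).mp hadj, heq⟩
  · rintro ⟨m, hml, hadj, heq⟩
    exact ⟨m, hml.trans hl, hml, (hR m (hml.trans hl) l hl).mpr hadj, heq⟩

theorem touchesTm_holds (hn : σ.inp 0 = n) (hR : DescribesRel n σ R) {l : ℕ} (hl : l < n)
    (e : List ℕ) {S : Plan} (hS : Tracks σ S l) (hact : S.act) :
    touchesTm.Holds σ (l :: e) ↔ S.Touches R (σ.arr 2) l := by
  simp only [touchesTm, hasColour, inPlan, holds_and', holds_or', holds_not', holds_eq', eval_var,
    List.getD_cons_zero, holds_ex, hn, holds_lt', List.getD_cons_succ, adjH, edgeH, holds_inp,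
    eval_add, eval_const, eval_mulN, eval_size, eval_arr, holds_arr, hS.a hact, hS.c hact,
    hS.t hact]
  refine and_congr_right fun _ => ⟨?_, ?_⟩
  · rintro ⟨m, hm, hml, hadj, hD, hne⟩
    exact ⟨m, hml, (hR m hm l hl).mp hadj, (hS.D hact m hml).mp hD, hne⟩
  · rintro ⟨m, hml, hadj, hD, hne⟩
    exact ⟨m, hml.trans hl, hml, (hR m (hml.trans hl) l hl).mpr hadj, (hS.D hact m hml).mpr hD,
      hne⟩

theorem splitsTm_holds (hn : σ.inp 0 = n) (hR : DescribesRel n σ R) {l : ℕ} (hl : l < n)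
    (e : List ℕ) {S : Plan} (hS : Tracks σ S l) (hact : S.act) :
    splitsTm.Holds σ (l :: e) ↔ S.Splits R (σ.arr 2) l := by
  simp only [splitsTm, hasColour, inPlan, holds_and', holds_or', holds_not', holds_eq', eval_var,
    List.getD_cons_zero, holds_ex, hn, holds_lt', List.getD_cons_succ, adjH, edgeH, holds_inp,
    eval_add, eval_const, eval_mulN, eval_size, eval_arr, holds_arr, hS.a hact, hS.c hact,
    hS.t hact]
  constructor
  · rintro ⟨m, hm, hml, hadj, hD, hne, hac⟩
    exact ⟨m, hml, (hR m hm l hl).mp hadj, mt (hS.D hact m hml).mpr hD, hne, hac⟩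
  · rintro ⟨m, hml, hadj, hD, hne, hac⟩
    exact ⟨m, hml.trans hl, hml, (hR m (hml.trans hl) l hl).mpr hadj,
      mt (hS.D hact m hml).mp hD, hne, hac⟩

theorem launchCmd_tracks (hn : σ.inp 0 = n) (hR : DescribesRel n σ R) {l : ℕ} (hl : l < n)
    (e : List ℕ) {x : Tm} {v : ℕ} (hx : ∀ i, x.eval σ (i :: l :: e) = v) :
    Tracks ((launchCmd x).run σ (l :: e))
      ⟨True, l, σ.arr 2 l, freeColour R n (σ.arr 2) l v, {l}⟩ (l + 1) := by
  rw [← freeColourTm_eval hn hR hl e hx]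
  refine ⟨?_, fun _ => ?_, fun _ => ?_, fun _ => ?_, fun _ m hm => ?_⟩
  · simp [launchCmd]
  · simp [launchCmd]
  · simp [launchCmd]
  · simp [launchCmd]
  -- Old marks in array 3 need no clearing: those before l are below the new t, where marks are
  -- ignored.
  · simp only [launchCmd, run_seq, run_set, Store.set_arr]
    simp only [Fin.reduceEq, false_and, if_false, true_and, eval_const, eval_var,
      List.getD_cons_zero, Set.mem_singleton_iff]
    constructor
    · intro h; omega
    · rintro rfl; simp

theorem stepCmd_tracks (hn : σ.inp 0 = n) (hR : DescribesRel n σ R) {l : ℕ} (hl : l < n)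
    (e : List ℕ) {S : Plan} (hS : Tracks σ S l) (hD : S.act → ∀ x ∈ S.D, x < l)
    (ht : S.act → S.t < l) :
    Tracks (stepCmd.run σ (l :: e)) (S.step R n (σ.arr 2) l) (l + 1) := by
  unfold Plan.step
  split_ifs with h1 h2 h3 h3
  · rw [stepCmd, run_ite_of_holds _ _ (by simpa using hS.act.mpr h1),
      run_ite_of_holds _ _ ((touchesTm_holds hn hR hl e hS h1).mpr h2),
      run_ite_of_holds _ _ ((splitsTm_holds hn hR hl e hS h1).mpr h3)]
    exact launchCmd_tracks hn hR hl e fun i => by simp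
  · rw [stepCmd, run_ite_of_holds _ _ (by simpa using hS.act.mpr h1),
      run_ite_of_holds _ _ ((touchesTm_holds hn hR hl e hS h1).mpr h2),
      run_ite_of_not_holds _ _ (mt (splitsTm_holds hn hR hl e hS h1).mp h3)]
    refine ⟨by simpa using hS.act, by simpa using hS.t, by simpa using hS.a, by simpa using hS.c,
      fun _ m hm => ?_⟩
    simp only [run_set, eval_var, List.getD_cons_zero, eval_const, Store.set_arr, true_and]
    rw [Set.mem_insert_iff]
    have := ht h1
    rcases Nat.lt_succ_iff_lt_or_eq.mp hm with hm | rfl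
    · rw [if_neg (by omega), or_iff_right (by omega)]
      exact hS.D h1 m hm
    · simp [this.le]
  · rw [stepCmd, run_ite_of_holds _ _ (by simpa using hS.act.mpr h1),
      run_ite_of_not_holds _ _ (mt (touchesTm_holds hn hR hl e hS h1).mp h2)]
    refine ⟨by simpa using hS.act, by simpa using hS.t, by simpa using hS.a, by simpa using hS.c,
      fun _ m hm => ?_⟩
    simp only [run_set, eval_var, List.getD_cons_zero, eval_const, Store.set_arr, true_and]
    rcases Nat.lt_succ_iff_lt_or_eq.mp hm with hm | rfl
    · rw [if_neg (by omega)]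
      exact hS.D h1 m hm
    -- The mark of l has just been erased, and l is not in D because D lies below l.
    · simp only [if_true, ne_eq, not_true_eq_false, and_false, false_iff]
      exact fun h => absurd (hD h1 m h) (lt_irrefl m)
  · rw [stepCmd, run_ite_of_not_holds _ _ (by simpa using mt hS.act.mp h1),
      run_ite_of_holds]
    · exact launchCmd_tracks hn hR hl e fun i => by simp [hn]
    · rw [holds_not', holds_eq', freeColourTm_eval hn hR hl e (v := n) fun i => by simp [hn]]
      simpa using h3
  · rw [stepCmd, run_ite_of_not_holds _ _ (by simpa using mt hS.act.mp h1),
      run_ite_of_not_holds]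
    · exact ⟨hS.act, hS.t, hS.a, hS.c, fun h => absurd h h1⟩
    · rw [holds_not', holds_eq', freeColourTm_eval hn hR hl e (v := n) fun i => by simp [hn]]
      simpa using h3

theorem planCmd_tracks (hn : σ.inp 0 = n) (hR : DescribesRel n σ R) (e : List ℕ) :
    Tracks (planCmd.run σ e) (plan R n (σ.arr 2) n) n := by
  rw [planCmd, run_seq]
  set σ₀ := (Cmd.set 8 (.const 0) (.const 0)).run σ e with hσ₀
  have h0 : σ₀.arr 0 = σ.arr 0 := Cmd.run_arr_of_notMem _ (by decide) _ _
  have h2 : σ₀.arr 2 = σ.arr 2 := Cmd.run_arr_of_notMem _ (by decide) _ _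
  have hinp : σ₀.inp = σ.inp := Cmd.run_inp _ _ _
  refine (Cmd.iter_induction (n := n) (p := stepCmd) (by rw [hinp, hn])
    (fun l τ => τ.arr 0 = σ.arr 0 ∧ τ.arr 2 = σ.arr 2 ∧ Tracks τ (plan R n (σ.arr 2) l) l) ⟨h0, h2, ?_⟩ ?_).2.2
  · exact ⟨by simp [hσ₀, plan], False.elim, False.elim, False.elim, False.elim⟩
  · rintro l hl τ hτ ⟨g0, g2, htr⟩
    refine ⟨(Cmd.run_arr_of_notMem _ (by decide) _ _).trans g0,
      (Cmd.run_arr_of_notMem _ (by decide) _ _).trans g2, ?_⟩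
    have := stepCmd_tracks (σ := τ) (R := R) (n := n) (by rw [hτ, hinp, hn])
      (by unfold DescribesRel; rw [hτ, hinp, g0]; exact hR) hl e htr
      (fun h => (plan_history h).2.1) fun h => (plan_history h).1
    rw [g2] at this
    exact this

end

/-! ### Performing an exchange by Kempe changes -/

/-- The local variable `0` is an unmarked position of one of the two colours, adjacent to a marked
position. -/
def growTm : Tm :=
  and' (not' (.arr 4 (.var 0))) (and' (hasColour (.var 0))
    (ex (and' (.arr 4 (.var 0)) (adjG (.var 0) (.var 1)))))

/-- The search returns n when no position can be added, and then nothing is done. -/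
def growCmd : Cmd :=
  .bind (.find growTm) (.ite (lt' (.var 0) size) (.set 4 (.var 0) (.const 1)) .skip)

/-- Mark the Kempe chain of the position given by the local variable `0`. -/
def markCmd : Cmd :=
  .seq (.iter (.set 4 (.var 0) (.const 0))) (.seq (.set 4 (.var 0) (.const 1)) (.iter growCmd))

/-- The other one of the two colours, for the position given by the local variable `0`. -/
def otherColour : Tm :=
  .sub (.add (.arr 10 (.const 0)) (.arr 11 (.const 0))) (.arr 2 (.var 0))

/-- Exchange the two colours on the marked positions, and remove these from the plan. -/
def swapCmd : Cmd :=
  .iter (.ite (.arr 4 (.var 0)) (.seq (.set 2 (.var 0) otherColour) (.set 3 (.var 0) (.const 0)))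
    .skip)

/-- Note the Kempe change at the position given by the local variable `0`. -/
def logCmd : Cmd :=
  .seq (.set 5 (.arr 12 (.const 0)) (.arr 0 (.var 0)))
    (.seq (.set 6 (.arr 12 (.const 0)) otherColour)
      (.seq (.set 7 (.arr 12 (.const 0)) (.arr 2 (.var 0)))
        (.set 12 (.const 0) (.add (.arr 12 (.const 0)) (.const 1)))))

def chainCmd : Cmd := .seq logCmd (.seq markCmd swapCmd)

def exchangeCmd : Cmd :=
  .iter (.bind (.find (and' (.arr 8 (.const 0)) (inPlan (.var 0))))
    (.ite (lt' (.var 0) size) chainCmd .skip))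

/-- The position `x` has one of the two colours. -/
def HasColour (σ : Store) (x : ℕ) : Prop := σ.arr 2 x = σ.arr 10 0 ∨ σ.arr 2 x = σ.arr 11 0

section

variable {n : ℕ} {σ : Store}

/-- Each round adds one position or finds the marked set closed, so n rounds suffice. Kempe chains
enter only through this description as the least closed set containing x. -/
theorem markCmd_correct (hn : σ.inp 0 = n) {Gr : Fin n → Fin n → Prop}
    (hG : ∀ p q : Fin n, σ.inp (2 + (n * σ.arr 0 p + σ.arr 0 q)) ≠ 0 ↔ Gr p q) (x : Fin n)
    (e : List ℕ) :
    let τ := markCmd.run σ (x :: e)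
    τ.arr 4 x ≠ 0 ∧
    (∀ p q : Fin n, τ.arr 4 p ≠ 0 → Gr p q → HasColour σ q → τ.arr 4 q ≠ 0) ∧
    ∀ D : Set (Fin n), x ∈ D → (∀ p ∈ D, ∀ q, Gr p q → HasColour σ q → q ∈ D) →
      ∀ y : Fin n, τ.arr 4 y ≠ 0 → y ∈ D := by
  classical
  let I : ℕ → Store → Prop := fun i τ =>
    (τ.arr 0 = σ.arr 0 ∧ τ.arr 2 = σ.arr 2 ∧ τ.arr 10 = σ.arr 10 ∧ τ.arr 11 = σ.arr 11) ∧
    τ.arr 4 x ≠ 0 ∧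
    ((∀ p q : Fin n, τ.arr 4 p ≠ 0 → Gr p q → HasColour σ q → τ.arr 4 q ≠ 0) ∨
      i < (Finset.univ.filter fun q : Fin n => τ.arr 4 q ≠ 0).card) ∧
    ∀ D : Set (Fin n), x ∈ D → (∀ p ∈ D, ∀ q, Gr p q → HasColour σ q → q ∈ D) →
      ∀ y : Fin n, τ.arr 4 y ≠ 0 → y ∈ D
  intro τ
  suffices h : I n τ by
    obtain ⟨-, h1, h2, h3⟩ := h
    refine ⟨h1, h2.resolve_right fun h => ?_, h3⟩
    have := Finset.card_filter_le (Finset.univ : Finset (Fin n)) fun q => τ.arr 4 q ≠ 0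
    rw [Finset.card_univ, Fintype.card_fin] at this
    omega
  have hτ : τ = (Cmd.iter growCmd).run (((Cmd.iter (.set 4 (.var 0) (.const 0))).run σ
    (x :: e)).set 4 x 1) (x :: e) := rfl
  set σ₁ := (Cmd.iter (.set 4 (.var 0) (.const 0))).run σ (x :: e) with hσ₁
  have h4 : ∀ y < n, σ₁.arr 4 y = 0 := by
    refine iter_induction hn (fun i τ => ∀ y < i, τ.arr 4 y = 0) (by simp) ?_
    intro i hi τ hτ h y hy
    simp only [run_set, eval_var, List.getD_cons_zero, eval_const, Store.set_arr, true_and]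
    split_ifs with hyi
    · rfl
    · exact h y (by omega)
  have hf : ∀ A : Fin 16, A ≠ 4 → σ₁.arr A = σ.arr A := fun A hA =>
    Cmd.run_arr_of_notMem _ (by simpa [Cmd.writes] using hA) _ _
  have hinp : σ₁.inp = σ.inp := Cmd.run_inp _ _ _
  rw [hτ]
  refine iter_induction (n := n) (by rw [Store.set_inp, hinp, hn]) I ?_ ?_
  · have hx : ∀ y : Fin n, (σ₁.set 4 x 1).arr 4 y ≠ 0 ↔ y = x := by
      intro y
      rw [Store.set_arr]
      by_cases hy : y = x
      · simp [hy]
      · simp [hy, h4 y y.isLt, Fin.val_inj]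
    refine ⟨⟨?_, ?_, ?_, ?_⟩, (hx x).mpr rfl, Or.inr ?_, ?_⟩
    · funext y; simp [hf 0]
    · funext y; simp [hf 2]
    · funext y; simp [hf 10]
    · funext y; simp [hf 11]
    · exact Finset.card_pos.mpr ⟨x, by simp⟩
    · intro D hxD _ y hy
      rwa [(hx y).mp hy]
  · rintro i hi τ' hτ' ⟨⟨g0, g2, g10, g11⟩, hx, hor, hmin⟩
    have hn' : τ'.inp 0 = n := by rw [hτ', Store.set_inp, hinp, hn]
    have hG' : ∀ p q : Fin n, τ'.inp (2 + (n * τ'.arr 0 p + τ'.arr 0 q)) ≠ 0 ↔ Gr p q := by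
      rw [hτ', Store.set_inp, hinp, g0]; exact hG
    have hgrow : ∀ q : Fin n, growTm.Holds τ' (q :: i :: x :: e) ↔
        τ'.arr 4 q = 0 ∧ HasColour σ q ∧ ∃ p : Fin n, τ'.arr 4 p ≠ 0 ∧ Gr p q := by
      intro q
      simp only [growTm, hasColour, adjG, edgeG, holds_and', holds_not', holds_arr, eval_var,
        List.getD_cons_zero, List.getD_cons_succ, holds_or', holds_eq', eval_arr, eval_const,
        holds_ex, holds_inp, eval_add, eval_mulN, hn', g2, g10, g11, not_not]
      refine and_congr_right fun _ => and_congr_right fun _ => ⟨?_, ?_⟩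
      · rintro ⟨p, hp, h1, h2⟩
        exact ⟨⟨p, hp⟩, h1, (hG' ⟨p, hp⟩ q).mp h2⟩
      · rintro ⟨p, h1, h2⟩
        exact ⟨p, p.isLt, h1, (hG' p q).mpr h2⟩
    rw [growCmd, run_bind, eval_find, hn']
    set q := leastBelow n fun j => growTm.Holds τ' (j :: i :: x :: e) with hq
    by_cases hqn : q < n
    · have hg := (hgrow ⟨q, hqn⟩).mp (of_leastBelow_lt hqn)
      rw [run_ite_of_holds _ _ (by simpa [hn'] using hqn)]
      simp only [run_set, eval_var, List.getD_cons_zero, eval_const]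
      have hmark : ∀ y : Fin n, (τ'.set 4 q 1).arr 4 y ≠ 0 ↔ y = ⟨q, hqn⟩ ∨ τ'.arr 4 y ≠ 0 := by
        intro y
        rw [Store.set_arr]
        by_cases hy : y = ⟨q, hqn⟩
        · simp [hy]
        · have hy' : (y : ℕ) ≠ q := fun h => hy (Fin.ext h)
          simp [hy, hy']
      obtain ⟨hq0, hqc, p, hp, hpq⟩ := hg
      refine ⟨⟨?_, ?_, ?_, ?_⟩, (hmark x).mpr (Or.inr hx), Or.inr ?_, ?_⟩
      · funext y; simp [g0]
      · funext y; simp [g2]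
      · funext y; simp [g10]
      · funext y; simp [g11]
      -- The set was not yet closed, so it had more than i elements, and now has one more.
      · have hlt := hor.resolve_left fun h => h p _ hp hpq hqc hq0
        have hsub : insert (⟨q, hqn⟩ : Fin n) (Finset.univ.filter fun q : Fin n => τ'.arr 4 q ≠ 0) ⊆
            Finset.univ.filter fun y : Fin n => (τ'.set 4 q 1).arr 4 y ≠ 0 := by
          intro y hy
          rw [Finset.mem_filter, hmark]
          simpa using hy
        have := Finset.card_le_card hsub
        rw [Finset.card_insert_of_notMem (by simpa using hq0)] at this
        omega
      · intro D hxD hD y hy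
        rcases (hmark y).mp hy with rfl | hy
        · exact hD p (hmin D hxD hD p hp) _ hpq hqc
        · exact hmin D hxD hD y hy
    · rw [run_ite_of_not_holds _ _ (by simpa [hn'] using hqn), run_skip]
      refine ⟨⟨g0, g2, g10, g11⟩, hx, Or.inl ?_, hmin⟩
      intro p r hp hpr hr hr0
      exact hqn (leastBelow_lt_iff.mpr ⟨r, r.isLt, (hgrow r).mpr ⟨hr0, hr, p, hp, hpr⟩⟩)

theorem swapCmd_correct (hn : σ.inp 0 = n) (e : List ℕ) :
    (∀ y < n, (swapCmd.run σ e).arr 2 y =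
      if σ.arr 4 y = 0 then σ.arr 2 y else σ.arr 10 0 + σ.arr 11 0 - σ.arr 2 y) ∧
    ∀ y < n, (swapCmd.run σ e).arr 3 y = if σ.arr 4 y = 0 then σ.arr 3 y else 0 := by
  let I : ℕ → Store → Prop := fun i τ =>
    (τ.arr 4 = σ.arr 4 ∧ τ.arr 10 = σ.arr 10 ∧ τ.arr 11 = σ.arr 11) ∧
    (∀ y, τ.arr 2 y = if i ≤ y ∨ σ.arr 4 y = 0 then σ.arr 2 y else
      σ.arr 10 0 + σ.arr 11 0 - σ.arr 2 y) ∧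
    (∀ y, τ.arr 3 y = if i ≤ y ∨ σ.arr 4 y = 0 then σ.arr 3 y else 0)
  have key : I n (swapCmd.run σ e) := by
    refine iter_induction hn I ⟨⟨rfl, rfl, rfl⟩, by simp, by simp⟩ ?_
    rintro i hi τ hτ ⟨⟨g4, g10, g11⟩, h2, h3⟩
    by_cases hm : σ.arr 4 i = 0
    · rw [run_ite_of_not_holds _ _ (by simp [g4, hm]), run_skip]
      refine ⟨⟨g4, g10, g11⟩, fun y => ?_, fun y => ?_⟩
      · rw [h2]
        rcases Nat.lt_trichotomy i y with h | rfl | h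
        · rw [if_pos (Or.inl h.le), if_pos (Or.inl (show i + 1 ≤ y from h))]
        · rw [if_pos (Or.inr hm), if_pos (Or.inr hm)]
        · simp only [show ¬ i ≤ y by omega, show ¬ i + 1 ≤ y by omega]
      · rw [h3]
        rcases Nat.lt_trichotomy i y with h | rfl | h
        · rw [if_pos (Or.inl h.le), if_pos (Or.inl (show i + 1 ≤ y from h))]
        · rw [if_pos (Or.inr hm), if_pos (Or.inr hm)]
        · simp only [show ¬ i ≤ y by omega, show ¬ i + 1 ≤ y by omega]
    · rw [run_ite_of_holds _ _ (by simp [g4, hm])]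
      have hi2 := h2 i
      rw [if_pos (Or.inl le_rfl)] at hi2
      refine ⟨⟨?_, ?_, ?_⟩, fun y => ?_, fun y => ?_⟩
      · funext y; simp [g4]
      · funext y; simp [g10]
      · funext y; simp [g11]
      · simp only [run_seq, run_set, otherColour, eval_sub, eval_add, eval_arr, eval_const,
          eval_var, List.getD_cons_zero, Store.set_arr, Fin.reduceEq, false_and, if_false,
          true_and, g10, g11, hi2]
        by_cases hy : y = i
        · subst hy
          simp [hm]
        · rw [if_neg hy, h2]
          simp only [show i ≤ y ↔ i + 1 ≤ y by omega]
      · simp only [run_seq, run_set, eval_const,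
          eval_var, List.getD_cons_zero, Store.set_arr, Fin.reduceEq, false_and, if_false,
          true_and]
        by_cases hy : y = i
        · subst hy
          simp [hm]
        · rw [if_neg hy, h3]
          simp only [show i ≤ y ↔ i + 1 ≤ y by omega]
  obtain ⟨-, h2, h3⟩ := key
  refine ⟨fun y hy => ?_, fun y hy => ?_⟩
  · rw [h2]; simp only [show ¬ n ≤ y by omega, false_or]
  · rw [h3]; simp only [show ¬ n ≤ y by omega, false_or]

variable {k : ℕ} {G H : SimpleGraph (Fin n)} {o : Fin n ≃ Fin n}

/-- The store describes the input and the order `o` of the vertices. -/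
structure Layout (σ : Store) (G H : SimpleGraph (Fin n)) (o : Fin n ≃ Fin n) : Prop where
  input : DescribesInput σ G H
  order : ∀ l : Fin n, σ.arr 0 l = o l

theorem Layout.congr (h : Layout σ G H o) {τ : Store} (hi : τ.inp = σ.inp)
    (h0 : τ.arr 0 = σ.arr 0) : Layout τ G H o :=
  ⟨h.input.of_inp_eq hi, h0 ▸ h.order⟩

/-- The store holds the coloring `α`. -/
def Colours (σ : Store) (o : Fin n ≃ Fin n) (α : G.Coloring (Fin k)) : Prop :=
  ∀ l : Fin n, σ.arr 2 l = α (o l)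

/-- The store holds the list `L` of Kempe changes. -/
structure Logged (σ : Store) (L : List (Fin n × Fin k × Fin k)) : Prop where
  length : σ.arr 12 0 = L.length
  entry : ∀ (i : ℕ) (hi : i < L.length),
    σ.arr 5 i = L[i].1 ∧ σ.arr 6 i = L[i].2.1 ∧ σ.arr 7 i = L[i].2.2

theorem Logged.congr {L : List (Fin n × Fin k × Fin k)} (h : Logged σ L) {τ : Store}
    (h5 : τ.arr 5 = σ.arr 5) (h6 : τ.arr 6 = σ.arr 6) (h7 : τ.arr 7 = σ.arr 7)
    (h12 : τ.arr 12 = σ.arr 12) : Logged τ L :=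
  ⟨h12 ▸ h.length, fun i hi => by rw [h5, h6, h7]; exact h.entry i hi⟩

theorem logCmd_correct {L : List (Fin n × Fin k × Fin k)} (h : Logged σ L) {x : ℕ}
    {m : Fin n × Fin k × Fin k} (h0 : σ.arr 0 x = m.1)
    (h1 : σ.arr 10 0 + σ.arr 11 0 - σ.arr 2 x = m.2.1) (h2 : σ.arr 2 x = m.2.2) (e : List ℕ) :
    Logged (logCmd.run σ (x :: e)) (L ++ [m]) := by
  constructor
  · simp [logCmd, h.length]
  · intro i hi
    rw [List.length_append, List.length_singleton] at hi
    simp only [logCmd, run_seq, run_set, otherColour, eval_sub, eval_add, eval_arr, eval_const,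
      eval_var, List.getD_cons_zero, Store.set_arr, Fin.reduceEq, false_and, if_false,
      true_and, h.length, h0, h1]
    by_cases hil : i = L.length
    · subst hil
      simp [h2]
    · have hil' : i < L.length := by omega
      simp only [hil, if_false, List.getElem_append_left hil']
      exact h.entry i hil'

/-- The log is written before the swap, while the old colour of x is still stored. The set of the
plan loses exactly the chain. -/
theorem chainCmd_correct {α : G.Coloring (Fin k)} {L : List (Fin n × Fin k × Fin k)}
    (hσ : Layout σ G H o) (hα : Colours σ o α) (hL : Logged σ L) {x : Fin n} {a c : Fin k}
    (ha : σ.arr 10 0 = a) (hc : σ.arr 11 0 = c) (hac : a ≠ c) (hx : α (o x) = a ∨ α (o x) = c)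
    (e : List ℕ) :
    ∃ d : Fin k, d ≠ α (o x) ∧ (∀ y, y ∈ twoColoured α (o x) d ↔ (α y = a ∨ α y = c)) ∧
      Colours (chainCmd.run σ (x :: e)) o (kempeChange α (o x) d) ∧
      Logged (chainCmd.run σ (x :: e)) (L ++ [(o x, d, α (o x))]) ∧
      (∀ y : Fin n, (chainCmd.run σ (x :: e)).arr 3 y ≠ 0 ↔
        σ.arr 3 y ≠ 0 ∧ o y ∉ kempeChain α (o x) d) ∧
      (∀ y : Fin n, o y ∈ kempeChain α (o x) d →
        (chainCmd.run σ (x :: e)).arr 2 y = a + c - σ.arr 2 y) ∧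
      ∀ y : Fin n, o y ∉ kempeChain α (o x) d →
        (chainCmd.run σ (x :: e)).arr 2 y = σ.arr 2 y := by
  -- The colour d is the one of a and c that x does not have.
  obtain ⟨d, hd, hdv, htwo⟩ : ∃ d : Fin k, d ≠ α (o x) ∧ (a : ℕ) + c - α (o x) = d ∧
      ∀ y, y ∈ twoColoured α (o x) d ↔ (α y = a ∨ α y = c) := by
    rcases hx with h | h
    · exact ⟨c, by rw [h]; exact hac.symm, by rw [h]; omega, fun y => by
        simp [twoColoured, h]⟩
    · exact ⟨a, by rw [h]; exact hac, by rw [h]; omega, fun y => by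
        simp [twoColoured, h, or_comm]⟩
  have hrun : chainCmd.run σ (x :: e) =
      swapCmd.run (markCmd.run (logCmd.run σ (x :: e)) (x :: e)) (x :: e) := rfl
  set σ₁ := logCmd.run σ (x :: e) with hσ₁
  set σ₂ := markCmd.run σ₁ (x :: e) with hσ₂
  have f₁ : ∀ A : Fin 16, A ∉ logCmd.writes → σ₁.arr A = σ.arr A := fun A hA =>
    Cmd.run_arr_of_notMem _ hA _ _
  have f₂ : ∀ A : Fin 16, A ∉ markCmd.writes → σ₂.arr A = σ₁.arr A := fun A hA =>
    Cmd.run_arr_of_notMem _ hA _ _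
  have f₃ : ∀ A : Fin 16, A ∉ swapCmd.writes → (chainCmd.run σ (x :: e)).arr A = σ₂.arr A :=
    fun A hA => hrun ▸ Cmd.run_arr_of_notMem _ hA _ _
  have i₁ : σ₁.inp = σ.inp := Cmd.run_inp _ _ _
  have i₂ : σ₂.inp = σ.inp := (Cmd.run_inp _ _ _).trans i₁
  have hlog : Logged σ₁ (L ++ [(o x, d, α (o x))]) :=
    logCmd_correct hL (hσ.order x) (by rw [ha, hc, hα x, hdv]) (hα x) e
  obtain ⟨m1, m2, m3⟩ := markCmd_correct (σ := σ₁) (n := n) (by rw [i₁, hσ.input.size])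
    (Gr := fun p q => G.Adj (o p) (o q)) (fun p q => by
      rw [i₁, f₁ 0 (by decide), hσ.order, hσ.order]; exact hσ.input.graph _ _) x e
  rw [← hσ₂] at m1 m2 m3
  have hcol : ∀ q : Fin n, HasColour σ₁ q ↔ o q ∈ twoColoured α (o x) d := by
    intro q
    rw [HasColour, f₁ 2 (by decide), f₁ 10 (by decide), f₁ 11 (by decide), ha, hc, hα q, htwo,
      Fin.val_inj, Fin.val_inj]
  have hmark : ∀ y : Fin n, σ₂.arr 4 y ≠ 0 ↔ o y ∈ kempeChain α (o x) d := by
    intro y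
    constructor
    · refine m3 {y | o y ∈ kempeChain α (o x) d} (self_mem_kempeChain _ _ _) ?_ y
      intro p hp q hpq hq
      exact mem_kempeChain_of_adj α (o x) d hp hpq ((hcol q).mp hq)
    · intro hy
      have hsub : kempeChain α (o x) d ⊆ {v | σ₂.arr 4 (o.symm v) ≠ 0} := by
        refine kempeChain_subset_of_closed _ _ _ (by simpa using m1) ?_
        intro v hv u hvu hu
        exact m2 (o.symm v) (o.symm u) hv (by simpa using hvu) ((hcol _).mpr (by simpa using hu))
      simpa using hsub hy
  obtain ⟨s2, s3⟩ := swapCmd_correct (σ := σ₂) (n := n) (by rw [i₂, hσ.input.size]) (x :: e)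
  rw [← hrun] at s2 s3
  have e2 : σ₂.arr 2 = σ.arr 2 := (f₂ 2 (by decide)).trans (f₁ 2 (by decide))
  have e3 : σ₂.arr 3 = σ.arr 3 := (f₂ 3 (by decide)).trans (f₁ 3 (by decide))
  have e10 : σ₂.arr 10 0 = a := by rw [f₂ 10 (by decide), f₁ 10 (by decide), ha]
  have e11 : σ₂.arr 11 0 = c := by rw [f₂ 11 (by decide), f₁ 11 (by decide), hc]
  have hin : ∀ y : Fin n, o y ∈ kempeChain α (o x) d →
      (chainCmd.run σ (x :: e)).arr 2 y = a + c - σ.arr 2 y := fun y hy => by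
    rw [s2 y y.isLt, if_neg ((hmark y).mpr hy), e10, e11, e2]
  have hout : ∀ y : Fin n, o y ∉ kempeChain α (o x) d →
      (chainCmd.run σ (x :: e)).arr 2 y = σ.arr 2 y := fun y hy => by
    rw [s2 y y.isLt, if_pos (not_not.mp (mt (hmark y).mp hy)), e2]
  refine ⟨d, hd, htwo, ?_, ?_, ?_, hin, hout⟩
  · intro y
    rw [kempeChange_apply]
    by_cases hy : o y ∈ kempeChain α (o x) d
    · rw [hin y hy, hα y, kempeSwap_of_mem hy]
      rcases kempeChain_subset _ _ _ hy with h | h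
      · rw [h, Equiv.swap_apply_left, hdv]
      · rw [h, Equiv.swap_apply_right]
        omega
    · rw [hout y hy, kempeSwap_of_notMem hy, hα y]
  · have g : ∀ A : Fin 16, A ∉ markCmd.writes → A ∉ swapCmd.writes →
        (chainCmd.run σ (x :: e)).arr A = σ₁.arr A := fun A h h' => (f₃ A h').trans (f₂ A h)
    exact hlog.congr (g 5 (by decide) (by decide)) (g 6 (by decide) (by decide))
      (g 7 (by decide) (by decide)) (g 12 (by decide) (by decide))
  · intro y
    rw [s3 y y.isLt, ← hmark y, e3]
    by_cases hy : σ₂.arr 4 y = 0 <;> simp [hy]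

/-- D is a union of Kempe chains for a and c, which are swapped one at a time. Each has a vertex, so
there are at most n of them. -/
theorem exchangeCmd_correct {α₀ α : G.Coloring (Fin k)} {L : List (Fin n × Fin k × Fin k)}
    (hσ : Layout σ G H o) (hα : Colours σ o α) (hL : Logged σ L) (hlog : KempeLog α₀ L α)
    {a c : Fin k} (hact : σ.arr 8 0 ≠ 0) (ha : σ.arr 10 0 = a) (hc : σ.arr 11 0 = c)
    (hac : a ≠ c) {D : Set (Fin n)}
    (hD : ∀ x : Fin n, (¬ (x : ℕ) < σ.arr 9 0 ∧ σ.arr 3 x ≠ 0) ↔ x ∈ D)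
    (hcol : ∀ x ∈ D, α (o x) = a ∨ α (o x) = c)
    (hclosed : ∀ x ∈ D, ∀ y, G.Adj (o x) (o y) → (α (o y) = a ∨ α (o y) = c) → y ∈ D)
    (e : List ℕ) :
    ∃ (α' : G.Coloring (Fin k)) (L' : List (Fin n × Fin k × Fin k)),
      Colours (exchangeCmd.run σ e) o α' ∧ Logged (exchangeCmd.run σ e) L' ∧
      KempeLog α₀ L' α' ∧ L'.length ≤ L.length + n ∧
      (∀ x ∈ D, (exchangeCmd.run σ e).arr 2 x = a + c - σ.arr 2 x) ∧
      ∀ x ∉ D, (exchangeCmd.run σ e).arr 2 x = σ.arr 2 x := by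
  -- D' is the part of D not yet treated: it keeps its original colours and remains closed, while D
  -- without D' is already swapped.
  let I : ℕ → Store → Prop := fun i τ =>
    (∀ A : Fin 16, A ∉ chainCmd.writes → τ.arr A = σ.arr A) ∧
    ∃ (α' : G.Coloring (Fin k)) (L' : List (Fin n × Fin k × Fin k)) (D' : Set (Fin n)),
      Colours τ o α' ∧ Logged τ L' ∧ KempeLog α₀ L' α' ∧ L'.length ≤ L.length + i ∧
      (∀ x : Fin n, (¬ (x : ℕ) < σ.arr 9 0 ∧ τ.arr 3 x ≠ 0) ↔ x ∈ D') ∧ D' ⊆ D ∧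
      (∀ x ∈ D', ∀ y, G.Adj (o x) (o y) → (α' (o y) = a ∨ α' (o y) = c) → y ∈ D') ∧
      (∀ x ∈ D, x ∉ D' → τ.arr 2 x = a + c - σ.arr 2 x) ∧
      (∀ x : Fin n, (x ∉ D ∨ x ∈ D') → τ.arr 2 x = σ.arr 2 x) ∧
      (D'.ncard + i ≤ n ∨ D' = ∅)
  have key : I n (exchangeCmd.run σ e) := by
    refine iter_induction hσ.input.size I ⟨fun _ _ => rfl, α, L, D, hα, hL, hlog, le_rfl, hD,
      subset_rfl, hclosed, fun x h h' => absurd h h', fun _ _ => rfl, Or.inl ?_⟩ ?_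
    · have := Set.ncard_le_card D
      simpa using this
    · rintro i hi τ hτ ⟨hf, α', L', D', hα', hL', hlog', hlen, hD', hDD', hcl', hin, hout, hcard⟩
      have hτσ : Layout τ G H o := hσ.congr hτ (hf 0 (by decide))
      have hfind : ∀ x : Fin n, (and' (.arr 8 (.const 0)) (inPlan (.var 0))).Holds τ
          (x :: i :: e) ↔ x ∈ D' := by
        intro x
        rw [← hD']
        simp [inPlan, hf 8 (by decide), hf 9 (by decide), hact]
      rw [run_bind, eval_find, hτσ.input.size]
      set q := leastBelow n fun j => (and' (.arr 8 (.const 0)) (inPlan (.var 0))).Holds τ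
        (j :: i :: e) with hq
      by_cases hqn : q < n
      · have hxD := (hfind ⟨q, hqn⟩).mp (of_leastBelow_lt hqn)
        rw [run_ite_of_holds _ _ (by simpa [hτσ.input.size] using hqn)]
        obtain ⟨x, hx⟩ : ∃ x : Fin n, (x : ℕ) = q := ⟨⟨q, hqn⟩, rfl⟩
        have hxD : x ∈ D' := by
          rwa [show x = ⟨q, hqn⟩ from Fin.ext hx]
        rw [← hx]
        have hcol' : ∀ y ∈ D', α' (o y) = a ∨ α' (o y) = c := by
          intro y hy
          have h1 := hout y (Or.inr hy)
          rw [hα' y, hα y] at h1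
          rw [Fin.ext h1]
          exact hcol y (hDD' hy)
        obtain ⟨d, hd, htwo, c1, c2, c3, c4, c5⟩ := chainCmd_correct hτσ hα' hL'
          ((congrFun (hf 10 (by decide)) 0).trans ha) ((congrFun (hf 11 (by decide)) 0).trans hc)
          hac (hcol' x hxD) (i :: e)
        have hK : ∀ y, o y ∈ kempeChain α' (o x) d → y ∈ D' := by
          have hsub : kempeChain α' (o x) d ⊆ {v | o.symm v ∈ D'} := by
            refine kempeChain_subset_of_closed _ _ _ (by simpa using hxD) ?_
            intro v hv u hvu hu
            exact hcl' _ hv _ (by simpa using hvu) (by simpa using (htwo u).mp hu)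
          exact fun y hy => by simpa using hsub hy
        refine ⟨fun A hA => (Cmd.run_arr_of_notMem _ hA _ _).trans (hf A hA),
          kempeChange α' (o x) d, _, D' \ {y | o y ∈ kempeChain α' (o x) d}, c1, c2,
          hlog'.snoc _ _ hd, ?_, ?_, Set.sdiff_subset.trans hDD', ?_, ?_, ?_, ?_⟩
        · simp only [List.length_append, List.length_singleton]; omega
        · intro y
          rw [c3 y, ← and_assoc, hD' y]
          rfl
        -- A swap does not change which vertices bear one of the two colours, and no edge between
        -- such vertices leaves the chain.
        · rintro y ⟨hy, hyK⟩ z hyz hz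
          have hzold : α' (o z) = a ∨ α' (o z) = c := by
            by_cases hzK : o z ∈ kempeChain α' (o x) d
            · exact (htwo _).mp (kempeChain_subset _ _ _ hzK)
            · rwa [kempeChange_apply, kempeSwap_of_notMem hzK] at hz
          refine ⟨hcl' y hy z hyz hzold, fun hzK => hyK ?_⟩
          exact mem_kempeChain_of_adj _ _ _ hzK hyz.symm ((htwo _).mpr (hcol' y hy))
        · intro y hy hyD
          by_cases hyK : o y ∈ kempeChain α' (o x) d
          · rw [c4 y hyK, hout y (Or.inr (hK y hyK))]
          · rw [c5 y hyK]
            exact hin y hy fun h => hyD ⟨h, hyK⟩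
        · intro y hy
          have hyK : o y ∉ kempeChain α' (o x) d := by
            rcases hy with hy | hy
            · exact fun h => hy (hDD' (hK y h))
            · exact hy.2
          rw [c5 y hyK]
          exact hout y (hy.imp id fun h => h.1)
        · left
          have hlt : (D' \ {y | o y ∈ kempeChain α' (o x) d}).ncard < D'.ncard :=
            Set.ncard_lt_ncard ⟨Set.sdiff_subset, fun h =>
              (h hxD).2 (self_mem_kempeChain α' (o x) d)⟩ D'.toFinite
          rcases hcard with h | h
          · omega
          · rw [h] at hxD
            exact hxD.elim
      · rw [run_ite_of_not_holds _ _ (by simpa [hτσ.input.size] using hqn), run_skip]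
        refine ⟨hf, α', L', D', hα', hL', hlog', by omega, hD', hDD', hcl', hin, hout, Or.inr ?_⟩
        rw [Set.eq_empty_iff_forall_notMem]
        intro x hx
        exact hqn (leastBelow_lt_iff.mpr ⟨x, x.isLt, (hfind x).mpr hx⟩)
  obtain ⟨-, α', L', D', h1, h2, h3, h4, -, -, -, h5, h6, h7⟩ := key
  have hemp : D' = ∅ := by
    rcases h7 with h | h
    · exact (Set.ncard_eq_zero D'.toFinite).mp (by omega)
    · exact h
  subst hemp
  exact ⟨α', L', h1, h2, h3, h4, fun x hx => h5 x hx (Set.notMem_empty x),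
    fun x hx => h6 x (Or.inl hx)⟩

theorem exchangeCmd_of_not_act (hn : σ.inp 0 = n) (hact : σ.arr 8 0 = 0) (e : List ℕ) :
    exchangeCmd.run σ e = σ := by
  refine iter_induction hn (fun _ τ => τ = σ) rfl ?_
  rintro i hi τ hτ rfl
  rw [run_bind, eval_find, leastBelow_eq (i := τ.inp 0) le_rfl (Or.inl le_rfl) (by simp [hact]),
    run_ite_of_not_holds _ _ (by simp), run_skip]

end

/-! ### The whole algorithm -/

theorem potential_congr {R : ℕ → ℕ → Prop} {n : ℕ} {f g : ℕ → ℕ} (h : ∀ m < n, f m = g m) :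
    potential R n f = potential R n g :=
  Finset.sum_congr rfl fun _ hl => vertexPotential_congr fun m hm =>
    h m (hm.trans_lt (Finset.mem_range.mp hl))

section

variable {n k w : ℕ} {G H : SimpleGraph (Fin n)} {o : Fin n ≃ Fin n}

/-- Adjacency as a relation on positions in the order `o`. -/
def posRel (H : SimpleGraph (Fin n)) (o : Fin n ≃ Fin n) (m l : ℕ) : Prop :=
  ∃ (hm : m < n) (hl : l < n), H.Adj (o ⟨m, hm⟩) (o ⟨l, hl⟩)

theorem posRel_symm (x y : ℕ) (h : posRel H o x y) : posRel H o y x :=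
  ⟨h.2.1, h.1, h.2.2.symm⟩

theorem posRel_iff (x y : Fin n) : posRel H o x y ↔ H.Adj (o x) (o y) :=
  ⟨fun h => h.2.2, fun h => ⟨x.isLt, y.isLt, h⟩⟩

/-- Earlier neighbours of a vertex in the order `o` are adjacent. -/
def IsEliminationOrder (H : SimpleGraph (Fin n)) (o : Fin n ≃ Fin n) : Prop :=
  ∀ l x y : Fin n, x < l → y < l → H.Adj (o x) (o l) → H.Adj (o y) (o l) → x ≠ y →
    H.Adj (o x) (o y)

theorem IsEliminationOrder.isElimination (ho : IsEliminationOrder H o) :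
    IsElimination (posRel H o) n := by
  intro l hl x hx y hy hxy
  obtain ⟨hxl, hxn, _, hxadj⟩ := mem_backNbrs.mp hx
  obtain ⟨hyl, hyn, _, hyadj⟩ := mem_backNbrs.mp hy
  exact ⟨hxn, hyn, ho ⟨l, hl⟩ ⟨x, hxn⟩ ⟨y, hyn⟩ hxl hyl hxadj hyadj
    fun h => hxy (congrArg Fin.val h)⟩

-- A vertex together with its earlier neighbours is a clique of `H`, so it has at most w + 1
-- elements.
open Classical in
theorem IsEliminationOrder.card_backNbrs_le (ho : IsEliminationOrder H o)
    (hw : H.CliqueFree (w + 2)) (l : ℕ) (hl : l < n) : (backNbrs (posRel H o) l).card ≤ w := by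
  set l' : Fin n := ⟨l, hl⟩
  set s : Finset (Fin n) := Finset.univ.filter fun v => v < l' ∧ H.Adj (o v) (o l') with hs
  have hmem : ∀ v, v ∈ s ↔ v < l' ∧ H.Adj (o v) (o l') := fun v => by simp [hs]
  have h1 : (backNbrs (posRel H o) l).card ≤ s.card := by
    refine (Finset.card_le_card fun m hm => ?_).trans (Finset.card_image_le (s := s) (f := Fin.val))
    obtain ⟨hml, hmn, _, hadj⟩ := mem_backNbrs.mp hm
    exact Finset.mem_image.mpr ⟨⟨m, hmn⟩, (hmem _).mpr ⟨hml, hadj⟩, rfl⟩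
  have hcard : ((insert l' s).map o.toEmbedding).card = s.card + 1 := by
    rw [Finset.card_map, Finset.card_insert_of_notMem fun h => lt_irrefl _ ((hmem _).mp h).1]
  have hcl : H.IsClique ((insert l' s).map o.toEmbedding : Finset (Fin n)) := by
    intro a ha b hb hab
    simp only [Finset.coe_map, Set.mem_image, Finset.mem_coe, Finset.mem_insert,
      Equiv.coe_toEmbedding] at ha hb
    obtain ⟨x, hx, rfl⟩ := ha
    obtain ⟨y, hy, rfl⟩ := hb
    have hxy : x ≠ y := fun h => hab (congrArg o h)
    rcases hx with rfl | hx <;> rcases hy with rfl | hy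
    · exact absurd rfl hxy
    · exact ((hmem _).mp hy).2.symm
    · exact ((hmem _).mp hx).2
    · exact ho l' x y ((hmem _).mp hx).1 ((hmem _).mp hy).1 ((hmem _).mp hx).2 ((hmem _).mp hy).2 hxy
  by_contra hlt
  exact hw.mono (show w + 2 ≤ s.card + 1 by omega) _ ⟨hcl, hcard⟩

variable {σ : Store}

theorem Layout.describesRel (hσ : Layout σ G H o) : DescribesRel n σ (posRel H o) := by
  intro m hm l hl
  have h1 := hσ.order ⟨m, hm⟩
  have h2 := hσ.order ⟨l, hl⟩
  simp only at h1 h2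
  rw [h1, h2, hσ.input.supergraph]
  exact (posRel_iff ⟨m, hm⟩ ⟨l, hl⟩).symm

/-- Perform one exchange, if one is needed. -/
def passCmd : Cmd := .seq planCmd exchangeCmd

open Classical in
theorem passCmd_correct {α₀ α : G.Coloring (Fin k)} {L : List (Fin n × Fin k × Fin k)}
    (hσ : Layout σ G H o) (hGH : G ≤ H) (hw : ∀ l < n, (backNbrs (posRel H o) l).card ≤ w)
    (hk : w < k) (hα : Colours σ o α) (hL : Logged σ L) (hlog : KempeLog α₀ L α) (e : List ℕ) :
    ∃ (α' : G.Coloring (Fin k)) (L' : List (Fin n × Fin k × Fin k)),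
      Colours (passCmd.run σ e) o α' ∧ Logged (passCmd.run σ e) L' ∧ KempeLog α₀ L' α' ∧
      L'.length ≤ L.length + (if (plan (posRel H o) n (σ.arr 2) n).act then n else 0) ∧
      ∀ l < n, (passCmd.run σ e).arr 2 l =
        (plan (posRel H o) n (σ.arr 2) n).exchange (σ.arr 2) l := by
  have htr := planCmd_tracks hσ.input.size hσ.describesRel e
  have hrun : passCmd.run σ e = exchangeCmd.run (planCmd.run σ e) e := rfl
  set τ := planCmd.run σ e with hτ
  set S := plan (posRel H o) n (σ.arr 2) n with hS
  have f : ∀ A : Fin 16, A ∉ planCmd.writes → τ.arr A = σ.arr A := fun A hA =>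
    Cmd.run_arr_of_notMem _ hA _ _
  have hτL : Layout τ G H o := hσ.congr (Cmd.run_inp _ _ _) (f 0 (by decide))
  have h2 : τ.arr 2 = σ.arr 2 := f 2 (by decide)
  have hτα : Colours τ o α := fun l => by rw [h2]; exact hα l
  have hτlog : Logged τ L := hL.congr (f 5 (by decide)) (f 6 (by decide)) (f 7 (by decide))
    (f 12 (by decide))
  by_cases hact : S.act
  · rw [if_pos hact]
    have hv := (plan_valid posRel_symm hw n le_rfl).1 hact
    have hak : S.a < k := by
      have := hv.colour_t
      rw [hα ⟨S.t, hv.t_lt⟩] at this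
      rw [← this]
      exact Fin.isLt _
    have hck : S.c < k := hv.c_le.trans_lt hk
    have hval : ∀ (x : Fin n) (b : ℕ) (hb : b < k), α (o x) = ⟨b, hb⟩ ↔ σ.arr 2 x = b := by
      intro x b hb
      rw [hα x, Fin.ext_iff]
    obtain ⟨α', L', c1, c2, c3, c4, c5, c6⟩ := exchangeCmd_correct hτL hτα hτlog hlog
      (a := ⟨S.a, hak⟩) (c := ⟨S.c, hck⟩) (htr.act.mpr hact) (htr.a hact) (htr.c hact)
      (fun h => hv.ne (congrArg Fin.val h)) (D := {x | (x : ℕ) ∈ S.D})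
      (fun x => by rw [htr.t hact]; exact htr.D hact x x.isLt)
      (fun x hx => by rw [hval, hval]; exact hv.colour x hx)
      -- Closedness was ensured along bichromatic edges of `H`. Edges of `G` are edges of `H`, and
      -- their ends have different colours.
      (fun x hx y hxy hy => by
        rw [hval, hval] at hy
        refine hv.closed x hx y y.isLt ((posRel_iff x y).mpr (hGH hxy)) hy ?_
        rw [hα x, hα y]
        exact fun h => α.valid hxy (Fin.ext h).symm) e
    refine ⟨α', L', hrun ▸ c1, hrun ▸ c2, c3, c4, fun l hl => ?_⟩
    rw [hrun, ← h2]
    by_cases hlD : l ∈ S.D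
    · rw [Plan.exchange_of_mem hact hlD]
      exact c5 ⟨l, hl⟩ hlD
    · rw [Plan.exchange_of_notMem hlD]
      exact c6 ⟨l, hl⟩ hlD
  · have : exchangeCmd.run τ e = τ := exchangeCmd_of_not_act hτL.input.size
      (not_not.mp (mt htr.act.mp hact)) e
    rw [hrun, this, if_neg hact]
    exact ⟨α, L, hτα, hτlog, hlog, le_rfl, fun l _ => by rw [Plan.exchange_of_not_act hact, h2]⟩

/-- Recolour to the coloring without planned exchanges. -/
def recolourCmd : Cmd := .iter (.iter passCmd)

/-- Two budgets are kept: a unit of potential pays for the at most n Kempe changes of an exchange,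
and as long as the plan is active each pass has used up a unit. Idle passes change neither the
coloring nor the log. -/
theorem recolourCmd_correct {α : G.Coloring (Fin k)} (hσ : Layout σ G H o) (hGH : G ≤ H)
    (ho : IsEliminationOrder H o) (hw : ∀ l < n, (backNbrs (posRel H o) l).card ≤ w)
    (hk : w < k) (hα : Colours σ o α) (h0 : σ.arr 12 0 = 0) (e : List ℕ) :
    ∃ (γ : G.Coloring (Fin k)) (L : List (Fin n × Fin k × Fin k)),
      Layout (recolourCmd.run σ e) G H o ∧ Colours (recolourCmd.run σ e) o γ ∧
      Logged (recolourCmd.run σ e) L ∧ KempeLog α L γ ∧ L.length ≤ max w 1 * n ^ 2 ∧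
      L.length ≤ n * (n * n) ∧
      ¬ (plan (posRel H o) n ((recolourCmd.run σ e).arr 2) n).act := by
  classical
  set Φ₀ := potential (posRel H o) n (σ.arr 2) with hΦ₀
  let I : ℕ → Store → Prop := fun m τ => Layout τ G H o ∧
    ∃ (γ : G.Coloring (Fin k)) (L : List (Fin n × Fin k × Fin k)),
      Colours τ o γ ∧ Logged τ L ∧ KempeLog α L γ ∧
      L.length + n * potential (posRel H o) n (τ.arr 2) ≤ n * Φ₀ ∧
      ((plan (posRel H o) n (τ.arr 2) n).act → potential (posRel H o) n (τ.arr 2) + m ≤ Φ₀)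
  have hstep : ∀ (τ : Store) (e : List ℕ) (m : ℕ), τ.inp 0 = n → I m τ →
      I (m + 1) (passCmd.run τ e) := by
    rintro τ e m - ⟨hτ, γ, L, h1, h2, h3, h4, h5⟩
    obtain ⟨γ', L', c1, c2, c3, c4, c5⟩ := passCmd_correct hτ hGH hw hk h1 h2 h3 e
    refine ⟨hτ.congr (Cmd.run_inp _ _ _) (Cmd.run_arr_of_notMem _ (by decide) _ _), γ', L', c1, c2,
      c3, ?_⟩
    rw [potential_congr c5, plan_congr c5]
    by_cases hact : (plan (posRel H o) n (τ.arr 2) n).act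
    · have hlt := potential_exchange_lt posRel_symm hw ho.isElimination hact
      rw [if_pos hact] at c4
      have := h5 hact
      refine ⟨?_, fun _ => by omega⟩
      have := Nat.mul_le_mul_left n (Nat.succ_le_of_lt hlt)
      rw [Nat.mul_succ] at this
      omega
    · rw [if_neg hact] at c4
      rw [Plan.exchange_of_not_act hact]
      exact ⟨by omega, fun h => absurd h hact⟩
  obtain ⟨hτ, γ, L, h1, h2, h3, h4, h5⟩ := Cmd.iter_count (Cmd.iter_count hstep) σ e 0
    hσ.input.size ⟨hσ, α, [], hα, ⟨by simpa using h0, by simp⟩, .nil, by simp [hΦ₀],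
      fun _ => le_rfl⟩
  have hb : ∀ w', (∀ l < n, (backNbrs (posRel H o) l).card ≤ w') → L.length ≤ n * (n * max w' 1) :=
    fun w' hw' => (by omega : L.length ≤ n * Φ₀).trans
      (Nat.mul_le_mul_left n (potential_le (posRel H o) n w' _ hw'))
  -- The program does not know w. Its n² passes, and the n³ rounds of printing, are justified by the
  -- trivial bound n for the number of earlier neighbours.
  have hn : ∀ l < n, (backNbrs (posRel H o) l).card ≤ n := fun l hl =>
    (card_backNbrs_le (posRel H o) l).trans hl.le
  refine ⟨γ, L, hτ, h1, h2, h3, (hb w hw).trans (le_of_eq (by ring)), ?_, fun hact => ?_⟩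
  · rcases Nat.eq_zero_or_pos n with hn0 | hn0
    · have := hb n hn
      simp only [hn0, Nat.zero_mul] at this ⊢
      exact this
    · have := hb n hn
      rwa [max_eq_left hn0] at this
  · change (plan (posRel H o) n ((Cmd.iter (.iter passCmd)).run σ e |>.arr 2) n).act at hact
    -- A plan still active would make the potential positive after n² decreases from at most n².
    have hlt := potential_exchange_lt posRel_symm hw ho.isElimination hact
    have h5 := h5 hact
    have hle := potential_le (posRel H o) n n (σ.arr 2) hn
    have hn0 : 0 < n := by
      have := (plan_history hact).1
      omega
    rw [max_eq_left hn0] at hle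
    rw [Nat.mul_one] at h5
    omega

/-- Load a coloring, placed at `off` behind the adjacency matrices. -/
def loadCmd (off : Tm) : Cmd :=
  .iter (.set 2 (.var 0) (.inp (.add (.const 2) (.add (.mulN (.add size size))
    (.add off (.arr 0 (.var 0)))))))

theorem loadCmd_correct {α : G.Coloring (Fin k)} (hσ : Layout σ G H o) {off : Tm} {v : ℕ}
    (hoff : ∀ (τ : Store) (e : List ℕ), τ.inp = σ.inp → off.eval τ e = v)
    (hα : ∀ u : Fin n, σ.inp (2 + (n * (n + n) + (v + u))) = α u) (e : List ℕ) :
    Colours ((loadCmd off).run σ e) o α := by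
  let I : ℕ → Store → Prop := fun i τ => τ.arr 0 = σ.arr 0 ∧ ∀ l : Fin n, (l : ℕ) < i →
    τ.arr 2 l = α (o l)
  have key : I n ((loadCmd off).run σ e) := by
    refine iter_induction hσ.input.size I ⟨rfl, by simp⟩ ?_
    rintro i hi τ hτ ⟨h0, h2⟩
    refine ⟨?_, fun l hl => ?_⟩
    · funext y; simp [h0]
    · have hord := hσ.order ⟨i, hi⟩
      simp only at hord
      simp only [run_set, eval_inp, eval_add, eval_const, eval_mulN, eval_size, eval_arr, eval_var,
        List.getD_cons_zero, Store.set_arr, true_and, hoff τ _ hτ, h0, hτ, hσ.input.size, hord, hα]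
      by_cases hli : (l : ℕ) = i
      · rw [if_pos hli, show (⟨i, hi⟩ : Fin n) = l from Fin.ext hli.symm]
      · rw [if_neg hli]
        exact h2 l (by omega)
  exact fun l => key.2 l l.isLt

/-- Print the Kempe changes in order. -/
def printCmd : Cmd :=
  .seq (.set 13 (.const 0) (.const 0)) (.iter (.iter (.iter
    (.ite (lt' (.arr 13 (.const 0)) (.arr 12 (.const 0)))
      (.seq (.print (.arr 5 (.arr 13 (.const 0)))) (.seq (.print (.arr 6 (.arr 13 (.const 0))))
        (.set 13 (.const 0) (.add (.arr 13 (.const 0)) (.const 1))))) .skip))))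

theorem encodeMoves_append (l l' : List (Fin n × Fin k)) :
    encodeMoves (l ++ l') = encodeMoves l ++ encodeMoves l' := List.flatMap_append

theorem printCmd_out {L : List (Fin n × Fin k × Fin k)} (hn : σ.inp 0 = n) (hL : Logged σ L)
    (hlen : L.length ≤ n * (n * n)) (e : List ℕ) :
    (printCmd.run σ e).out = σ.out ++ encodeMoves (L.map fun m => (m.1, m.2.1)) := by
  let I : ℕ → Store → Prop := fun m τ =>
    (∀ A : Fin 16, A ≠ 13 → τ.arr A = σ.arr A) ∧ τ.arr 13 0 = min m L.length ∧
    τ.out = σ.out ++ encodeMoves ((L.take (min m L.length)).map fun m => (m.1, m.2.1))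
  obtain ⟨-, -, h⟩ := Cmd.iter_count (Cmd.iter_count (Cmd.iter_count (n := n) (s := 1) (I := I)
    (p := .ite (lt' (.arr 13 (.const 0)) (.arr 12 (.const 0)))
      (.seq (.print (.arr 5 (.arr 13 (.const 0)))) (.seq (.print (.arr 6 (.arr 13 (.const 0))))
        (.set 13 (.const 0) (.add (.arr 13 (.const 0)) (.const 1))))) .skip) (by
    rintro τ e m - ⟨h1, h2, h3⟩
    have h12 : τ.arr 12 0 = L.length := by rw [h1 12 (by decide)]; exact hL.length
    by_cases hm : m < L.length
    · rw [run_ite_of_holds _ _ (by simp [h2, h12, hm])]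
      rw [min_eq_left hm.le] at h2 h3
      obtain ⟨g5, g6, -⟩ := hL.entry m hm
      refine ⟨fun A hA => ?_, ?_, ?_⟩
      · funext y; simp [hA, h1 A hA]
      · simp only [run_seq, run_set, run_print, Store.set_arr, eval_const, and_self, if_true,
          eval_add, eval_arr, h2]
        omega
      · simp only [run_seq, run_set, run_print, Store.set_out, eval_arr, eval_const, h2, h3,
          h1 5 (by decide), h1 6 (by decide), g5, g6, List.append_assoc]
        rw [min_eq_left (by omega), List.take_succ_eq_append_getElem hm, List.map_append,
          encodeMoves_append]
        simp [encodeMoves]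
    · rw [run_ite_of_not_holds _ _ (by simp only [holds_lt', eval_arr, eval_const, h2, h12]; omega)]
      rw [min_eq_right (by omega)] at h2 h3
      refine ⟨h1, ?_, ?_⟩
      · rw [min_eq_right (by omega)]; exact h2
      · rw [min_eq_right (by omega)]; exact h3)))
    (σ.set 13 0 0) e 0 hn ⟨fun A hA => by funext y; simp [hA], by simp, by simp [encodeMoves]⟩
  rw [min_eq_right (by simpa using hlen), List.take_length] at h
  exact h

/-- Print the inverses of the Kempe changes in reverse order. -/
def printReverseCmd : Cmd :=
  .iter (.iter (.iter (.ite (.arr 12 (.const 0))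
    (.seq (.set 12 (.const 0) (.sub (.arr 12 (.const 0)) (.const 1)))
      (.seq (.print (.arr 5 (.arr 12 (.const 0)))) (.print (.arr 7 (.arr 12 (.const 0))))))
    .skip)))

theorem printReverseCmd_out {L : List (Fin n × Fin k × Fin k)} (hn : σ.inp 0 = n)
    (hL : Logged σ L) (hlen : L.length ≤ n * (n * n)) (e : List ℕ) :
    (printReverseCmd.run σ e).out =
      σ.out ++ encodeMoves (L.reverse.map fun m => (m.1, m.2.2)) := by
  let I : ℕ → Store → Prop := fun m τ =>
    (∀ A : Fin 16, A ≠ 12 → τ.arr A = σ.arr A) ∧ τ.arr 12 0 = L.length - m ∧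
    τ.out = σ.out ++ encodeMoves ((L.drop (L.length - m)).reverse.map fun m => (m.1, m.2.2))
  obtain ⟨-, -, h⟩ := Cmd.iter_count (Cmd.iter_count (Cmd.iter_count (n := n) (s := 1) (I := I)
    (p := .ite (.arr 12 (.const 0))
      (.seq (.set 12 (.const 0) (.sub (.arr 12 (.const 0)) (.const 1)))
        (.seq (.print (.arr 5 (.arr 12 (.const 0)))) (.print (.arr 7 (.arr 12 (.const 0))))))
      .skip) (by
    rintro τ e m - ⟨h1, h2, h3⟩
    by_cases hm : m < L.length
    · rw [run_ite_of_holds _ _ (by simp only [holds_arr, eval_const, h2]; omega)]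
      obtain ⟨i, hi⟩ : ∃ i, L.length - m = i + 1 := ⟨L.length - m - 1, by omega⟩
      have hi' : L.length - (m + 1) = i := by omega
      have hil : i < L.length := by omega
      rw [hi] at h2 h3
      obtain ⟨g5, -, g7⟩ := hL.entry i hil
      refine ⟨fun A hA => ?_, ?_, ?_⟩
      · funext y; simp [hA, h1 A hA]
      · simp [h2, hi']
      · simp only [run_seq, run_set, run_print, Store.set_out, eval_arr, eval_const, eval_sub,
          Store.set_arr, Fin.reduceEq, false_and, if_false, and_self, if_true, h2, h3,
          Nat.add_sub_cancel, h1 5 (by decide), h1 7 (by decide), g5, g7, List.append_assoc, hi']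
        rw [List.drop_eq_getElem_cons hil, List.reverse_cons, List.map_append, encodeMoves_append]
        simp [encodeMoves]
    · rw [run_ite_of_not_holds _ _ (by simp only [holds_arr, eval_const, h2]; omega)]
      have e1 : L.length - (m + 1) = L.length - m := by omega
      exact ⟨h1, by rw [e1]; exact h2, by rw [e1]; exact h3⟩)))
    σ e 0 hn ⟨fun A hA => rfl, by simpa using hL.length, by simp [encodeMoves]⟩
  rw [show L.length - (0 + n * (n * (n * 1))) = 0 by rw [Nat.mul_one]; omega, List.drop_zero] at h
  exact h

/-- Recolour both colorings to the same coloring, and print the Kempe changes. -/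
def recolouringCmd : Cmd :=
  .seq orderCmd (.seq (loadCmd (.const 0)) (.seq (.set 12 (.const 0) (.const 0))
    (.seq recolourCmd (.seq printCmd (.seq (loadCmd size) (.seq (.set 12 (.const 0) (.const 0))
      (.seq recolourCmd printReverseCmd)))))))

theorem recolouringCmd_correct {α β : G.Coloring (Fin k)} (hσ : DescribesInput σ G H)
    (hH : IsTreewidthWitness G H w) (hk : w + 1 ≤ k)
    (hα : ∀ u : Fin n, σ.inp (2 + (n * (n + n) + (0 + u))) = α u)
    (hβ : ∀ u : Fin n, σ.inp (2 + (n * (n + n) + (n + u))) = β u)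
    (hused : ∀ v, σ.arr 1 v = 0) (hout : σ.out = []) (e : List ℕ) :
    ∃ l : List (Fin n × Fin k), (recolouringCmd.run σ e).out = encodeMoves l ∧
      IsKempeSequence α l β ∧ l.length ≤ 2 * max w 1 * n ^ 2 := by
  obtain ⟨o, ho1, ho⟩ := orderCmd_correct hσ hH.chordal hused e
  have ho : IsEliminationOrder H o := ho
  have hw := ho.card_backNbrs_le hH.cliqueFree
  have hrun : recolouringCmd.run σ e = printReverseCmd.run (recolourCmd.run
    (((loadCmd size).run (printCmd.run (recolourCmd.run
      (((loadCmd (.const 0)).run (orderCmd.run σ e) e).set 12 0 0) e) e) e).set 12 0 0) e) e := rfl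
  rw [hrun]
  set σ₁ := orderCmd.run σ e with hσ₁
  have l₁ : Layout σ₁ G H o := ⟨hσ.of_inp_eq (Cmd.run_inp _ _ _), ho1⟩
  have out₁ : σ₁.out = [] := (Cmd.run_out_of_prints _ rfl _ _).trans hout
  set σ₂ := ((loadCmd (.const 0)).run σ₁ e).set 12 0 0 with hσ₂
  have l₂ : Layout σ₂ G H o := by
    refine l₁.congr (Cmd.run_inp (loadCmd (.const 0)) _ _) ?_
    funext y
    simp only [hσ₂, Store.set_arr, Fin.reduceEq, false_and, if_false]
    rw [Cmd.run_arr_of_notMem (loadCmd (.const 0)) (by decide)]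
  have c₂ : Colours σ₂ o α := by
    have := loadCmd_correct l₁ (off := .const 0) (v := 0) (α := α) (fun _ _ _ => rfl)
      (fun u => by rw [hσ₁, Cmd.run_inp]; exact hα u) e
    intro l
    simpa [hσ₂] using this l
  have out₂ : σ₂.out = [] := (Cmd.run_out_of_prints (loadCmd (.const 0)) rfl _ _).trans out₁
  obtain ⟨γ, L, l₃, c₃, log₃, k₃, len₃, len₃', act₃⟩ := recolourCmd_correct l₂ hH.le ho hw hk c₂
    (by simp [hσ₂]) e
  set σ₃ := recolourCmd.run σ₂ e with hσ₃
  have out₃ : σ₃.out = [] := (Cmd.run_out_of_prints _ rfl _ _).trans out₂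
  set σ₄ := printCmd.run σ₃ e with hσ₄
  have out₄ : σ₄.out = encodeMoves (L.map fun m => (m.1, m.2.1)) := by
    rw [hσ₄, printCmd_out l₃.input.size log₃ len₃' e, out₃, List.nil_append]
  have l₄ : Layout σ₄ G H o :=
    l₃.congr (Cmd.run_inp _ _ _) (Cmd.run_arr_of_notMem _ (by decide) _ _)
  have inp₄ : σ₄.inp = σ.inp := by simp [hσ₄, hσ₃, hσ₂, hσ₁]
  set σ₅ := ((loadCmd size).run σ₄ e).set 12 0 0 with hσ₅
  have l₅ : Layout σ₅ G H o := by
    refine l₄.congr (Cmd.run_inp (loadCmd size) _ _) ?_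
    funext y
    simp only [hσ₅, Store.set_arr, Fin.reduceEq, false_and, if_false]
    rw [Cmd.run_arr_of_notMem (loadCmd size) (by decide)]
  have c₅ : Colours σ₅ o β := by
    have := loadCmd_correct l₄ (off := size) (v := n) (α := β)
      (fun τ e hτ => by rw [eval_size, hτ, l₄.input.size])
      (fun u => by rw [inp₄]; exact hβ u) e
    intro l
    simpa [hσ₅] using this l
  have out₅ : σ₅.out = σ₄.out := Cmd.run_out_of_prints (loadCmd size) rfl _ _
  obtain ⟨γ', L', l₆, c₆, log₆, k₆, len₆, len₆', act₆⟩ := recolourCmd_correct l₅ hH.le ho hw hk c₅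
    (by simp [hσ₅]) e
  set σ₆ := recolourCmd.run σ₅ e with hσ₆
  have out₆ : σ₆.out = σ₄.out := (Cmd.run_out_of_prints _ rfl _ _).trans out₅
  -- Both runs end in the greedy coloring of `H`, which does not depend on where they started.
  have hγ : γ = γ' := by
    ext v : 1
    obtain ⟨l, rfl⟩ := o.surjective v
    have := eq_of_not_act posRel_symm hw act₃ act₆ l l.isLt
    rw [c₃ l, c₆ l] at this
    exact Fin.ext this
  subst hγ
  refine ⟨(L.map fun m => (m.1, m.2.1)) ++ L'.reverse.map fun m => (m.1, m.2.2), ?_,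
    k₆.isKempeSequence_reverse.append k₃.isKempeSequence, ?_⟩
  · rw [printReverseCmd_out l₆.input.size log₆ len₆' e, out₆, out₄, encodeMoves_append]
  · simp only [List.length_append, List.length_map, List.length_reverse]
    calc L.length + L'.length ≤ max w 1 * n ^ 2 + max w 1 * n ^ 2 := add_le_add len₃ len₆
      _ = _ := by ring

end

/-! ### The encoding of the input -/

section

variable {n k : ℕ}

theorem encodeGraph_length (G : SimpleGraph (Fin n)) : (encodeGraph G).length = n * n := by
  simp [encodeGraph, Function.comp_def]

theorem getD_append_of_length {l l' : List ℕ} {m i : ℕ} (h : l.length = m) :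
    (l ++ l').getD (m + i) 0 = l'.getD i 0 := by
  rw [List.getD_append_right _ _ _ _ (by omega)]
  congr 1; omega

theorem mul_add_div_mod (u v : Fin n) :
    (n * (u : ℕ) + v) / n = u ∧ (n * (u : ℕ) + v) % n = v := by
  have h0 : 0 < n := u.pos
  exact ⟨by rw [Nat.mul_add_div h0, Nat.div_eq_of_lt v.isLt, Nat.add_zero],
    by rw [Nat.mul_add_mod, Nat.mod_eq_of_lt v.isLt]⟩

theorem mul_add_lt (u v : Fin n) : n * (u : ℕ) + v < n * n := by
  have := Nat.mul_le_mul_left n u.isLt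
  rw [Nat.mul_succ] at this
  omega

/-- The flattened matrix is reindexed by `Fin (n * n)`, where row and column are quotient and
remainder modulo n. -/
theorem encodeGraph_getD (G : SimpleGraph (Fin n)) (u v : Fin n) :
    (encodeGraph G).getD (n * u + v) 0 ≠ 0 ↔ G.Adj u v := by
  classical
  have key : encodeGraph G = List.ofFn fun i : Fin (n * n) =>
      if G.Adj i.divNat i.modNat then 1 else 0 := by
    rw [List.ofFn_mul', encodeGraph]
    congr! with a b
    · exact Fin.ext (mul_add_div_mod a b).1.symm
    · exact Fin.ext (mul_add_div_mod a b).2.symm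
  have hu : (⟨n * u + v, mul_add_lt u v⟩ : Fin (n * n)).divNat = u :=
    Fin.ext (mul_add_div_mod u v).1
  have hv : (⟨n * u + v, mul_add_lt u v⟩ : Fin (n * n)).modNat = v :=
    Fin.ext (mul_add_div_mod u v).2
  rw [key, List.getD_eq_getElem _ _ (by simpa using mul_add_lt u v), List.getElem_ofFn, hu, hv]
  simp

theorem encodeInput_length (G H : SimpleGraph (Fin n)) (α β : G.Coloring (Fin k)) :
    (encodeInput G H α β).length = 2 + 2 * n + 2 * (n * n) := by
  simp [encodeInput, encodeGraph_length, encodeColoring]; ring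

theorem encodeColoring_getD {G : SimpleGraph (Fin n)} (α : G.Coloring (Fin k)) (u : Fin n) :
    (encodeColoring α).getD u 0 = α u := by
  rw [encodeColoring, List.getD_eq_getElem _ _ (by simp), List.getElem_ofFn]

theorem describesInput_initialStore (G H : SimpleGraph (Fin n)) (α β : G.Coloring (Fin k)) :
    DescribesInput (initialStore (encodeInput G H α β)) G H := by
  refine ⟨rfl, fun u v => ?_, fun u v => ?_⟩
  · rw [← encodeGraph_getD]
    change (encodeInput G H α β).getD _ 0 ≠ 0 ↔ _
    simp only [encodeInput, List.append_assoc]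
    rw [getD_append_of_length (l := [n, k]) (m := 2) rfl, List.getD_append _ _ _ _ (by
      rw [encodeGraph_length]; exact mul_add_lt u v)]
  · rw [← encodeGraph_getD]
    change (encodeInput G H α β).getD _ 0 ≠ 0 ↔ _
    simp only [encodeInput, List.append_assoc]
    rw [getD_append_of_length (l := [n, k]) (m := 2) rfl, Nat.mul_add, Nat.add_assoc,
      getD_append_of_length (encodeGraph_length G), List.getD_append _ _ _ _ (by
      rw [encodeGraph_length]; exact mul_add_lt u v)]

theorem encodeInput_coloring (G H : SimpleGraph (Fin n)) (α β : G.Coloring (Fin k)) (u : Fin n) :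
    (encodeInput G H α β).getD (2 + (n * (n + n) + (0 + u))) 0 = α u ∧
      (encodeInput G H α β).getD (2 + (n * (n + n) + (n + u))) 0 = β u := by
  have hlen : (encodeColoring α).length = n := by simp [encodeColoring]
  simp only [encodeInput, List.append_assoc]
  rw [Nat.mul_add, Nat.add_assoc, Nat.add_assoc]
  constructor
  · rw [getD_append_of_length (l := [n, k]) (m := 2) rfl, getD_append_of_length (encodeGraph_length G),
      getD_append_of_length (encodeGraph_length H), Nat.zero_add, List.getD_append _ _ _ _
      (by rw [hlen]; exact u.isLt), encodeColoring_getD]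
  · rw [getD_append_of_length (l := [n, k]) (m := 2) rfl, getD_append_of_length (encodeGraph_length G),
      getD_append_of_length (encodeGraph_length H), getD_append_of_length hlen,
      encodeColoring_getD]

end

/-- The algorithm finds a short sequence of Kempe changes. -/
theorem exists_kempeSequence_of_witness {n k w : ℕ} {G H : SimpleGraph (Fin n)}
    (hH : IsTreewidthWitness G H w) (hk : w + 1 ≤ k) (α β : G.Coloring (Fin k)) :
    ∃ l : List (Fin n × Fin k),
      (recolouringCmd.run (initialStore (encodeInput G H α β)) []).out = encodeMoves l ∧
      IsKempeSequence α l β ∧ l.length ≤ 2 * max w 1 * n ^ 2 :=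
  recolouringCmd_correct (describesInput_initialStore G H α β) hH hk
    (fun u => (encodeInput_coloring G H α β u).1) (fun u => (encodeInput_coloring G H α β u).2)
    (fun _ => rfl) rfl []

end Kempe

/-! ### Both statements -/

theorem theorem3 :
    (∃ C : ℕ, ∀ (V : Type*) [Fintype V] (G : SimpleGraph V) (k : ℕ),
      Kempe.treewidth G + 1 ≤ k →
      ∀ α β : G.Coloring (Fin k), ∃ l : List (V × Fin k),
        Kempe.IsKempeSequence α l β ∧
        l.length ≤ C * max (Kempe.treewidth G) 1 * Fintype.card V ^ 2) ∧
    (∃ (P : Kempe.Prog) (C d : ℕ), ∀ (n k w : ℕ) (G H : SimpleGraph (Fin n)),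
      Kempe.IsTreewidthWitness G H w → w + 1 ≤ k →
      ∀ α β : G.Coloring (Fin k), ∃ l : List (Fin n × Fin k),
        Kempe.OutputsWithin P (Kempe.encodeInput G H α β) (Kempe.encodeMoves l)
          (C * k * (n + 1) ^ d) ∧
        Kempe.IsKempeSequence α l β ∧
        l.length ≤ C * max w 1 * n ^ 2) := by
  constructor
  · refine ⟨2, fun V _ G k hk α β => ?_⟩
    obtain ⟨H, hH⟩ := Kempe.exists_isTreewidthWitness G
    -- The algorithm is run on a copy of `G` with vertex set `Fin n`, and its Kempe changes are
    -- carried back along `e`.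
    let e := SimpleGraph.Iso.map (Fintype.equivFin V) G
    obtain ⟨l, -, hl, hlen⟩ := Kempe.exists_kempeSequence_of_witness
      (hH.map (Fintype.equivFin V)) hk (Kempe.mapColoring e α) (Kempe.mapColoring e β)
    exact ⟨_, hl.of_mapColoring e, by simpa using hlen⟩
  · obtain ⟨P, C, d, hP⟩ := Kempe.Cmd.exists_prog Kempe.recolouringCmd
    -- The same constant has to serve for the running time (C) and for the number of Kempe changes
    -- (2).
    refine ⟨P, C + 2, d, fun n k w G H hH hk α β => ?_⟩
    obtain ⟨l, hout, hl, hlen⟩ := Kempe.exists_kempeSequence_of_witness hH hk α β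
    refine ⟨l, ?_, hl, hlen.trans (by gcongr; omega)⟩
    obtain ⟨t, s, ht, hrun, hs⟩ := hP n (Kempe.encodeInput G H α β) rfl
      (Kempe.encodeInput_length G H α β)
    refine ⟨t, s, ht.trans ?_, hrun, hs.trans hout⟩
    -- The running time is bounded independently of k; the factor k is only inserted, as k ≥ 1.
    have : C * 1 ≤ (C + 2) * k := Nat.mul_le_mul (by omega) (by omega)
    rw [Nat.mul_one] at this
    gcongr
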